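/- Let $\{\omega_n\}_{n\ge1},\{\zeta_n\}_{n\ge1}$ be sequences of complex numbers and $\{r_n\}_{n\ge1}$ a sequence of real numbers, each consisting of pairwise distinct terms, let $c_n,d_n\in\mathbb C$ ($n\ge 1$) and $\eta\in\mathbb R$, and suppose that for all $n,m\ge1$ $$\omega_n\ne\zeta_m,\quad \omega_n\ne\overline{\zeta_m},\quad \omega_n\ne-\overline{\zeta_m},\quad \zeta_n\ne-\overline{\zeta_m},\quad r_n\ne i\omega_m,\quad r_n\ne i\zeta_m,\quad r_n\ne-\eta,\quad \zeta_n\ne0 .$$ Let $\gamma>0$, $\alpha>0$, $\chi<0$, $n'\in\mathbb N$ $(n'\ge1)$, $\mu>0$, $\nu>1/2$, $M>0$ be such that $$\liminf_{n\to\infty}(\Re\omega_{n+1}-\Re\omega_n)=\liminf_{n\to\infty}(\Re\zeta_{n+1}-\Re\zeta_n)=\gamma,$$ $$\lim_{n\to\infty}\Im\omega_n=\alpha,\qquad \lim_{n\to\infty}r_n=\chi,\qquad \lim_{n\to\infty}\Im\zeta_n=0,$$ $$a|d_n|\le|\zeta_n|\le b|d_n|\ \text{ for all } n \text{ with some constants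 } a,b>0,\qquad |c_n|\,|\omega_n|\le M\ \text{ for all } n .$$ Let $T>2\pi/\gamma$. Then there are constants $c_1,c_2>0$, not depending on the coefficients below, such that the following holds for all $C_n,D_n\in\mathbb C$, $R_n\in\mathbb R$ $(n\ge1)$ and $\mathcal E\in\mathbb R$ that satisfy $$\sum_{n=1}^\infty\big(|C_n|^2+|d_nD_n|^2\big)<\infty,\qquad |C_n|\le M|d_nD_n|\ \ (n\ge1),\qquad |\mathcal E|^2\le M\sum_{n=1}^\infty\big(|C_n|^2+|d_nD_n|^2\big),$$ $$|R_n|\le\frac{\mu}{n^\nu}\big(|C_n|^2+|d_nD_n|^2\big)^{1/2}\ \ (n\ge n'),\qquad |R_n|\le\mu\big(|C_n|^2+|d_nD_n|^2\big)^{1/2}\ \ (n\le n').$$ The series $$u_1(t)=\sum_{n=1}^\infty\Big(C_ne^{i\omega_nt}+\overline{C_n}e^{-i\overline{\omega_n}t}+R_ne^{r_nt}+D_ne^{i\zeta_nt}+\overline{D_n}e^{-i\overline{\zeta_n}t}\Big),$$ $$u_2(t)=\sum_{n=1}^\infty\Big(d_nD_ne^{i\zeta_nt}+\overline{d_nD_n}e^{-i\overline{\zeta_n}t}+c_nC_ne^{i\omega_nt}+\overline{c_nC_n}e^{-i\overline{\omega_n}t}\Big)+\mathcal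 E e^{-\eta t}$$ converge in $L^2(0,T)$, and $$c_1\int_0^T\big(|u_1(t)|^2+|u_2(t)|^2\big)\,dt\le\sum_{n=1}^\infty\big(|C_n|^2+|d_nD_n|^2\big)\le c_2\int_0^T\big(|u_1(t)|^2+|u_2(t)|^2\big)\,dt .$$ -/

import Mathlib

open Filter Topology MeasureTheory

noncomputable section

namespace WaveMemory

/-- The series with terms `f 0, f 1, f 2, …` converges to `u` in `L²(0,T)`
(convergence of the partial sums in the `L²` norm). -/
def IsL2Sum (T : ℝ) (f : ℕ → ℝ → ℂ) (u : ℝ → ℂ) : Prop :=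
  MemLp u 2 (volume.restrict (Set.Ioc 0 T)) ∧
    Tendsto (fun N : ℕ => eLpNorm (fun t => u t - ∑ n ∈ Finset.range N, f n t) 2
      (volume.restrict (Set.Ioc 0 T))) atTop (𝓝 0)

/-- The pair `z e^{iσt} + conj z e^{-i (conj σ) t}`. -/
def wavePair (z σ : ℂ) (t : ℝ) : ℂ :=
  z * Complex.exp (Complex.I * σ * t) +
    starRingEnd ℂ z * Complex.exp (-Complex.I * starRingEnd ℂ σ * t)

/-- The `n`-th term of the series of the first component. -/
def term₁ (ω ζ : ℕ → ℂ) (r : ℕ → ℝ) (C D : ℕ → ℂ) (R : ℕ → ℝ) (n : ℕ) (t : ℝ) : ℂ :=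
  wavePair (C n) (ω n) t + ((R n * Real.exp (r n * t) : ℝ) : ℂ) + wavePair (D n) (ζ n) t

/-- The `n`-th term of the series of the second component. -/
def term₂ (ω ζ c d : ℕ → ℂ) (C D : ℕ → ℂ) (n : ℕ) (t : ℝ) : ℂ :=
  wavePair (d n * D n) (ζ n) t + wavePair (c n * C n) (ω n) t

/-- `u₁` is the sum in `L²(0,T)` of its series, and `u₂` is the sum in `L²(0,T)` of its series
plus the extra term `𝓔 e^{-ηt}`. -/
def IsSolutionPair (T η : ℝ) (ω ζ : ℕ → ℂ) (r : ℕ → ℝ) (c d : ℕ → ℂ)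
    (C D : ℕ → ℂ) (R : ℕ → ℝ) (𝓔 : ℝ) (u₁ u₂ : ℝ → ℂ) : Prop :=
  IsL2Sum T (term₁ ω ζ r C D R) u₁ ∧
    IsL2Sum T (term₂ ω ζ c d C D) (fun t => u₂ t - ((𝓔 * Real.exp (-η * t) : ℝ) : ℂ))

/-- The quantity `|Cₙ|² + |dₙ Dₙ|²`. -/
def energy (d C D : ℕ → ℂ) (n : ℕ) : ℝ := ‖C n‖ ^ 2 + ‖d n * D n‖ ^ 2

/-- The conditions on the coefficients `C, D, R, 𝓔` of the two series. Index `n` stands for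
the `(n+1)`-st member of each sequence, hence the weight `(n+1)^ν`. -/
structure AdmissibleCoeffs (d : ℕ → ℂ) (N₀ : ℕ) (μ ν M : ℝ)
    (C D : ℕ → ℂ) (R : ℕ → ℝ) (𝓔 : ℝ) : Prop where
  summable_energy : Summable (energy d C D)
  bound_R_ge : ∀ n, N₀ ≤ n → |R n| ≤ μ / ((n : ℝ) + 1) ^ ν * Real.sqrt (energy d C D n)
  bound_R_le : ∀ n, n ≤ N₀ → |R n| ≤ μ * Real.sqrt (energy d C D n)
  bound_E : |𝓔| ^ 2 ≤ M * ∑' n, energy d C D n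
  bound_C : ∀ n, ‖C n‖ ≤ M * ‖d n * D n‖

end WaveMemory

end

/-! The coefficients are placed in one sequence `x` indexed by ℕ × `Fin 6`, with slots C, its
conjugate, dD, its conjugate, (n+1)^ν R and 𝓔 (at n = 0 only). The pair (u₁, u₂) becomes the sum of
x_p v_p with v_p in L²(0,T) × L²(0,T). Since c_n → 0 and 1/d_n → 0, the exponentials in ω_n dominate
the first component and those in ζ_n the second, while the cross terms have weights tending to zero.
The damped exponentials are summable against n^(-ν) because ν > 1/2, so they too form a compact
perturbation.

The bound of the norm by the coefficients is a Bessel inequality, obtained family by family from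
Ingham's upper estimate (`ingham_upper`). For the reverse bound, `ingham_lower`, valid on tails
because T > 2π/γ, gives coercivity up to a compact weighted sum (`Regular.exists_coercive`). The
compact term is removed by compactness–uniqueness (`exists_observability_of_compact`): normalised
counterexamples have a coordinatewise limit lying in the kernel, and if the kernel is trivial the
compact term tends to zero, contradicting coercivity.

Uniqueness (`Regular.coeff_eq_zero`) rests on invariance under time translation. Difference
quotients of a null sequence are null on a shorter interval, where coercivity bounds them, so
multiplication by the exponents σ preserves null sequences at a geometric rate. A null sequence
therefore lives on bounded exponents. In the second component, which contains no e^{r_n t}, only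
finitely many terms remain, and a Vandermonde argument isolates each ζ_n. Once every d_nD_n
vanishes, the bounds on C and R leave only 𝓔 e^{-ηt}, which must vanish as well. -/

noncomputable section

namespace WaveMemory

/-! ### Weighted Bessel inequalities in a Hilbert space. -/

section Bessel

variable {J V : Type*} [NormedAddCommGroup V] [InnerProductSpace ℂ V]

/-- The finite combinations of the vectors `v j` satisfy a weighted Bessel inequality. -/
def BesselBound (v : J → V) (θ : J → ℝ) : Prop :=
  ∀ (G : Finset J) (x : J → ℂ), ‖∑ j ∈ G, x j • v j‖ ^ 2 ≤ ∑ j ∈ G, θ j * ‖x j‖ ^ 2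

theorem BesselBound.mono {v : J → V} {θ θ' : J → ℝ} (h : BesselBound v θ) (hθ : ∀ j, θ j ≤ θ' j) :
    BesselBound v θ' := fun G x =>
  (h G x).trans (Finset.sum_le_sum fun j _ => mul_le_mul_of_nonneg_right (hθ j) (by positivity))

theorem BesselBound.smul {v : J → V} {θ : J → ℝ} (h : BesselBound v θ) (w : J → ℂ) :
    BesselBound (fun j => w j • v j) (fun j => θ j * ‖w j‖ ^ 2) := by
  intro G x
  have := h G (fun j => x j * w j)
  simp only [mul_smul, norm_mul, mul_pow] at this
  refine this.trans (Finset.sum_le_sum fun j _ => le_of_eq (by ring))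

theorem BesselBound.summable [CompleteSpace V] {v : J → V} {K : ℝ} (h : BesselBound v fun _ => K)
    {x : J → ℂ} (hx : Summable fun j => ‖x j‖ ^ 2) : Summable fun j => x j • v j := by
  rw [summable_iff_vanishing_norm]
  intro ε hε
  have hK : 0 < |K| + 1 := by positivity
  obtain ⟨s, hs⟩ := (summable_iff_vanishing_norm.1 hx) (ε ^ 2 / (|K| + 1)) (by positivity)
  refine ⟨s, fun t ht => ?_⟩
  have h1 := hs t ht
  rw [Real.norm_of_nonneg (Finset.sum_nonneg fun _ _ => by positivity), lt_div_iff₀ hK] at h1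
  have h2 := h t x
  rw [← Finset.mul_sum] at h2
  have h3 : 0 ≤ ∑ j ∈ t, ‖x j‖ ^ 2 := Finset.sum_nonneg fun _ _ => by positivity
  refine lt_of_pow_lt_pow_left₀ 2 hε.le ?_
  nlinarith [le_abs_self K]

theorem BesselBound.norm_sq_le {v : J → V} {θ : J → ℝ} (h : BesselBound v θ) {x : J → ℂ} {y : V}
    (hy : HasSum (fun j => x j • v j) y) (hx : Summable fun j => θ j * ‖x j‖ ^ 2) :
    ‖y‖ ^ 2 ≤ ∑' j, θ j * ‖x j‖ ^ 2 :=
  le_of_tendsto_of_tendsto' (Tendsto.pow (Tendsto.norm hy) 2) hx.hasSum (fun G => h G x)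

/-- Duality: the inequality is tested on the coefficients conj⟨y, v_j⟩, for which pairing the
combination with y gives the very sum to be bounded, and one factor of it cancels. -/
theorem BesselBound.summable_inner {v : J → V} {K : ℝ} (h : BesselBound v fun _ => K) (y : V) :
    Summable fun j => ‖inner ℂ y (v j)‖ ^ 2 := by
  refine summable_of_sum_le (c := |K| * ‖y‖ ^ 2) (fun _ => by positivity) fun G => ?_
  set s := ∑ j ∈ G, ‖inner ℂ y (v j)‖ ^ 2 with hs
  have hs0 : 0 ≤ s := Finset.sum_nonneg fun _ _ => by positivity
  have h1 := h G (fun j => starRingEnd ℂ (inner ℂ y (v j)))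
  simp only [RCLike.norm_conj, ← Finset.mul_sum] at h1
  have h2 : inner ℂ y (∑ j ∈ G, starRingEnd ℂ (inner ℂ y (v j)) • v j) = (s : ℂ) := by
    rw [inner_sum, hs]
    push_cast
    refine Finset.sum_congr rfl fun j _ => ?_
    rw [inner_smul_right]
    exact RCLike.conj_mul _
  have h3 := norm_inner_le_norm (𝕜 := ℂ) y (∑ j ∈ G, starRingEnd ℂ (inner ℂ y (v j)) • v j)
  rw [h2, Complex.norm_real, Real.norm_of_nonneg hs0] at h3
  have h4 : s ^ 2 ≤ ‖y‖ ^ 2 * (K * s) := by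
    calc s ^ 2 ≤ (‖y‖ * ‖∑ j ∈ G, starRingEnd ℂ (inner ℂ y (v j)) • v j‖) ^ 2 := by gcongr
      _ ≤ _ := by rw [mul_pow]; gcongr
  rcases hs0.eq_or_lt with h5 | h5
  · rw [← h5]; positivity
  · have h6 : s ≤ ‖y‖ ^ 2 * K := by
      refine le_of_mul_le_mul_right ?_ h5
      nlinarith
    nlinarith [le_abs_self K, sq_nonneg ‖y‖]

theorem BesselBound.abs_const {v : J → V} {K : ℝ} (h : BesselBound v fun _ => K) :
    BesselBound v fun _ => |K| := h.mono fun _ => le_abs_self K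

end Bessel

/-! ### Bounded sequences in ℓ² converging coordinatewise. -/

section Sequences

variable {J : Type*}

theorem tendsto_tsum_zero_of_uniform_tail {F : ℕ → J → ℝ} (h0 : ∀ k j, 0 ≤ F k j)
    (hs : ∀ k, Summable (F k)) (hF : ∀ j, Tendsto (fun k => F k j) atTop (𝓝 0))
    (ht : ∀ ε > 0, ∃ s : Finset J, ∀ k, ∀ t : Finset J, Disjoint t s → ∑ j ∈ t, F k j ≤ ε) :
    Tendsto (fun k => ∑' j, F k j) atTop (𝓝 0) := by
  classical
  rw [Metric.tendsto_atTop]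
  intro ε hε
  obtain ⟨s, hs'⟩ := ht (ε / 3) (by positivity)
  have h1 : Tendsto (fun k => ∑ j ∈ s, F k j) atTop (𝓝 0) := by
    simpa using tendsto_finsetSum s (fun j _ => hF j)
  obtain ⟨N, hN⟩ := (Metric.tendsto_atTop.1 h1) (ε / 3) (by positivity)
  refine ⟨N, fun k hk => ?_⟩
  have h2 := hN k hk
  rw [Real.dist_eq, sub_zero] at h2 ⊢
  rw [abs_of_nonneg (tsum_nonneg (h0 k))]
  have h3 : ∑' j, F k j ≤ ε / 3 + ε / 3 := by
    refine (hs k).tsum_le_of_sum_le fun t => ?_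
    calc ∑ j ∈ t, F k j ≤ ∑ j ∈ s ∪ t, F k j :=
          Finset.sum_le_sum_of_subset_of_nonneg Finset.subset_union_right fun _ _ _ => h0 _ _
      _ = ∑ j ∈ s, F k j + ∑ j ∈ t \ s, F k j := by
          rw [← Finset.union_sdiff_self_eq_union, Finset.sum_union Finset.disjoint_sdiff]
      _ ≤ _ := add_le_add ((le_abs_self _).trans h2.le) (hs' k _ Finset.sdiff_disjoint)
  linarith

/-- Boundedness in ℓ² together with coordinatewise convergence is weak convergence; the tails are
uniformly small because g is square summable. -/
theorem tendsto_tsum_mul_zero {x : ℕ → J → ℂ} {g : J → ℂ} {B : ℝ}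
    (hx : ∀ k, Summable fun j => ‖x k j‖ ^ 2) (hB : ∀ k, ∑' j, ‖x k j‖ ^ 2 ≤ B)
    (hx0 : ∀ j, Tendsto (fun k => x k j) atTop (𝓝 0)) (hg : Summable fun j => ‖g j‖ ^ 2) :
    Tendsto (fun k => ∑' j, x k j * g j) atTop (𝓝 0) := by
  have hle : ∀ k j, ‖x k j * g j‖ ≤ ‖x k j‖ ^ 2 + ‖g j‖ ^ 2 := fun k j => by
    rw [norm_mul]; nlinarith [sq_nonneg (‖x k j‖ - ‖g j‖), norm_nonneg (x k j), norm_nonneg (g j)]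
  have hs : ∀ k, Summable fun j => ‖x k j * g j‖ := fun k =>
    Summable.of_nonneg_of_le (fun _ => norm_nonneg _) (hle k) ((hx k).add hg)
  have hB0 : 0 ≤ B := (tsum_nonneg fun _ => by positivity).trans (hB 0)
  have key : Tendsto (fun k => ∑' j, ‖x k j * g j‖) atTop (𝓝 0) := by
    refine tendsto_tsum_zero_of_uniform_tail (fun _ _ => norm_nonneg _) hs ?_ ?_
    · intro j
      simpa using ((hx0 j).mul_const (g j)).norm
    · intro ε hε
      -- Young's inequality with parameter δ bounds the tail by δB + δ⁻¹δ² = δ(B + 1) = ε.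
      set δ := ε / (B + 1) with hδ
      have hδ0 : 0 < δ := by positivity
      obtain ⟨s, hs⟩ := (summable_iff_vanishing_norm.1 hg) (δ ^ 2) (by positivity)
      refine ⟨s, fun k t ht => ?_⟩
      have h1 := hs t ht
      rw [Real.norm_of_nonneg (Finset.sum_nonneg fun _ _ => by positivity)] at h1
      have h2 : ∑ j ∈ t, ‖x k j‖ ^ 2 ≤ B :=
        ((hx k).sum_le_tsum t fun _ _ => by positivity).trans (hB k)
      have h3 : ∀ j ∈ t, ‖x k j * g j‖ ≤ δ * ‖x k j‖ ^ 2 + δ⁻¹ * ‖g j‖ ^ 2 := fun j _ => by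
        rw [norm_mul]
        have e : δ * ‖x k j‖ ^ 2 + δ⁻¹ * ‖g j‖ ^ 2 - 2 * (‖x k j‖ * ‖g j‖)
            = δ⁻¹ * (δ * ‖x k j‖ - ‖g j‖) ^ 2 := by field_simp; ring
        have : 0 ≤ δ⁻¹ * (δ * ‖x k j‖ - ‖g j‖) ^ 2 := by positivity
        nlinarith [mul_nonneg (norm_nonneg (x k j)) (norm_nonneg (g j))]
      calc _ ≤ _ := Finset.sum_le_sum h3
        _ = δ * ∑ j ∈ t, ‖x k j‖ ^ 2 + δ⁻¹ * ∑ j ∈ t, ‖g j‖ ^ 2 := by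
            rw [Finset.sum_add_distrib, Finset.mul_sum, Finset.mul_sum]
        _ ≤ δ * B + δ⁻¹ * δ ^ 2 := by gcongr
        _ = ε := by rw [hδ]; field_simp
  refine squeeze_zero_norm (fun k => ?_) key
  exact norm_tsum_le_tsum_norm (hs k)

/-- A diagonal operator whose weights tend to zero is compact, hence turns weak convergence into
strong convergence. -/
theorem tendsto_tsum_weight_zero {x : ℕ → J → ℂ} {θ : J → ℝ} {B : ℝ} (hθ0 : ∀ j, 0 ≤ θ j)
    (hθ : ∀ ε > 0, {j | ε < θ j}.Finite)
    (hx : ∀ k, Summable fun j => ‖x k j‖ ^ 2) (hB : ∀ k, ∑' j, ‖x k j‖ ^ 2 ≤ B)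
    (hx0 : ∀ j, Tendsto (fun k => x k j) atTop (𝓝 0))
    (hs : ∀ k, Summable fun j => θ j * ‖x k j‖ ^ 2) :
    Tendsto (fun k => ∑' j, θ j * ‖x k j‖ ^ 2) atTop (𝓝 0) := by
  have hB0 : 0 ≤ B := (tsum_nonneg fun _ => by positivity).trans (hB 0)
  refine tendsto_tsum_zero_of_uniform_tail (fun k j => mul_nonneg (hθ0 j) (by positivity)) hs ?_ ?_
  · intro j
    simpa using (((hx0 j).norm.pow 2).const_mul (θ j))
  · intro ε hε
    have hδ : 0 < ε / (B + 1) := by positivity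
    refine ⟨(hθ _ hδ).toFinset, fun k t ht => ?_⟩
    have h2 : ∑ j ∈ t, ‖x k j‖ ^ 2 ≤ B :=
      ((hx k).sum_le_tsum t fun _ _ => by positivity).trans (hB k)
    calc _ ≤ ∑ j ∈ t, ε / (B + 1) * ‖x k j‖ ^ 2 := by
          refine Finset.sum_le_sum fun j hj => mul_le_mul_of_nonneg_right ?_ (by positivity)
          have := Finset.disjoint_left.1 ht hj
          simpa using this
      _ = ε / (B + 1) * ∑ j ∈ t, ‖x k j‖ ^ 2 := by rw [Finset.mul_sum]
      _ ≤ ε / (B + 1) * B := by gcongr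
      _ ≤ ε := by rw [div_mul_eq_mul_div, div_le_iff₀ (by positivity)]; nlinarith

theorem summable_norm_sq_of_tendsto {x : ℕ → J → ℂ} {a : J → ℂ} {B : ℝ}
    (hx : ∀ k, Summable fun j => ‖x k j‖ ^ 2) (hB : ∀ k, ∑' j, ‖x k j‖ ^ 2 ≤ B)
    (hxa : ∀ j, Tendsto (fun k => x k j) atTop (𝓝 (a j))) : Summable fun j => ‖a j‖ ^ 2 := by
  refine summable_of_sum_le (c := B) (fun _ => by positivity) fun G => ?_
  refine le_of_tendsto (tendsto_finsetSum G fun j _ => ((hxa j).norm.pow 2))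
    (Eventually.of_forall fun k => ?_)
  exact ((hx k).sum_le_tsum G fun _ _ => by positivity).trans (hB k)

end Sequences

/-! ### The compactness–uniqueness argument. -/

section Compactness

variable {J V : Type*} [NormedAddCommGroup V] [InnerProductSpace ℂ V] [CompleteSpace V]

/-- The synthesis map x ↦ ∑ x_j v_j is bounded on ℓ², hence weakly continuous, so the weak limit of
the coefficients is mapped to the limit of the sums. Weak convergence is tested against each vector
y. -/
theorem BesselBound.tsum_eq_zero_of_tendsto {v : J → V} {K : ℝ} (h : BesselBound v fun _ => K)
    {x : ℕ → J → ℂ} {a : J → ℂ} {B : ℝ}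
    (hx : ∀ k, Summable fun j => ‖x k j‖ ^ 2) (hB : ∀ k, ∑' j, ‖x k j‖ ^ 2 ≤ B)
    (hxa : ∀ j, Tendsto (fun k => x k j) atTop (𝓝 (a j)))
    (hS : Tendsto (fun k => ∑' j, x k j • v j) atTop (𝓝 0)) : ∑' j, a j • v j = 0 := by
  have ha := summable_norm_sq_of_tendsto hx hB hxa
  have hle : ∀ k j, ‖x k j - a j‖ ^ 2 ≤ 2 * ‖x k j‖ ^ 2 + 2 * ‖a j‖ ^ 2 := fun k j => by
    have := norm_sub_le (x k j) (a j)
    nlinarith [sq_nonneg (‖x k j‖ - ‖a j‖), norm_nonneg (x k j - a j)]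
  have hd : ∀ k, Summable fun j => ‖x k j - a j‖ ^ 2 := fun k =>
    Summable.of_nonneg_of_le (fun _ => by positivity) (hle k)
      (((hx k).mul_left 2).add (ha.mul_left 2))
  have hdB : ∀ k, ∑' j, ‖x k j - a j‖ ^ 2 ≤ 2 * B + 2 * ∑' j, ‖a j‖ ^ 2 := fun k => by
    refine ((hd k).tsum_le_tsum (hle k) (((hx k).mul_left 2).add (ha.mul_left 2))).trans ?_
    rw [Summable.tsum_add ((hx k).mul_left 2) (ha.mul_left 2), tsum_mul_left, tsum_mul_left]
    gcongr
    exact hB k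
  refine ext_inner_left ℂ fun y => ?_
  rw [inner_zero_right]
  have h1 : Tendsto (fun k => ∑' j, (x k j - a j) * inner ℂ y (v j)) atTop (𝓝 0) := by
    refine tendsto_tsum_mul_zero hd hdB (fun j => ?_) (h.summable_inner y)
    simpa using (hxa j).sub_const (a j)
  have h2 : ∀ k, ∑' j, (x k j - a j) * inner ℂ y (v j)
      = inner ℂ y (∑' j, x k j • v j) - inner ℂ y (∑' j, a j • v j) := fun k => by
    have h3 := ((h.summable (hx k)).hasSum.sub (h.summable ha).hasSum).mapL (innerSL ℂ y)
    rw [← inner_sub_right]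
    refine HasSum.tsum_eq ?_
    have h4 : (fun j => innerSL ℂ y (x k j • v j - a j • v j))
        = fun j => (x k j - a j) * inner ℂ y (v j) := by
      funext j
      rw [← sub_smul]
      exact inner_smul_right _ _ _
    rw [h4] at h3
    exact h3
  simp only [h2] at h1
  have h4 : Tendsto (fun k => inner ℂ y (∑' j, x k j • v j)) atTop (𝓝 (inner ℂ y (0 : V))) :=
    (Filter.Tendsto.inner tendsto_const_nhds hS)
  have h5 := tendsto_nhds_unique h1 (h4.sub_const _)
  simpa using h5

/-- Compactness–uniqueness: an inequality which holds up to a compact term on a cone holds without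
this term if the closure of the cone meets the kernel trivially. -/
theorem exists_observability_of_compact [Countable J] {v : J → V} {K Λ : ℝ}
    (h : BesselBound v fun _ => K) {θ : J → ℝ} (hθ0 : ∀ j, 0 ≤ θ j)
    (hθ : ∀ ε > 0, {j | ε < θ j}.Finite) {Kθ : ℝ} (hθb : ∀ j, θ j ≤ Kθ)
    {𝓚 𝓐 : Set (J → ℂ)} (hsub : 𝓚 ⊆ 𝓐) (hcl : IsClosed 𝓐)
    (hcone : ∀ x ∈ 𝓚, ∀ s : ℝ, 0 < s → (fun j => (s : ℂ) * x j) ∈ 𝓚)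
    (hl2 : ∀ x ∈ 𝓚, Summable fun j => ‖x j‖ ^ 2)
    (hcoer : ∀ x ∈ 𝓚, ∑' j, ‖x j‖ ^ 2 ≤
      Λ * (‖∑' j, x j • v j‖ ^ 2 + ∑' j, θ j * ‖x j‖ ^ 2))
    (hker : ∀ x ∈ 𝓐, (Summable fun j => ‖x j‖ ^ 2) → ∑' j, x j • v j = 0 → x = 0) :
    ∃ c > 0, ∀ x ∈ 𝓚, ∑' j, ‖x j‖ ^ 2 ≤ c * ‖∑' j, x j • v j‖ ^ 2 := by
  by_contra! hcon
  have hk : ∀ k : ℕ, ∃ x ∈ 𝓚, ∑' j, ‖x j‖ ^ 2 = 1 ∧ ‖∑' j, x j • v j‖ ^ 2 ≤ 1 / ((k : ℝ) + 1) := by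
    intro k
    obtain ⟨x, hx, hlt⟩ := hcon (k + 1) (by positivity)
    set E := ∑' j, ‖x j‖ ^ 2 with hE
    have hE0 : 0 < E := lt_of_le_of_lt (by positivity) hlt
    -- The cone is invariant under positive scaling, so the counterexample for the constant k + 1 is
    -- normalised to ℓ² norm one.
    have hs : 0 < (Real.sqrt E)⁻¹ := by positivity
    have hsq : ((Real.sqrt E)⁻¹) ^ 2 = E⁻¹ := by rw [inv_pow, Real.sq_sqrt hE0.le]
    refine ⟨_, hcone x hx _ hs, ?_, ?_⟩
    · simp only [norm_mul, mul_pow, Complex.norm_real, Real.norm_of_nonneg hs.le, tsum_mul_left, hsq]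
      exact inv_mul_cancel₀ hE0.ne'
    · simp only [mul_smul]
      rw [(h.summable (hl2 x hx)).tsum_const_smul ((((Real.sqrt E)⁻¹ : ℝ)) : ℂ), norm_smul, mul_pow,
        Complex.norm_real, Real.norm_of_nonneg hs.le, hsq, le_div_iff₀ (by positivity),
        inv_mul_eq_div, div_mul_eq_mul_div, div_le_iff₀ hE0]
      linarith
  choose x hxK hx1 hxS using hk
  have hball : ∀ k, x k ∈ Set.pi Set.univ (fun _ : J => Metric.closedBall (0 : ℂ) 1) := by
    intro k j _
    rw [mem_closedBall_zero_iff]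
    have := (hl2 _ (hxK k)).le_tsum j fun _ _ => by positivity
    rw [hx1 k] at this
    nlinarith [norm_nonneg (x k j)]
  -- Tychonoff; countability of the index set provides a convergent subsequence rather than a mere
  -- cluster point.
  obtain ⟨a, -, φ, hφ, hlim⟩ :=
    (isCompact_univ_pi fun _ : J => isCompact_closedBall (0 : ℂ) 1).tendsto_subseq hball
  have hpt : ∀ j, Tendsto (fun k => x (φ k) j) atTop (𝓝 (a j)) := fun j =>
    (tendsto_pi_nhds.1 hlim) j
  have haA : a ∈ 𝓐 := hcl.mem_of_tendsto hlim (Eventually.of_forall fun k => hsub (hxK _))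
  have hl : ∀ k, Summable fun j => ‖x (φ k) j‖ ^ 2 := fun k => hl2 _ (hxK _)
  have hb : ∀ k, ∑' j, ‖x (φ k) j‖ ^ 2 ≤ 1 := fun k => (hx1 _).le
  have ha2 := summable_norm_sq_of_tendsto hl hb hpt
  have hSq : Tendsto (fun k => ‖∑' j, x (φ k) j • v j‖ ^ 2) atTop (𝓝 0) :=
    squeeze_zero (fun _ => by positivity) (fun k => hxS (φ k))
      (tendsto_one_div_add_atTop_nhds_zero_nat.comp hφ.tendsto_atTop)
  have hS : Tendsto (fun k => ∑' j, x (φ k) j • v j) atTop (𝓝 0) := by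
    rw [tendsto_zero_iff_norm_tendsto_zero]
    have := hSq.sqrt
    simpa [Real.sqrt_sq] using this
  have ha0 : a = 0 := hker a haA ha2 (h.tsum_eq_zero_of_tendsto hl hb hpt hS)
  subst ha0
  have hsθ : ∀ k, Summable fun j => θ j * ‖x (φ k) j‖ ^ 2 := fun k =>
    Summable.of_nonneg_of_le (fun j => mul_nonneg (hθ0 j) (by positivity))
      (fun j => mul_le_mul_of_nonneg_right (hθb j) (by positivity)) ((hl k).mul_left Kθ)
  have hT := tendsto_tsum_weight_zero hθ0 hθ hl hb hpt hsθ
  have hfin := (hSq.add hT).const_mul Λ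
  -- With a = 0 both terms on the right of the coercivity inequality tend to zero, while its left
  -- side stays equal to one.
  have : (1 : ℝ) ≤ Λ * (0 + 0) :=
    ge_of_tendsto hfin (Eventually.of_forall fun k => by
      have := hcoer _ (hxK (φ k)); rwa [hx1] at this)
  norm_num at this

end Compactness

/-! ### Null sequences and translation invariance. -/

section Uniqueness

/-- The factor by which the difference quotient of step `h` multiplies `t ↦ exp (i σ t)`. -/
def diffFactor (h : ℝ) (σ : ℂ) : ℂ := (Complex.exp (Complex.I * σ * h) - 1) / h

/-- The bound is uniform in the step h, as the later passage to the limit requires. For |σh| ≤ 1 it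
comes from |e^z - 1| ≤ 2|z|; otherwise e^τ + 1 bounds the numerator trivially and |σh| > 1. -/
theorem norm_diffFactor_le {τ h : ℝ} {σ : ℂ} (hσ : |σ.im| ≤ τ) (h0 : 0 < h) (h1 : h ≤ 1) :
    ‖diffFactor h σ‖ ≤ (Real.exp τ + 1) * ‖σ‖ := by
  have hτ : 0 ≤ τ := (abs_nonneg _).trans hσ
  have he : 1 ≤ Real.exp τ := Real.one_le_exp hτ
  rw [diffFactor, norm_div, Complex.norm_real, Real.norm_of_nonneg h0.le, div_le_iff₀ h0]
  set z := Complex.I * σ * h with hz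
  have hzn : ‖z‖ = ‖σ‖ * h := by simp [hz, abs_of_pos h0]
  rw [mul_assoc, ← hzn]
  by_cases hz1 : ‖z‖ ≤ 1
  · have := Complex.norm_exp_sub_one_le hz1
    nlinarith [norm_nonneg z]
  · have h2 : ‖Complex.exp z‖ ≤ Real.exp τ := by
      rw [Complex.norm_exp, Real.exp_le_exp]
      have : z.re = -σ.im * h := by simp [hz]
      rw [this]
      calc -σ.im * h ≤ |σ.im| * h := by gcongr; exact neg_le_abs _
        _ ≤ τ * 1 := by gcongr
        _ = τ := mul_one _
    calc ‖Complex.exp z - 1‖ ≤ ‖Complex.exp z‖ + ‖(1 : ℂ)‖ := norm_sub_le _ _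
      _ ≤ Real.exp τ + 1 := by rw [norm_one]; gcongr
      _ ≤ (Real.exp τ + 1) * ‖z‖ := le_mul_of_one_le_right (by positivity) (not_le.1 hz1).le

theorem tendsto_diffFactor (σ : ℂ) :
    Tendsto (fun h : ℝ => diffFactor h σ) (𝓝[>] 0) (𝓝 (Complex.I * σ)) := by
  have h1 : HasDerivAt (fun h : ℝ => Complex.exp (Complex.I * σ * h)) (Complex.I * σ) 0 := by
    have h2 : HasDerivAt (fun h : ℝ => Complex.I * σ * (h : ℂ)) (Complex.I * σ) 0 := by
      simpa using (Complex.ofRealCLM.hasDerivAt (x := (0 : ℝ))).const_mul (Complex.I * σ)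
    simpa using h2.cexp
  have h3 := h1.tendsto_slope_zero_right
  refine h3.congr fun h => ?_
  simp [diffFactor, div_eq_inv_mul]

variable {J : Type*} {V : ℝ → Type*} [∀ T, NormedAddCommGroup (V T)]
  [∀ T, InnerProductSpace ℂ (V T)]

/-- Time translation by `h` maps the vectors `v T j` to `exp (i σⱼ h) v T' j`, contractively. -/
def TranslationBound (v : ∀ T, J → V T) (σ : J → ℂ) : Prop :=
  ∀ (T' h T : ℝ), 0 ≤ h → T' + h ≤ T → ∀ (G : Finset J) (x : J → ℂ),
    ‖∑ j ∈ G, (x j * Complex.exp (Complex.I * σ j * h)) • v T' j‖ ≤ ‖∑ j ∈ G, x j • v T j‖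

/-- The square summable sequence `x` is annihilated on every shorter interval. -/
def IsNull (v : ∀ T, J → V T) (T : ℝ) (x : J → ℂ) : Prop :=
  (Summable fun j => ‖x j‖ ^ 2) ∧ ∀ T' < T, HasSum (fun j => x j • v T' j) 0

theorem TranslationBound.restrict {v : ∀ T, J → V T} {σ : J → ℂ} (hv : TranslationBound v σ)
    {T' T : ℝ} (hT : T' ≤ T) (G : Finset J) (x : J → ℂ) :
    ‖∑ j ∈ G, x j • v T' j‖ ≤ ‖∑ j ∈ G, x j • v T j‖ := by
  simpa using hv T' 0 T le_rfl (by simpa using hT) G x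

theorem BesselBound.restrict {v : ∀ T, J → V T} {σ : J → ℂ} (hv : TranslationBound v σ)
    {T' T : ℝ} (hT : T' ≤ T) {θ : J → ℝ} (h : BesselBound (v T) θ) : BesselBound (v T') θ :=
  fun G x => (pow_le_pow_left₀ (norm_nonneg _) (hv.restrict hT G x) 2).trans (h G x)

theorem TranslationBound.hasSum_diffFactor {v : ∀ T, J → V T} {σ : J → ℂ}
    (hv : TranslationBound v σ) {T T' h : ℝ} {x : J → ℂ} (hx : IsNull v T x) (h0 : 0 < h)
    (hT : T' + h < T) : HasSum (fun j => (diffFactor h (σ j) * x j) • v T' j) 0 := by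
  have h1 : HasSum (fun j => (x j * Complex.exp (Complex.I * σ j * h)) • v T' j) 0 :=
    squeeze_zero_norm (fun G => hv T' h (T' + h) h0.le le_rfl G x)
      (tendsto_zero_iff_norm_tendsto_zero.1 (hx.2 _ hT))
  have h2 := (h1.sub (hx.2 T' (by linarith))).const_smul ((h : ℂ)⁻¹)
  rw [sub_zero, smul_zero] at h2
  convert h2 using 1
  funext j
  rw [← sub_smul, smul_smul, diffFactor]
  congr 1
  ring

/-- The difference quotients of x are annihilated on the interval of length T₀, so coercivity leaves
only the compact term, which the bound on θ_j |σ_j|² controls uniformly in h. Letting h → 0 gives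
square summability of σ_j x_j; dominated convergence then shows that this sequence is null. -/
theorem IsNull.mul_exponent [∀ T, CompleteSpace (V T)] {v : ∀ T, J → V T} {σ : J → ℂ} (hv : TranslationBound v σ)
    {T T₀ K τ Λ Θ : ℝ} (hT : T₀ < T) (hK : BesselBound (v T) fun _ => K)
    (hτ : ∀ j, |(σ j).im| ≤ τ) {θ : J → ℝ} (hΛ : 0 ≤ Λ) (hΘ0 : 0 ≤ Θ) (hθ0 : ∀ j, 0 ≤ θ j)
    (hΘ : ∀ j, θ j * ‖σ j‖ ^ 2 ≤ Θ)
    (hcoer : ∀ (G : Finset J) (x : J → ℂ), ∑ j ∈ G, ‖x j‖ ^ 2 ≤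
      Λ * (‖∑ j ∈ G, x j • v T₀ j‖ ^ 2 + ∑ j ∈ G, θ j * ‖x j‖ ^ 2))
    {x : J → ℂ} (hx : IsNull v T x) :
    IsNull v T (fun j => σ j * x j) ∧
      ∑' j, ‖σ j * x j‖ ^ 2 ≤ Λ * (Θ * (Real.exp τ + 1) ^ 2) * ∑' j, ‖x j‖ ^ 2 := by
  set Q := Real.exp τ + 1 with hQ
  have hQ0 : 0 < Q := by positivity
  have hq : ∀ᶠ h : ℝ in 𝓝[>] 0, 0 < h ∧ h ≤ 1 := by
    filter_upwards [Ioc_mem_nhdsGT (zero_lt_one' ℝ)] with h hh using hh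
  have hqT : ∀ T' < T, ∀ᶠ h : ℝ in 𝓝[>] 0, T' + h < T := fun T' hT' => by
    filter_upwards [Ioo_mem_nhdsGT (sub_pos.2 hT')] with h hh
    linarith [hh.2]
  have hfin : ∀ G : Finset J, ∑ j ∈ G, ‖σ j * x j‖ ^ 2 ≤ Λ * (Θ * Q ^ 2) * ∑' j, ‖x j‖ ^ 2 := by
    intro G
    have hlim : Tendsto (fun h : ℝ => ∑ j ∈ G, ‖diffFactor h (σ j) * x j‖ ^ 2) (𝓝[>] 0)
        (𝓝 (∑ j ∈ G, ‖Complex.I * σ j * x j‖ ^ 2)) :=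
      tendsto_finsetSum G fun j _ => (((tendsto_diffFactor (σ j)).mul_const (x j)).norm.pow 2)
    simp only [norm_mul, Complex.norm_I, one_mul] at hlim ⊢
    refine le_of_tendsto hlim ?_
    filter_upwards [hq, hqT T₀ hT] with h ⟨h0, h1⟩ hh
    have hs := hv.hasSum_diffFactor hx h0 hh
    have hle : ∀ j, θ j * ‖diffFactor h (σ j) * x j‖ ^ 2 ≤ Θ * Q ^ 2 * ‖x j‖ ^ 2 := fun j => by
      rw [norm_mul, mul_pow]
      calc θ j * (‖diffFactor h (σ j)‖ ^ 2 * ‖x j‖ ^ 2)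
          ≤ θ j * ((Q * ‖σ j‖) ^ 2 * ‖x j‖ ^ 2) := by
            gcongr
            · exact hθ0 j
            · exact norm_diffFactor_le (hτ j) h0 h1
        _ = θ j * ‖σ j‖ ^ 2 * Q ^ 2 * ‖x j‖ ^ 2 := by ring
        _ ≤ _ := by gcongr; exact hΘ j
    have hA : ∀ G' : Finset J, ∑ j ∈ G', ‖diffFactor h (σ j) * x j‖ ^ 2 ≤
        Λ * (‖∑ j ∈ G', (diffFactor h (σ j) * x j) • v T₀ j‖ ^ 2 +
          Θ * Q ^ 2 * ∑' j, ‖x j‖ ^ 2) := fun G' => by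
      refine (hcoer G' _).trans ?_
      gcongr
      calc _ ≤ ∑ j ∈ G', Θ * Q ^ 2 * ‖x j‖ ^ 2 := Finset.sum_le_sum fun j _ => hle j
        _ = Θ * Q ^ 2 * ∑ j ∈ G', ‖x j‖ ^ 2 := by rw [Finset.mul_sum]
        _ ≤ _ := by
          gcongr
          exact hx.1.sum_le_tsum G' fun _ _ => by positivity
    have hB : Tendsto (fun G' : Finset J =>
        Λ * (‖∑ j ∈ G', (diffFactor h (σ j) * x j) • v T₀ j‖ ^ 2 +
          Θ * Q ^ 2 * ∑' j, ‖x j‖ ^ 2)) atTop (𝓝 (Λ * (‖(0 : V T₀)‖ ^ 2 +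
          Θ * Q ^ 2 * ∑' j, ‖x j‖ ^ 2))) :=
      (((Tendsto.norm hs).pow 2).add_const _).const_mul Λ
    have hC : ∑ j ∈ G, ‖diffFactor h (σ j) * x j‖ ^ 2 ≤ Λ * (‖(0 : V T₀)‖ ^ 2 +
          Θ * Q ^ 2 * ∑' j, ‖x j‖ ^ 2) := by
      refine ge_of_tendsto hB ?_
      filter_upwards [eventually_ge_atTop G] with G' hG
      exact (Finset.sum_le_sum_of_subset_of_nonneg hG fun _ _ _ => by positivity).trans (hA G')
    simp only [norm_mul, norm_zero] at hC
    refine hC.trans (le_of_eq (by ring))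
  have hsum : Summable fun j => ‖σ j * x j‖ ^ 2 :=
    summable_of_sum_le (fun _ => by positivity) hfin
  refine ⟨⟨hsum, fun T' hT' => ?_⟩, hsum.tsum_le_of_sum_le hfin⟩
  have hKT := hK.abs_const.restrict hv hT'.le
  have hsv := (hKT.summable hsum).hasSum
  set y := ∑' j, (σ j * x j) • v T' j with hy
  have hdom : ∀ h : ℝ, 0 < h → h ≤ 1 → ∀ j,
      ‖diffFactor h (σ j) * x j - Complex.I * (σ j * x j)‖ ^ 2 ≤ (Q + 1) ^ 2 * ‖σ j * x j‖ ^ 2 := by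
    intro h h0 h1 j
    rw [← mul_pow]
    gcongr
    calc _ ≤ ‖diffFactor h (σ j) * x j‖ + ‖Complex.I * (σ j * x j)‖ := norm_sub_le _ _
      _ ≤ Q * ‖σ j‖ * ‖x j‖ + ‖σ j‖ * ‖x j‖ := by
        rw [norm_mul, norm_mul, norm_mul, Complex.norm_I, one_mul]
        gcongr
        exact norm_diffFactor_le (hτ j) h0 h1
      _ = _ := by rw [norm_mul]; ring
  have hlim : Tendsto (fun h : ℝ => |K| *
      ∑' j, ‖diffFactor h (σ j) * x j - Complex.I * (σ j * x j)‖ ^ 2) (𝓝[>] 0) (𝓝 (|K| * 0)) := by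
    refine Tendsto.const_mul _ ?_
    have := tendsto_tsum_of_dominated_convergence (𝓕 := 𝓝[>] (0 : ℝ))
      (f := fun h j => ‖diffFactor h (σ j) * x j - Complex.I * (σ j * x j)‖ ^ 2)
      (g := fun _ => 0) (bound := fun j => (Q + 1) ^ 2 * ‖σ j * x j‖ ^ 2) (hsum.mul_left _) ?_ ?_
    · simpa using this
    · intro j
      have := ((((tendsto_diffFactor (σ j)).mul_const (x j)).sub_const
        (Complex.I * (σ j * x j))).norm.pow 2)
      simpa [mul_assoc] using this
    · filter_upwards [hq] with h hh j
      rw [Real.norm_of_nonneg (by positivity)]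
      exact hdom h hh.1 hh.2 j
  -- The difference quotients sum to zero, so the error of replacing them by iσ_j x_j sums to
  -- exactly -iy, and the Bessel inequality bounds it.
  have hyle : ‖y‖ ^ 2 ≤ |K| * 0 := by
    refine ge_of_tendsto hlim ?_
    filter_upwards [hq, hqT T' hT'] with h hh hhT
    have hs := (hv.hasSum_diffFactor hx hh.1 hhT).sub (hsv.const_smul Complex.I)
    have hs' : HasSum (fun j => (diffFactor h (σ j) * x j - Complex.I * (σ j * x j)) • v T' j)
        (0 - Complex.I • y) := by
      convert hs using 1
      funext j
      rw [sub_smul, mul_smul Complex.I]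
    have hsm : Summable fun j => ‖diffFactor h (σ j) * x j - Complex.I * (σ j * x j)‖ ^ 2 :=
      Summable.of_nonneg_of_le (fun _ => by positivity) (hdom h hh.1 hh.2) (hsum.mul_left _)
    have := hKT.norm_sq_le hs' (hsm.mul_left _)
    rwa [tsum_mul_left, zero_sub, norm_neg, norm_smul, Complex.norm_I, one_mul] at this
  have : y = 0 := by
    rw [mul_zero] at hyle
    exact norm_eq_zero.1 (pow_eq_zero_iff two_ne_zero |>.1 (le_antisymm hyle (by positivity)))
  rwa [this] at hsv

/-- A null sequence is supported on a bounded set of exponents, and all its multiples by powers of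
the exponents are null. -/
theorem IsNull.exists_bound [∀ T, CompleteSpace (V T)] {v : ∀ T, J → V T} {σ : J → ℂ} (hv : TranslationBound v σ)
    {T T₀ K τ Λ Θ : ℝ} (hT : T₀ < T) (hK : BesselBound (v T) fun _ => K)
    (hτ : ∀ j, |(σ j).im| ≤ τ) {θ : J → ℝ} (hΛ : 0 ≤ Λ) (hΘ0 : 0 ≤ Θ) (hθ0 : ∀ j, 0 ≤ θ j)
    (hΘ : ∀ j, θ j * ‖σ j‖ ^ 2 ≤ Θ)
    (hcoer : ∀ (G : Finset J) (x : J → ℂ), ∑ j ∈ G, ‖x j‖ ^ 2 ≤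
      Λ * (‖∑ j ∈ G, x j • v T₀ j‖ ^ 2 + ∑ j ∈ G, θ j * ‖x j‖ ^ 2))
    {x : J → ℂ} (hx : IsNull v T x) :
    (∀ k : ℕ, IsNull v T (fun j => σ j ^ k * x j)) ∧
      ∃ A : ℝ, ∀ j, A < ‖σ j‖ → x j = 0 := by
  set L := Λ * (Θ * (Real.exp τ + 1) ^ 2) with hL
  have hL0 : 0 ≤ L := by positivity
  have key : ∀ k : ℕ, IsNull v T (fun j => σ j ^ k * x j) ∧
      ∑' j, ‖σ j ^ k * x j‖ ^ 2 ≤ L ^ k * ∑' j, ‖x j‖ ^ 2 := by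
    intro k
    induction k with
    | zero => simpa using hx
    | succ k ih =>
      have := ih.1.mul_exponent hv hT hK hτ hΛ hΘ0 hθ0 hΘ hcoer
      simp only [← mul_assoc, ← pow_succ'] at this
      refine ⟨this.1, this.2.trans ?_⟩
      rw [pow_succ' L, mul_assoc]
      have h2 := mul_le_mul_of_nonneg_left ih.2 hL0
      simpa only [hL, ← mul_assoc] using h2
  -- Moments of order k grow at most like L^k, whereas a nonzero coefficient with |σ_j|² > L + 1
  -- would force growth (L + 1)^k.
  refine ⟨fun k => (key k).1, Real.sqrt (L + 1), fun j hj => ?_⟩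
  by_contra hne
  have hσ : L + 1 < ‖σ j‖ ^ 2 := by
    rwa [Real.sqrt_lt' (lt_of_le_of_lt (Real.sqrt_nonneg _) hj)] at hj
  have hk : ∀ k : ℕ, ((L + 1) ^ k) * ‖x j‖ ^ 2 ≤ L ^ k * ∑' j, ‖x j‖ ^ 2 := fun k => by
    calc (L + 1) ^ k * ‖x j‖ ^ 2 ≤ (‖σ j‖ ^ 2) ^ k * ‖x j‖ ^ 2 := by gcongr
      _ = ‖σ j ^ k * x j‖ ^ 2 := by rw [norm_mul, norm_pow]; ring
      _ ≤ _ := ((key k).1.1.le_tsum j fun _ _ => by positivity).trans (key k).2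
  have hxj : 0 < ‖x j‖ ^ 2 := by positivity
  have hr : L / (L + 1) < 1 := by rw [div_lt_one (by positivity)]; linarith
  have hlim := (tendsto_pow_atTop_nhds_zero_of_lt_one (by positivity) hr).mul_const
    (∑' j, ‖x j‖ ^ 2)
  rw [zero_mul] at hlim
  refine absurd (ge_of_tendsto' hlim fun k => ?_) (not_le.2 hxj)
  rw [div_pow, div_mul_eq_mul_div, le_div_iff₀ (by positivity), mul_comm]
  exact hk k

end Uniqueness

/-- If all moments of a finite family of vectors vanish, the vectors whose exponent is not shared
vanish. -/
theorem eq_zero_of_moments {J V : Type*} [AddCommGroup V] [Module ℂ V] (G : Finset J) (σ : J → ℂ)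
    (b : J → V) (hm : ∀ k : ℕ, ∑ j ∈ G, σ j ^ k • b j = 0) {i : J} (hi : i ∈ G)
    (hne : ∀ j ∈ G, j ≠ i → σ j ≠ σ i) : b i = 0 := by
  classical
  have hp : ∀ p : Polynomial ℂ, ∑ j ∈ G, p.eval (σ j) • b j = 0 := by
    intro p
    induction p using Polynomial.induction_on' with
    | add p q hp hq => simp [add_smul, Finset.sum_add_distrib, hp, hq]
    | monomial n a => simp [mul_smul, ← Finset.smul_sum, hm]
  -- A polynomial vanishing at every exponent of G except σ_i, as in Lagrange interpolation.
  have h := hp (∏ j ∈ G.erase i, (Polynomial.X - Polynomial.C (σ j)))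
  rw [Finset.sum_eq_single_of_mem i hi] at h
  · refine (smul_eq_zero.1 h).resolve_left ?_
    rw [Polynomial.eval_prod, ← ne_eq, Finset.prod_ne_zero_iff]
    intro j hj
    rw [Finset.mem_erase] at hj
    simpa [sub_eq_zero] using (hne j hj.2 hj.1).symm
  · intro j hj hji
    rw [Polynomial.eval_prod, Finset.prod_eq_zero (Finset.mem_erase.2 ⟨hji, hj⟩) (by simp), zero_smul]

/-! ### Ingham's inequalities with a cosine weight. -/

section Ingham

/-- The weight is one half-wave of the cosine and vanishes at both ends of the interval; this makes
the transform decay quadratically in z, so that sums over separated frequencies converge. -/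
theorem integral_cos_mul_exp {b t₀ R : ℝ} {z : ℂ} (hb : b * R = Real.pi / 2)
    (hz : (b : ℂ) ^ 2 - z ^ 2 ≠ 0) :
    ∫ t in (t₀ - R)..(t₀ + R), (Real.cos (b * (t - t₀)) : ℂ) * Complex.exp (Complex.I * z * t) =
      b * (Complex.exp (Complex.I * z * (t₀ + R : ℝ)) + Complex.exp (Complex.I * z * (t₀ - R : ℝ))) /
        ((b : ℂ) ^ 2 - z ^ 2) := by
  set F : ℝ → ℂ := fun t => Complex.exp (Complex.I * z * t) *
    (Complex.I * z * Real.cos (b * (t - t₀)) + b * Real.sin (b * (t - t₀))) /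
      ((b : ℂ) ^ 2 - z ^ 2) with hF
  have hder : ∀ t : ℝ, HasDerivAt F
      ((Real.cos (b * (t - t₀)) : ℂ) * Complex.exp (Complex.I * z * t)) t := by
    intro t
    have h0 : HasDerivAt (fun t : ℝ => b * (t - t₀)) b t := by
      simpa using ((hasDerivAt_id t).sub_const t₀).const_mul b
    have h1 : HasDerivAt (fun t : ℝ => Complex.I * z * (t : ℂ)) (Complex.I * z) t := by
      simpa using (Complex.ofRealCLM.hasDerivAt (x := t)).const_mul (Complex.I * z)
    have h2 := h0.cos.ofReal_comp
    have h3 := h0.sin.ofReal_comp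
    have h4 := ((h1.cexp).mul ((h2.const_mul (Complex.I * z)).add (h3.const_mul (b : ℂ)))).div_const
      ((b : ℂ) ^ 2 - z ^ 2)
    refine h4.congr_deriv ?_
    rw [div_eq_iff hz]
    simp only [Pi.add_apply]
    push_cast
    linear_combination (Complex.exp (Complex.I * z * t)) * z ^ 2 *
      Complex.cos (b * (t - t₀)) * Complex.I_sq
  rw [intervalIntegral.integral_eq_sub_of_hasDerivAt (fun t _ => hder t)]
  · have e1 : b * (t₀ + R - t₀) = Real.pi / 2 := by rw [← hb]; ring
    have e2 : b * (t₀ - R - t₀) = -(Real.pi / 2) := by rw [← hb]; ring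
    simp only [hF, e1, e2, Real.cos_neg, Real.sin_neg, Real.cos_pi_div_two, Real.sin_pi_div_two]
    push_cast
    ring
  · apply Continuous.intervalIntegrable
    fun_prop

theorem norm_exp_I_mul_le {z : ℂ} {t τ ρ : ℝ} (hz : |z.im| ≤ τ) (ht : |t| ≤ ρ) :
    ‖Complex.exp (Complex.I * z * t)‖ ≤ Real.exp (τ * ρ) := by
  rw [Complex.norm_exp, Real.exp_le_exp]
  have : (Complex.I * z * t).re = -(z.im * t) := by simp
  rw [this]
  calc -(z.im * t) ≤ |z.im * t| := neg_le_abs _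
    _ = |z.im| * |t| := abs_mul _ _
    _ ≤ τ * ρ := mul_le_mul hz ht (abs_nonneg _) ((abs_nonneg _).trans hz)

theorem norm_integral_cos_mul_exp_le {b t₀ R τ : ℝ} {z : ℂ} (hb0 : 0 < b) (hR : 0 ≤ R)
    (hb : b * R = Real.pi / 2)
    (hτ : |z.im| ≤ 2 * τ) (hx : 0 < z.re ^ 2 - 4 * τ ^ 2 - b ^ 2) :
    ‖∫ t in (t₀ - R)..(t₀ + R), (Real.cos (b * (t - t₀)) : ℂ) * Complex.exp (Complex.I * z * t)‖ ≤
      2 * b * Real.exp (2 * τ * (|t₀| + R)) / (z.re ^ 2 - 4 * τ ^ 2 - b ^ 2) := by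
  have him : z.im ^ 2 ≤ 4 * τ ^ 2 := by
    have := pow_le_pow_left₀ (abs_nonneg _) hτ 2
    rw [sq_abs] at this
    linarith
  have hden : z.re ^ 2 - 4 * τ ^ 2 - b ^ 2 ≤ ‖(b : ℂ) ^ 2 - z ^ 2‖ := by
    have h1 := Complex.abs_re_le_norm ((b : ℂ) ^ 2 - z ^ 2)
    have h2 : ((b : ℂ) ^ 2 - z ^ 2).re = b ^ 2 - (z.re ^ 2 - z.im ^ 2) := by
      simp [sq]
    rw [h2] at h1
    have := neg_le_abs (b ^ 2 - (z.re ^ 2 - z.im ^ 2))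
    linarith
  have hne : (b : ℂ) ^ 2 - z ^ 2 ≠ 0 := norm_pos_iff.1 (hx.trans_le hden)
  rw [integral_cos_mul_exp hb hne, norm_div, norm_mul, Complex.norm_real, Real.norm_of_nonneg hb0.le]
  have a1 : |t₀ + R| ≤ |t₀| + R := (abs_add_le _ _).trans (by rw [abs_of_nonneg hR])
  have a2 : |t₀ - R| ≤ |t₀| + R := (abs_sub _ _).trans (by rw [abs_of_nonneg hR])
  have h3 := (norm_add_le _ _).trans (add_le_add (norm_exp_I_mul_le hτ a1) (norm_exp_I_mul_le hτ a2))
  refine div_le_div₀ (by positivity) ?_ hx hden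
  calc _ ≤ b * (Real.exp (2 * τ * (|t₀| + R)) + Real.exp (2 * τ * (|t₀| + R))) := by gcongr
    _ = _ := by ring

/-- The sum telescopes, since 1/(4k² - 1) = ½(1/(2k-1) - 1/(2k+1)). -/
theorem sum_range_one_div_le (n : ℕ) :
    ∑ k ∈ Finset.range n, 1 / (4 * ((k : ℝ) + 1) ^ 2 - 1) ≤ 1 / 2 := by
  have : ∀ n : ℕ, ∑ k ∈ Finset.range n, 1 / (4 * ((k : ℝ) + 1) ^ 2 - 1)
      = 1 / 2 - 1 / (2 * (2 * (n : ℝ) + 1)) := by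
    intro n
    induction n with
    | zero => norm_num
    | succ n ih =>
      rw [Finset.sum_range_succ, ih]
      have h1 : 4 * ((n : ℝ) + 1) ^ 2 - 1 = (2 * n + 1) * (2 * n + 3) := by ring
      have h2 : (2 * (n : ℝ) + 1) ≠ 0 := by positivity
      have h3 : (2 * (n : ℝ) + 3) ≠ 0 := by positivity
      rw [h1]
      push_cast
      have h4 : (2 * ((n : ℝ) + 1) + 1) = 2 * n + 3 := by ring
      rw [h4]
      field_simp
      ring
  rw [this]
  have : 0 ≤ 1 / (2 * (2 * (n : ℝ) + 1)) := by positivity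
  linarith

theorem four_mul_sq_sub_one_pos {k : ℤ} (hk : k ≠ 0) : (0 : ℝ) < 4 * (k : ℝ) ^ 2 - 1 := by
  have : (1 : ℤ) ≤ k ^ 2 := by have := sq_nonneg k; have : k ^ 2 ≠ 0 := pow_ne_zero 2 hk; omega
  have : (1 : ℝ) ≤ (k : ℝ) ^ 2 := by exact_mod_cast this
  linarith

theorem sum_int_one_div_le (S : Finset ℤ) (hS : ∀ k ∈ S, k ≠ 0) :
    ∑ k ∈ S, 1 / (4 * (k : ℝ) ^ 2 - 1) ≤ 1 := by
  classical
  obtain ⟨n, hn⟩ : ∃ n : ℕ, ∀ k ∈ S, k.natAbs ≤ n :=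
    ⟨S.sup Int.natAbs, fun k hk => Finset.le_sup (f := Int.natAbs) hk⟩
  set A : Finset ℤ := (Finset.range n).image (fun k : ℕ => (k : ℤ) + 1)
  set B : Finset ℤ := (Finset.range n).image (fun k : ℕ => -((k : ℤ) + 1))
  have hsub : S ⊆ A ∪ B := by
    intro k hk
    have h1 := hn k hk
    have h2 := hS k hk
    rw [Finset.mem_union, Finset.mem_image, Finset.mem_image]
    rcases lt_or_gt_of_ne h2 with h | h
    · exact Or.inr ⟨k.natAbs - 1, by rw [Finset.mem_range]; omega, by omega⟩
    · exact Or.inl ⟨k.natAbs - 1, by rw [Finset.mem_range]; omega, by omega⟩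
  have hpos : ∀ k ∈ A ∪ B, (0 : ℝ) ≤ 1 / (4 * (k : ℝ) ^ 2 - 1) := by
    intro k hk
    refine (one_div_pos.2 (four_mul_sq_sub_one_pos ?_)).le
    rintro rfl
    rw [Finset.mem_union, Finset.mem_image, Finset.mem_image] at hk
    rcases hk with ⟨m, -, h⟩ | ⟨m, -, h⟩ <;> omega
  calc _ ≤ ∑ k ∈ A ∪ B, 1 / (4 * (k : ℝ) ^ 2 - 1) :=
        Finset.sum_le_sum_of_subset_of_nonneg hsub fun k hk _ => hpos k hk
    _ ≤ ∑ k ∈ A, 1 / (4 * (k : ℝ) ^ 2 - 1) + ∑ k ∈ B, 1 / (4 * (k : ℝ) ^ 2 - 1) := by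
        rw [← Finset.sum_union_inter]
        exact le_add_of_nonneg_right (Finset.sum_nonneg fun k hk =>
          hpos k (Finset.mem_union_left _ (Finset.mem_inter.1 hk).1))
    _ ≤ 1 / 2 + 1 / 2 := by
        refine add_le_add ?_ ?_
        · rw [Finset.sum_image (fun a _ b _ h => by simpa using h)]
          push_cast
          exact sum_range_one_div_le n
        · rw [Finset.sum_image (fun a _ b _ h => by simpa using h)]
          push_cast
          simp only [neg_sq]
          exact sum_range_one_div_le n
    _ = 1 := by norm_num

variable {J : Type*}

/-- The exponential sum with coefficients `a` and frequencies `σ`. -/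
def expSum (G : Finset J) (σ a : J → ℂ) (t : ℝ) : ℂ :=
  ∑ j ∈ G, a j * Complex.exp (Complex.I * σ j * t)

theorem continuous_expSum (G : Finset J) (σ a : J → ℂ) : Continuous (expSum G σ a) := by
  unfold expSum
  fun_prop

theorem norm_sq_expSum (G : Finset J) (σ a : J → ℂ) (t : ℝ) :
    ((‖expSum G σ a t‖ ^ 2 : ℝ) : ℂ) = ∑ i ∈ G, ∑ j ∈ G, a i * starRingEnd ℂ (a j) *
      Complex.exp (Complex.I * (σ i - starRingEnd ℂ (σ j)) * t) := by
  rw [Complex.ofReal_pow, ← Complex.mul_conj', expSum, map_sum, Finset.sum_mul_sum]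
  refine Finset.sum_congr rfl fun i _ => Finset.sum_congr rfl fun j _ => ?_
  rw [map_mul, ← Complex.exp_conj]
  simp only [map_mul, Complex.conj_I, Complex.conj_ofReal]
  rw [show Complex.I * (σ i - starRingEnd ℂ (σ j)) * t =
    Complex.I * σ i * t + -Complex.I * starRingEnd ℂ (σ j) * t by ring, Complex.exp_add]
  ring

/-- Ingham's inequality with a cosine weight, for complex exponents in a narrow strip. -/
theorem abs_weighted_integral_sub_le {γ τ b t₀ R : ℝ} (hγ : 0 < γ) (hb0 : 0 < b) (hR : 0 ≤ R)
    (hb : b * R = Real.pi / 2) (hbτ : 4 * τ ^ 2 + b ^ 2 ≤ γ ^ 2 / 4) (G : Finset J)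
    (σ a : J → ℂ) (φ : J → ℤ) (hφ : Set.InjOn φ G)
    (hgap : ∀ i ∈ G, ∀ j ∈ G, γ * |(φ i - φ j : ℝ)| ≤ |(σ i).re - (σ j).re|)
    (hτ : ∀ j ∈ G, |(σ j).im| ≤ τ) :
    |(∫ t in (t₀ - R)..(t₀ + R), Real.cos (b * (t - t₀)) * ‖expSum G σ a t‖ ^ 2) -
      ∑ j ∈ G, ‖a j‖ ^ 2 *
        ∫ t in (t₀ - R)..(t₀ + R), Real.cos (b * (t - t₀)) * Real.exp (-(2 * (σ j).im * t))| ≤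
      8 * b * Real.exp (2 * τ * (|t₀| + R)) / γ ^ 2 * ∑ j ∈ G, ‖a j‖ ^ 2 := by
  classical
  set E := Real.exp (2 * τ * (|t₀| + R)) with hE
  set W : J → J → ℂ := fun i j => ∫ t in (t₀ - R)..(t₀ + R), (Real.cos (b * (t - t₀)) : ℂ) *
    Complex.exp (Complex.I * (σ i - starRingEnd ℂ (σ j)) * t) with hW
  have hint : ((∫ t in (t₀ - R)..(t₀ + R), Real.cos (b * (t - t₀)) * ‖expSum G σ a t‖ ^ 2 : ℝ) : ℂ)
      = ∑ i ∈ G, ∑ j ∈ G, a i * starRingEnd ℂ (a j) * W i j := by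
    rw [← intervalIntegral.integral_ofReal]
    simp only [Complex.ofReal_mul, norm_sq_expSum, Finset.mul_sum]
    rw [intervalIntegral.integral_finsetSum]
    · refine Finset.sum_congr rfl fun i _ => ?_
      rw [intervalIntegral.integral_finsetSum]
      · refine Finset.sum_congr rfl fun j _ => ?_
        rw [hW, ← intervalIntegral.integral_const_mul]
        refine intervalIntegral.integral_congr fun t _ => ?_
        ring
      · intro j _
        apply Continuous.intervalIntegrable
        fun_prop
    · intro i _
      apply Continuous.intervalIntegrable
      fun_prop
  have hdiag : ∀ i, W i i = ((∫ t in (t₀ - R)..(t₀ + R),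
      Real.cos (b * (t - t₀)) * Real.exp (-(2 * (σ i).im * t)) : ℝ) : ℂ) := by
    intro i
    rw [hW, ← intervalIntegral.integral_ofReal]
    refine intervalIntegral.integral_congr fun t _ => ?_
    simp only [Complex.ofReal_mul, Complex.ofReal_exp]
    congr 2
    rw [Complex.sub_conj]
    push_cast
    linear_combination (2 * (σ i).im * t : ℂ) * Complex.I_sq
  have hoff : ∀ i ∈ G, ∀ j ∈ G, i ≠ j →
      ‖W i j‖ ≤ 8 * b * E / γ ^ 2 * (1 / (4 * ((φ i - φ j : ℤ) : ℝ) ^ 2 - 1)) := by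
    intro i hi j hj hij
    have hk : φ i - φ j ≠ 0 := sub_ne_zero.2 fun h => hij (hφ hi hj h)
    have hpos := four_mul_sq_sub_one_pos hk
    have hre : (σ i - starRingEnd ℂ (σ j)).re = (σ i).re - (σ j).re := by simp
    have him : |(σ i - starRingEnd ℂ (σ j)).im| ≤ 2 * τ := by
      have : (σ i - starRingEnd ℂ (σ j)).im = (σ i).im + (σ j).im := by simp
      rw [this]
      exact (abs_add_le _ _).trans (by linarith [hτ i hi, hτ j hj])
    have hsq : γ ^ 2 * ((φ i - φ j : ℤ) : ℝ) ^ 2 ≤ (σ i - starRingEnd ℂ (σ j)).re ^ 2 := by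
      have h := pow_le_pow_left₀ (by positivity) (hgap i hi j hj) 2
      rw [mul_pow, sq_abs, sq_abs] at h
      rw [hre]
      push_cast
      exact h
    -- The assumption `hbτ` absorbs the strip width and b² into γ²/4, leaving γ²k² - γ²/4 with k = φ
    -- i - φ j.
    have hden : γ ^ 2 / 4 * (4 * ((φ i - φ j : ℤ) : ℝ) ^ 2 - 1) ≤
        (σ i - starRingEnd ℂ (σ j)).re ^ 2 - 4 * τ ^ 2 - b ^ 2 := by linarith
    have hden0 : 0 < γ ^ 2 / 4 * (4 * ((φ i - φ j : ℤ) : ℝ) ^ 2 - 1) := by positivity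
    refine (norm_integral_cos_mul_exp_le hb0 hR hb him (hden0.trans_le hden)).trans ?_
    calc _ ≤ 2 * b * E / (γ ^ 2 / 4 * (4 * ((φ i - φ j : ℤ) : ℝ) ^ 2 - 1)) := by
          gcongr
      _ = _ := by
          field_simp
          ring
  -- As φ is injective on G, the differences φ i - φ j are distinct nonzero integers. The row and
  -- column bounds feed a Schur test for the off-diagonal terms.
  have hrow : ∀ i ∈ G, ∑ j ∈ G.erase i, (1 / (4 * ((φ i - φ j : ℤ) : ℝ) ^ 2 - 1)) ≤ 1 := by
    intro i hi
    rw [← Finset.sum_image (f := fun k : ℤ => 1 / (4 * (k : ℝ) ^ 2 - 1)) (g := fun j => φ i - φ j)]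
    · refine sum_int_one_div_le _ fun k hk => ?_
      obtain ⟨j, hj, rfl⟩ := Finset.mem_image.1 hk
      rw [Finset.mem_erase] at hj
      exact sub_ne_zero.2 fun h => hj.1 (hφ hi hj.2 h).symm
    · intro j hj k hk h
      rw [Finset.mem_coe, Finset.mem_erase] at hj hk
      refine hφ hj.2 hk.2 ?_
      simpa using h
  have hcol : ∀ j ∈ G, ∑ i ∈ G.erase j, (1 / (4 * ((φ i - φ j : ℤ) : ℝ) ^ 2 - 1)) ≤ 1 := by
    intro j hj
    refine le_trans (le_of_eq (Finset.sum_congr rfl fun i _ => ?_)) (hrow j hj)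
    push_cast
    ring
  have hsplit : ((∫ t in (t₀ - R)..(t₀ + R), Real.cos (b * (t - t₀)) * ‖expSum G σ a t‖ ^ 2) -
      ∑ j ∈ G, ‖a j‖ ^ 2 *
        ∫ t in (t₀ - R)..(t₀ + R), Real.cos (b * (t - t₀)) * Real.exp (-(2 * (σ j).im * t)) : ℝ) =
      ∑ i ∈ G, ∑ j ∈ G.erase i, a i * starRingEnd ℂ (a j) * W i j := by
    rw [Complex.ofReal_sub, hint, Complex.ofReal_sum, ← Finset.sum_sub_distrib]
    refine Finset.sum_congr rfl fun i hi => ?_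
    rw [← Finset.add_sum_erase _ _ hi, hdiag i, Complex.ofReal_mul, Complex.ofReal_pow,
      ← Complex.mul_conj']
    simp
  rw [← Real.norm_eq_abs, ← Complex.norm_real, hsplit]
  set w : J → J → ℝ := fun i j => 1 / (4 * ((φ i - φ j : ℤ) : ℝ) ^ 2 - 1) with hw
  have hw0 : ∀ i ∈ G, ∀ j ∈ G.erase i, 0 ≤ w i j := by
    intro i hi j hj
    rw [Finset.mem_erase] at hj
    exact (one_div_pos.2 (four_mul_sq_sub_one_pos
      (sub_ne_zero.2 fun h => hj.1 (hφ hi hj.2 h).symm))).le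
  have hswap : ∑ i ∈ G, ∑ j ∈ G.erase i, ‖a j‖ ^ 2 * w i j =
      ∑ j ∈ G, ∑ i ∈ G.erase j, ‖a j‖ ^ 2 * w i j := by
    refine Finset.sum_comm' fun i j => ?_
    simp only [Finset.mem_erase]
    tauto
  have hbE : 0 ≤ 8 * b * E / γ ^ 2 := by positivity
  calc _ ≤ ∑ i ∈ G, ∑ j ∈ G.erase i, ‖a i * starRingEnd ℂ (a j) * W i j‖ :=
        (norm_sum_le _ _).trans (Finset.sum_le_sum fun i _ => norm_sum_le _ _)
    _ ≤ ∑ i ∈ G, ∑ j ∈ G.erase i, 8 * b * E / γ ^ 2 * ((‖a i‖ ^ 2 * w i j + ‖a j‖ ^ 2 * w i j) / 2) := by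
        refine Finset.sum_le_sum fun i hi => Finset.sum_le_sum fun j hj => ?_
        have h1 := hw0 i hi j hj
        rw [Finset.mem_erase] at hj
        have h2 := hoff i hi j hj.2 hj.1.symm
        rw [norm_mul, norm_mul, RCLike.norm_conj]
        calc _ ≤ ‖a i‖ * ‖a j‖ * (8 * b * E / γ ^ 2 * w i j) := by gcongr
          _ ≤ (‖a i‖ ^ 2 + ‖a j‖ ^ 2) / 2 * (8 * b * E / γ ^ 2 * w i j) := by
              gcongr
              nlinarith [sq_nonneg (‖a i‖ - ‖a j‖)]
          _ = _ := by ring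
    _ = 8 * b * E / γ ^ 2 * ((∑ i ∈ G, ∑ j ∈ G.erase i, ‖a i‖ ^ 2 * w i j +
          ∑ i ∈ G, ∑ j ∈ G.erase i, ‖a j‖ ^ 2 * w i j) / 2) := by
        simp only [← Finset.sum_add_distrib, Finset.mul_sum, Finset.sum_div]
    _ ≤ 8 * b * E / γ ^ 2 * ((∑ i ∈ G, ‖a i‖ ^ 2 + ∑ i ∈ G, ‖a i‖ ^ 2) / 2) := by
        rw [hswap]
        gcongr with i hi i hi
        · rw [← Finset.mul_sum]
          exact mul_le_of_le_one_right (by positivity) (hrow i hi)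
        · rw [← Finset.mul_sum]
          exact mul_le_of_le_one_right (by positivity) (hcol i hi)
    _ = _ := by ring

theorem integral_cos_shift {b t₀ R : ℝ} (hb0 : b ≠ 0) (hb : b * R = Real.pi / 2) :
    ∫ t in (t₀ - R)..(t₀ + R), Real.cos (b * (t - t₀)) = 2 / b := by
  have hder : ∀ t : ℝ, HasDerivAt (fun t => Real.sin (b * (t - t₀)) / b)
      (Real.cos (b * (t - t₀))) t := by
    intro t
    have h0 : HasDerivAt (fun t : ℝ => b * (t - t₀)) b t := by
      simpa using ((hasDerivAt_id t).sub_const t₀).const_mul b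
    refine (h0.sin.div_const b).congr_deriv ?_
    field_simp
  rw [intervalIntegral.integral_eq_sub_of_hasDerivAt (fun t _ => hder t)]
  · have e1 : b * (t₀ + R - t₀) = Real.pi / 2 := by rw [← hb]; ring
    have e2 : b * (t₀ - R - t₀) = -(Real.pi / 2) := by rw [← hb]; ring
    simp only [e1, e2, Real.sin_neg, Real.sin_pi_div_two]
    ring
  · exact Continuous.intervalIntegrable (by fun_prop) _ _

theorem cos_shift_nonneg {b t₀ R t : ℝ} (hb0 : 0 < b) (hb : b * R = Real.pi / 2)
    (ht : t ∈ Set.Icc (t₀ - R) (t₀ + R)) : 0 ≤ Real.cos (b * (t - t₀)) := by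
  refine Real.cos_nonneg_of_mem_Icc ⟨?_, ?_⟩
  · rw [← hb]; nlinarith [ht.1]
  · rw [← hb]; nlinarith [ht.2]

theorem integral_cos_mul_exp_bounds {b t₀ R τ s : ℝ} (hb0 : 0 < b) (hR : 0 ≤ R)
    (hb : b * R = Real.pi / 2) (hs : |s| ≤ τ) :
    (Real.exp (2 * τ * (|t₀| + R)))⁻¹ * (2 / b) ≤
      ∫ t in (t₀ - R)..(t₀ + R), Real.cos (b * (t - t₀)) * Real.exp (-(2 * s * t)) ∧
    (∫ t in (t₀ - R)..(t₀ + R), Real.cos (b * (t - t₀)) * Real.exp (-(2 * s * t))) ≤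
      Real.exp (2 * τ * (|t₀| + R)) * (2 / b) := by
  have hle : t₀ - R ≤ t₀ + R := by linarith
  have habs : ∀ t ∈ Set.Icc (t₀ - R) (t₀ + R), |2 * s * t| ≤ 2 * τ * (|t₀| + R) := by
    intro t ht
    have : |t| ≤ |t₀| + R := by
      rw [abs_le]
      constructor
      · linarith [ht.1, neg_abs_le t₀]
      · linarith [ht.2, le_abs_self t₀]
    rw [abs_mul, abs_mul, abs_two]
    have hτ : 0 ≤ τ := (abs_nonneg _).trans hs
    gcongr
  rw [← integral_cos_shift hb0.ne' hb (t₀ := t₀), ← intervalIntegral.integral_const_mul,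
    ← intervalIntegral.integral_const_mul]
  constructor
  · refine intervalIntegral.integral_mono_on hle ?_ ?_ fun t ht => ?_
    · exact Continuous.intervalIntegrable (by fun_prop) _ _
    · exact Continuous.intervalIntegrable (by fun_prop) _ _
    · rw [mul_comm, ← Real.exp_neg]
      refine mul_le_mul_of_nonneg_left (Real.exp_le_exp.2 ?_) (cos_shift_nonneg hb0 hb ht)
      have := (abs_le.1 (habs t ht)).2
      linarith
  · refine intervalIntegral.integral_mono_on hle ?_ ?_ fun t ht => ?_
    · exact Continuous.intervalIntegrable (by fun_prop) _ _
    · exact Continuous.intervalIntegrable (by fun_prop) _ _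
    · rw [mul_comm]
      refine mul_le_mul_of_nonneg_right (Real.exp_le_exp.2 ?_) (cos_shift_nonneg hb0 hb ht)
      have := (abs_le.1 (habs t ht)).1
      linarith

/-- Lower Ingham inequality on `(0,T)`. -/
theorem ingham_lower {γ τ T : ℝ} (hγ : 0 < γ) (hT : 0 < T)
    (hbτ : 4 * τ ^ 2 + (Real.pi / T) ^ 2 ≤ γ ^ 2 / 4) (G : Finset J)
    (σ a : J → ℂ) (φ : J → ℤ) (hφ : Set.InjOn φ G)
    (hgap : ∀ i ∈ G, ∀ j ∈ G, γ * |(φ i - φ j : ℝ)| ≤ |(σ i).re - (σ j).re|)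
    (hτ : ∀ j ∈ G, |(σ j).im| ≤ τ) :
    ((Real.exp (2 * τ * T))⁻¹ * (2 / (Real.pi / T)) -
      8 * (Real.pi / T) * Real.exp (2 * τ * T) / γ ^ 2) * ∑ j ∈ G, ‖a j‖ ^ 2 ≤
      ∫ t in (0 : ℝ)..T, ‖expSum G σ a t‖ ^ 2 := by
  have hb0 : 0 < Real.pi / T := by positivity
  have hR : 0 ≤ T / 2 := by positivity
  have hb : Real.pi / T * (T / 2) = Real.pi / 2 := by field_simp
  have h := abs_weighted_integral_sub_le (t₀ := T / 2) hγ hb0 hR hb hbτ G σ a φ hφ hgap hτ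
  have e1 : |T / 2| + T / 2 = T := by rw [abs_of_nonneg hR]; ring
  have e2 : T / 2 - T / 2 = 0 := sub_self _
  have e3 : T / 2 + T / 2 = T := by ring
  have hcont := continuous_expSum G σ a
  have hmono : (∫ t in (T / 2 - T / 2)..(T / 2 + T / 2), Real.cos (Real.pi / T * (t - T / 2)) *
      ‖expSum G σ a t‖ ^ 2) ≤ ∫ t in (T / 2 - T / 2)..(T / 2 + T / 2), ‖expSum G σ a t‖ ^ 2 := by
    refine intervalIntegral.integral_mono_on (by linarith) ?_ ?_ fun t ht => ?_
    · exact Continuous.intervalIntegrable (by fun_prop) _ _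
    · exact Continuous.intervalIntegrable (by fun_prop) _ _
    · exact mul_le_of_le_one_left (by positivity) (Real.cos_le_one _)
  have hdiag : (Real.exp (2 * τ * T))⁻¹ * (2 / (Real.pi / T)) * ∑ j ∈ G, ‖a j‖ ^ 2 ≤
      ∑ j ∈ G, ‖a j‖ ^ 2 * ∫ t in (T / 2 - T / 2)..(T / 2 + T / 2),
        Real.cos (Real.pi / T * (t - T / 2)) * Real.exp (-(2 * (σ j).im * t)) := by
    rw [Finset.mul_sum]
    refine Finset.sum_le_sum fun j hj => ?_
    rw [mul_comm]
    refine mul_le_mul_of_nonneg_left ?_ (by positivity)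
    have := (integral_cos_mul_exp_bounds (t₀ := T / 2) hb0 hR hb (hτ j hj)).1
    rwa [e1] at this
  rw [e1] at h
  rw [e2, e3] at h hmono hdiag
  have := (abs_le.1 h).1
  linarith

/-- Upper Ingham inequality on `(0,T)`, with a weight on a longer interval. -/
theorem ingham_upper {γ τ T R : ℝ} (hγ : 0 < γ) (hT : 0 < T) (hTR : T ≤ R)
    (hbτ : 4 * τ ^ 2 + (Real.pi / (2 * R)) ^ 2 ≤ γ ^ 2 / 4) (G : Finset J)
    (σ a : J → ℂ) (φ : J → ℤ) (hφ : Set.InjOn φ G)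
    (hgap : ∀ i ∈ G, ∀ j ∈ G, γ * |(φ i - φ j : ℝ)| ≤ |(σ i).re - (σ j).re|)
    (hτ : ∀ j ∈ G, |(σ j).im| ≤ τ) :
    ∫ t in (0 : ℝ)..T, ‖expSum G σ a t‖ ^ 2 ≤
      2 * (Real.exp (2 * τ * (|T / 2| + R)) * (2 / (Real.pi / (2 * R))) +
        8 * (Real.pi / (2 * R)) * Real.exp (2 * τ * (|T / 2| + R)) / γ ^ 2) *
        ∑ j ∈ G, ‖a j‖ ^ 2 := by
  have hR0 : 0 < R := hT.trans_le hTR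
  set b := Real.pi / (2 * R) with hbdef
  have hb0 : 0 < b := by positivity
  have hb : b * R = Real.pi / 2 := by rw [hbdef]; field_simp
  have h := abs_weighted_integral_sub_le (t₀ := T / 2) hγ hb0 hR0.le hb hbτ G σ a φ hφ hgap hτ
  have hcont := continuous_expSum G σ a
  have h1 : ∫ t in (0 : ℝ)..T, ‖expSum G σ a t‖ ^ 2 ≤
      ∫ t in (0 : ℝ)..T, 2 * (Real.cos (b * (t - T / 2)) * ‖expSum G σ a t‖ ^ 2) := by
    refine intervalIntegral.integral_mono_on hT.le ?_ ?_ fun t ht => ?_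
    · exact Continuous.intervalIntegrable (by fun_prop) _ _
    · exact Continuous.intervalIntegrable (by fun_prop) _ _
    · have hcos : 1 / 2 ≤ Real.cos (b * (t - T / 2)) := by
        rw [← Real.cos_pi_div_three, ← Real.cos_abs (b * (t - T / 2))]
        refine Real.cos_le_cos_of_nonneg_of_le_pi (abs_nonneg _) (by linarith [Real.pi_pos]) ?_
        rw [abs_mul, abs_of_pos hb0]
        -- Since T ≤ R, the phase stays within π/4 on (0,T), and the weight is at least 1/2 there.
        -- The longer interval is what allows an arbitrary T > 0 in the upper estimate.
        have h2 : |t - T / 2| ≤ R / 2 := by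
          rw [abs_le]; constructor <;> linarith [ht.1, ht.2]
        calc b * |t - T / 2| ≤ b * (R / 2) := by gcongr
          _ = Real.pi / 4 := by linear_combination hb / 2
          _ ≤ Real.pi / 3 := by linarith [Real.pi_pos]
      nlinarith [sq_nonneg ‖expSum G σ a t‖]
  have h2 : ∫ t in (0 : ℝ)..T, Real.cos (b * (t - T / 2)) * ‖expSum G σ a t‖ ^ 2 ≤
      ∫ t in (T / 2 - R)..(T / 2 + R), Real.cos (b * (t - T / 2)) * ‖expSum G σ a t‖ ^ 2 := by
    refine intervalIntegral.integral_mono_interval (by linarith) hT.le (by linarith) ?_ ?_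
    · refine (ae_restrict_iff' measurableSet_Ioc).2 (Eventually.of_forall fun t ht => ?_)
      exact mul_nonneg (cos_shift_nonneg hb0 hb (Set.Ioc_subset_Icc_self ht)) (by positivity)
    · exact Continuous.intervalIntegrable (by fun_prop) _ _
  have hdiag : ∑ j ∈ G, ‖a j‖ ^ 2 * (∫ t in (T / 2 - R)..(T / 2 + R),
        Real.cos (b * (t - T / 2)) * Real.exp (-(2 * (σ j).im * t))) ≤
      Real.exp (2 * τ * (|T / 2| + R)) * (2 / b) * ∑ j ∈ G, ‖a j‖ ^ 2 := by
    rw [Finset.mul_sum]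
    refine Finset.sum_le_sum fun j hj => ?_
    rw [mul_comm]
    exact mul_le_mul_of_nonneg_right
      (integral_cos_mul_exp_bounds (t₀ := T / 2) hb0 hR0.le hb (hτ j hj)).2 (by positivity)
  rw [intervalIntegral.integral_const_mul] at h1
  have := (abs_le.1 h).2
  linarith

end Ingham

/-! ### From the asymptotic gap to Ingham estimates for tails. -/

section Tails

/-- The sequence `s` together with its mirror image `-conj s`. -/
def mirror (s : ℕ → ℂ) (p : ℕ × Bool) : ℂ := cond p.2 (-starRingEnd ℂ (s p.1)) (s p.1)

theorem eventually_gap_of_liminf {u : ℕ → ℝ} {γ γ' : ℝ} (hγ : 0 < γ)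
    (hu : liminf u atTop = γ) (h : γ' < γ) : ∀ᶠ n in atTop, γ' ≤ u n := by
  rw [liminf_eq] at hu
  -- The real liminf is an `sSup`, which takes the value 0 on the empty set; γ > 0 excludes this
  -- case.
  have hne : {a | ∀ᶠ n in atTop, a ≤ u n}.Nonempty := by
    by_contra hcon
    rw [Set.not_nonempty_iff_eq_empty.1 hcon, Real.sSup_empty] at hu
    exact hγ.ne hu
  obtain ⟨a, ha, hlt⟩ := exists_lt_of_lt_csSup hne (hu ▸ h)
  exact Eventually.mono ha fun n hn => hlt.le.trans hn

/-- Consecutive gaps add up. The lower bound on the real parts themselves is included so that the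
tail also stays away from its mirror image across the imaginary axis. -/
theorem exists_tail_separation {s : ℕ → ℂ} {γ γ' : ℝ} (hγ : 0 < γ)
    (hs : liminf (fun n => (s (n + 1)).re - (s n).re) atTop = γ) (hγ' : 0 < γ') (h : γ' < γ) :
    ∃ N₀ : ℕ, (∀ n ≥ N₀, γ' ≤ (s n).re) ∧
      ∀ m n, N₀ ≤ m → m ≤ n → γ' * ((n : ℝ) - m) ≤ (s n).re - (s m).re := by
  obtain ⟨A, hA⟩ := eventually_atTop.1 (eventually_gap_of_liminf hγ hs h)
  have hmono : ∀ m n, A ≤ m → m ≤ n → γ' * ((n : ℝ) - m) ≤ (s n).re - (s m).re := by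
    intro m n hm hmn
    induction n, hmn using Nat.le_induction with
    | base => simp
    | succ n hmn ih =>
      have := hA n (hm.trans hmn)
      push_cast
      linarith
  obtain ⟨k, hk⟩ := exists_nat_ge ((γ' - (s A).re) / γ')
  rw [div_le_iff₀ hγ'] at hk
  refine ⟨A + k, fun n hn => ?_, fun m n hm hmn => hmono m n (by omega) hmn⟩
  have h1 := hmono A n le_rfl (by omega)
  have h2 : (A : ℝ) + k ≤ n := by exact_mod_cast hn
  nlinarith

theorem tendsto_norm_atTop_of_liminf_gap {s : ℕ → ℂ} {γ : ℝ} (hγ : 0 < γ)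
    (hs : liminf (fun n => (s (n + 1)).re - (s n).re) atTop = γ) :
    Tendsto (fun n => ‖s n‖) atTop atTop := by
  obtain ⟨N, -, hN⟩ := exists_tail_separation hγ hs (half_pos hγ) (half_lt_self hγ)
  have h1 : Tendsto (fun n : ℕ => γ / 2 * ((n : ℝ) - N) + (s N).re) atTop atTop :=
    tendsto_atTop_add_const_right _ _ (Tendsto.const_mul_atTop (half_pos hγ)
      (tendsto_atTop_add_const_right _ _ tendsto_natCast_atTop_atTop))
  refine tendsto_atTop_mono' _ ?_ h1
  filter_upwards [eventually_ge_atTop N] with n hn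
  have := hN N n le_rfl hn
  have := (le_abs_self _).trans (Complex.abs_re_le_norm (s n))
  linarith

/-- An enumeration of the tails of a sequence and of its mirror image by the integers. -/
def mirrorIndex (N : ℕ) (p : ℕ × Bool) : ℤ := cond p.2 (-((p.1 : ℤ) - N) - 1) ((p.1 : ℤ) - N)

theorem mirrorIndex_injOn (N : ℕ) : Set.InjOn (mirrorIndex N) {p | N ≤ p.1} := by
  rintro ⟨n, b⟩ hn ⟨m, c⟩ hm h
  change N ≤ n at hn
  change N ≤ m at hm
  cases b <;> cases c <;> simp only [mirrorIndex, cond_true, cond_false] at h <;>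
    first | exact Prod.ext (by simp only; omega) rfl | (exfalso; omega)

/-- The tail takes the indices 0, 1, … and its mirror image -1, -2, …. Across the axis the distance
is a sum of two real parts, each at least γ beyond the accumulated gaps, which covers the extra unit
in the index difference. -/
theorem mirrorIndex_gap {s : ℕ → ℂ} {γ : ℝ} {N : ℕ} (hpos : ∀ n ≥ N, γ ≤ (s n).re) (hγ : 0 < γ)
    (hs : ∀ m n, N ≤ m → m ≤ n → γ * ((n : ℝ) - m) ≤ (s n).re - (s m).re)
    {p q : ℕ × Bool} (hp : N ≤ p.1) (hq : N ≤ q.1) :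
    γ * |(mirrorIndex N p - mirrorIndex N q : ℝ)| ≤ |(mirror s p).re - (mirror s q).re| := by
  have key : ∀ n m, N ≤ n → N ≤ m → γ * |(n : ℝ) - m| ≤ |(s n).re - (s m).re| := by
    intro n m hn hm
    rcases le_total m n with h | h
    · rw [abs_of_nonneg (by rw [sub_nonneg]; exact_mod_cast h)]
      exact (hs m n hm h).trans (le_abs_self _)
    · rw [abs_sub_comm, abs_sub_comm (s n).re,
        abs_of_nonneg (by rw [sub_nonneg]; exact_mod_cast h)]
      exact (hs n m hn h).trans (le_abs_self _)
  have key2 : ∀ n m, N ≤ n → N ≤ m →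
      γ * |((n : ℝ) - N) + (m - N) + 1| ≤ |(s n).re + (s m).re| := by
    intro n m hn hm
    have h1 := hs N n le_rfl hn
    have h2 := hs N m le_rfl hm
    have h3 := hpos N le_rfl
    have hn' : (N : ℝ) ≤ n := by exact_mod_cast hn
    have hm' : (N : ℝ) ≤ m := by exact_mod_cast hm
    rw [abs_of_nonneg (by linarith)]
    refine le_trans ?_ (le_abs_self _)
    nlinarith
  obtain ⟨n, b⟩ := p
  obtain ⟨m, c⟩ := q
  cases b <;> cases c <;> simp only [mirrorIndex, mirror, cond_true, cond_false, Complex.neg_re,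
    Complex.conj_re] <;> push_cast
  · convert key n m hp hq using 2
    congr 1; ring
  · convert key2 n m hp hq using 2
    · congr 1; ring
    · ring
  · convert key2 n m hp hq using 1
    · rw [← abs_neg]; congr 2; ring
    · rw [← abs_neg]; congr 1; ring
  · convert key n m hp hq using 1
    · rw [← abs_neg]; congr 2; ring
    · rw [← abs_neg]; congr 1; ring

variable {J : Type*}

theorem expSum_shift (G : Finset J) (σ a : J → ℂ) (β t : ℝ) :
    expSum G (fun j => σ j + Complex.I * β) a t = Real.exp (-(β * t)) * expSum G σ a t := by
  simp only [expSum, Finset.mul_sum]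
  refine Finset.sum_congr rfl fun j _ => ?_
  rw [show Complex.I * (σ j + Complex.I * β) * t = Complex.I * σ j * t + ((-(β * t) : ℝ) : ℂ) by
    push_cast; linear_combination (β * t : ℂ) * Complex.I_sq, Complex.exp_add, Complex.ofReal_exp]
  ring

/-- A vertical shift of all exponents by iβ multiplies the sum by e^{-βt}, which costs only a
constant on (0,T). This reduces exponents with Im → β to exponents in a thin strip around the real
axis; the mirror image undergoes the same shift (`mirror_sub_add`). -/
theorem integral_expSum_shift_bounds (G : Finset J) (σ a : J → ℂ) (β : ℝ) {T : ℝ} (hT : 0 ≤ T) :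
    Real.exp (-(2 * |β| * T)) * (∫ t in (0 : ℝ)..T, ‖expSum G σ a t‖ ^ 2) ≤
      ∫ t in (0 : ℝ)..T, ‖expSum G (fun j => σ j + Complex.I * β) a t‖ ^ 2 ∧
    (∫ t in (0 : ℝ)..T, ‖expSum G (fun j => σ j + Complex.I * β) a t‖ ^ 2) ≤
      Real.exp (2 * |β| * T) * (∫ t in (0 : ℝ)..T, ‖expSum G σ a t‖ ^ 2) := by
  have hc := continuous_expSum G σ a
  have he : ∀ t : ℝ, ‖expSum G (fun j => σ j + Complex.I * β) a t‖ ^ 2 =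
      Real.exp (-(2 * β * t)) * ‖expSum G σ a t‖ ^ 2 := by
    intro t
    rw [expSum_shift, norm_mul, Complex.norm_real, Real.norm_of_nonneg (Real.exp_pos _).le, mul_pow,
      ← Real.exp_nat_mul]
    congr 2
    push_cast
    ring
  have hab : ∀ t ∈ Set.Icc 0 T, |2 * β * t| ≤ 2 * |β| * T := by
    intro t ht
    rw [abs_mul, abs_mul, abs_two, abs_of_nonneg ht.1]
    have := ht.2
    gcongr
  simp only [he]
  rw [← intervalIntegral.integral_const_mul, ← intervalIntegral.integral_const_mul]
  constructor
  · refine intervalIntegral.integral_mono_on hT ?_ ?_ fun t ht => ?_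
    · exact Continuous.intervalIntegrable (by fun_prop) _ _
    · exact Continuous.intervalIntegrable (by fun_prop) _ _
    · refine mul_le_mul_of_nonneg_right (Real.exp_le_exp.2 ?_) (by positivity)
      linarith [(abs_le.1 (hab t ht)).2]
  · refine intervalIntegral.integral_mono_on hT ?_ ?_ fun t ht => ?_
    · exact Continuous.intervalIntegrable (by fun_prop) _ _
    · exact Continuous.intervalIntegrable (by fun_prop) _ _
    · refine mul_le_mul_of_nonneg_right (Real.exp_le_exp.2 ?_) (by positivity)
      linarith [(abs_le.1 (hab t ht)).1]

theorem mirror_sub_add (s : ℕ → ℂ) (β : ℝ) (p : ℕ × Bool) :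
    mirror (fun n => s n - Complex.I * β) p + Complex.I * β = mirror s p := by
  obtain ⟨n, b⟩ := p
  cases b <;> simp [mirror]

theorem abs_im_mirror_le {s : ℕ → ℂ} {β τ : ℝ} {p : ℕ × Bool} (h : |(s p.1).im - β| ≤ τ) :
    |(mirror (fun n => s n - Complex.I * β) p).im| ≤ τ := by
  obtain ⟨n, b⟩ := p
  cases b <;> simpa [mirror, sub_eq_add_neg, add_comm] using h

theorem exists_tail_lower_bound {s : ℕ → ℂ} {γ β T : ℝ} (hγ : 0 < γ)
    (hs : liminf (fun n => (s (n + 1)).re - (s n).re) atTop = γ)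
    (hβ : Tendsto (fun n => (s n).im) atTop (𝓝 β)) (hT : 2 * Real.pi / γ < T) :
    ∃ κ > 0, ∃ N : ℕ, ∀ (G : Finset J) (f : J → ℕ × Bool), Set.InjOn f G →
      (∀ j ∈ G, N ≤ (f j).1) → ∀ a : J → ℂ,
        κ * ∑ j ∈ G, ‖a j‖ ^ 2 ≤ ∫ t in (0 : ℝ)..T, ‖expSum G (fun j => mirror s (f j)) a t‖ ^ 2 := by
  have hT0 : 0 < T := lt_trans (by positivity) hT
  have hlt : 2 * Real.pi / T < γ := by
    rw [div_lt_iff₀ hγ] at hT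
    rw [div_lt_iff₀ hT0]; linarith
  obtain ⟨γ', h1, h2⟩ := exists_between hlt
  have hγ' : 0 < γ' := lt_trans (by positivity) h1
  set b := Real.pi / T with hb
  have hb0 : 0 < b := by positivity
  have hbγ : 2 * b < γ' := by rw [hb]; linarith [mul_div_assoc 2 Real.pi T]
  have hsq : (2 * b) ^ 2 < γ' ^ 2 := pow_lt_pow_left₀ hbγ (by positivity) two_ne_zero
  have hτ1 : ∀ᶠ τ in 𝓝[>] (0 : ℝ), 4 * τ ^ 2 + b ^ 2 < γ' ^ 2 / 4 := by
    refine nhdsWithin_le_nhds ?_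
    have hc : Continuous fun τ : ℝ => 4 * τ ^ 2 + b ^ 2 := by fun_prop
    refine hc.continuousAt.eventually_lt continuousAt_const ?_
    linarith [zero_pow (M₀ := ℝ) two_ne_zero]
  -- At τ = 0 the constant of `ingham_lower` is 2/b - 8b/γ'², positive exactly when 2b < γ', that is
  -- T > 2π/γ'. Continuity preserves this for a thin strip.
  have hτ2 : ∀ᶠ τ in 𝓝[>] (0 : ℝ), 0 < (Real.exp (2 * τ * T))⁻¹ * (2 / b) -
      8 * b * Real.exp (2 * τ * T) / γ' ^ 2 := by
    refine nhdsWithin_le_nhds ?_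
    have hc : Continuous fun τ : ℝ => (Real.exp (2 * τ * T))⁻¹ * (2 / b) -
      8 * b * Real.exp (2 * τ * T) / γ' ^ 2 := by
      simp only [← Real.exp_neg]
      fun_prop
    refine continuousAt_const.eventually_lt hc.continuousAt ?_
    simp only [mul_zero, zero_mul, Real.exp_zero, inv_one, one_mul, mul_one, sub_pos]
    rw [div_lt_div_iff₀ (by positivity) hb0]
    linarith
  obtain ⟨τ, ⟨h3, h4⟩, h5⟩ := ((hτ1.and hτ2).and self_mem_nhdsWithin).exists
  obtain ⟨N₀, hN₀, hsep⟩ := exists_tail_separation hγ hs hγ' h2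
  obtain ⟨N₁, hN₁⟩ := (Metric.tendsto_atTop.1 hβ) τ h5
  refine ⟨Real.exp (-(2 * |β| * T)) * _, mul_pos (Real.exp_pos _) h4, max N₀ N₁,
    fun G f hf hN a => ?_⟩
  set M := max N₀ N₁ with hM
  have hgap := @mirrorIndex_gap s γ' M (fun n hn => hN₀ n ((le_max_left _ _).trans hn)) hγ'
    (fun m n hm hmn => hsep m n ((le_max_left _ _).trans hm) hmn)
  have key := ingham_lower hγ' hT0 h3.le G
    (fun j => mirror (fun n => s n - Complex.I * β) (f j)) a (fun j => mirrorIndex M (f j))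
    (fun i hi j hj h => hf hi hj (mirrorIndex_injOn M (hN i hi) (hN j hj) h))
    (fun i hi j hj => by
      refine (hgap (hN i hi) (hN j hj)).trans (le_of_eq ?_)
      rw [← mirror_sub_add s β (f i), ← mirror_sub_add s β (f j)]
      simp)
    (fun j hj => abs_im_mirror_le (by
      have := hN₁ (f j).1 ((le_max_right _ _).trans (hN j hj))
      rw [Real.dist_eq] at this
      exact this.le))
  have h6 := (integral_expSum_shift_bounds G
    (fun j => mirror (fun n => s n - Complex.I * β) (f j)) a β hT0.le).1
  simp only [mirror_sub_add] at h6
  rw [mul_assoc]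
  exact (mul_le_mul_of_nonneg_left key (Real.exp_pos _).le).trans h6

theorem exists_tail_upper_bound {s : ℕ → ℂ} {γ β T : ℝ} (hγ : 0 < γ)
    (hs : liminf (fun n => (s (n + 1)).re - (s n).re) atTop = γ)
    (hβ : Tendsto (fun n => (s n).im) atTop (𝓝 β)) (hT0 : 0 < T) :
    ∃ K : ℝ, ∃ N : ℕ, ∀ (G : Finset J) (f : J → ℕ × Bool), Set.InjOn f G →
      (∀ j ∈ G, N ≤ (f j).1) → ∀ a : J → ℂ,
        ∫ t in (0 : ℝ)..T, ‖expSum G (fun j => mirror s (f j)) a t‖ ^ 2 ≤ K * ∑ j ∈ G, ‖a j‖ ^ 2 := by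
  set γ' := γ / 2 with hγ'def
  have hγ' : 0 < γ' := half_pos hγ
  set R := max T (2 * Real.pi / γ') with hR
  have hR0 : 0 < R := lt_max_of_lt_left hT0
  have hb : Real.pi / (2 * R) ≤ γ' / 4 := by
    have : 2 * Real.pi / γ' ≤ R := le_max_right _ _
    rw [div_le_iff₀ hγ'] at this
    rw [div_le_div_iff₀ (by positivity) (by positivity)]
    linarith
  set τ := γ' / 8 with hτ
  -- With τ = γ'/8 and π/(2R) ≤ γ'/4, each of the two terms is at most γ'²/16.
  have hbτ : 4 * τ ^ 2 + (Real.pi / (2 * R)) ^ 2 ≤ γ' ^ 2 / 4 := by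
    have := pow_le_pow_left₀ (by positivity) hb 2
    rw [hτ]
    nlinarith [sq_nonneg γ']
  obtain ⟨N₀, hN₀, hsep⟩ := exists_tail_separation hγ hs hγ' (half_lt_self hγ)
  obtain ⟨N₁, hN₁⟩ := (Metric.tendsto_atTop.1 hβ) τ (by positivity)
  refine ⟨Real.exp (2 * |β| * T) * (2 * (Real.exp (2 * τ * (|T / 2| + R)) *
    (2 / (Real.pi / (2 * R))) + 8 * (Real.pi / (2 * R)) *
      Real.exp (2 * τ * (|T / 2| + R)) / γ' ^ 2)), max N₀ N₁, fun G f hf hN a => ?_⟩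
  set M := max N₀ N₁ with hM
  have hgap := @mirrorIndex_gap s γ' M (fun n hn => hN₀ n ((le_max_left _ _).trans hn)) hγ'
    (fun m n hm hmn => hsep m n ((le_max_left _ _).trans hm) hmn)
  have key := ingham_upper hγ' hT0 (le_max_left T (2 * Real.pi / γ')) hbτ G
    (fun j => mirror (fun n => s n - Complex.I * β) (f j)) a (fun j => mirrorIndex M (f j))
    (fun i hi j hj h => hf hi hj (mirrorIndex_injOn M (hN i hi) (hN j hj) h))
    (fun i hi j hj => by
      refine (hgap (hN i hi) (hN j hj)).trans (le_of_eq ?_)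
      rw [← mirror_sub_add s β (f i), ← mirror_sub_add s β (f j)]
      simp)
    (fun j hj => abs_im_mirror_le (by
      have := hN₁ (f j).1 ((le_max_right _ _).trans (hN j hj))
      rw [Real.dist_eq] at this
      exact this.le))
  have h6 := (integral_expSum_shift_bounds G
    (fun j => mirror (fun n => s n - Complex.I * β) (f j)) a β hT0.le).2
  simp only [mirror_sub_add] at h6
  rw [mul_assoc]
  exact h6.trans (mul_le_mul_of_nonneg_left key (Real.exp_pos _).le)

end Tails

/-! ### Exponentials as vectors of L²(0,T) and of pairs. -/

section Exponentials

/-- The complex space `L²(0,T)`. -/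
abbrev L2 (T : ℝ) := Lp ℂ 2 (volume.restrict (Set.Ioc 0 T))

/-- The space of pairs of functions in `L²(0,T)`. -/
abbrev L2Pair (T : ℝ) := WithLp 2 (L2 T × L2 T)

theorem memLp_of_continuous {f : ℝ → ℂ} (hf : Continuous f) (T : ℝ) :
    MemLp f 2 (volume.restrict (Set.Ioc 0 T)) := by
  obtain ⟨C, hC⟩ := (isCompact_Icc (a := (0 : ℝ)) (b := T)).exists_bound_of_continuousOn
    hf.continuousOn
  refine MemLp.of_bound hf.aestronglyMeasurable C ?_
  exact (ae_restrict_iff' measurableSet_Ioc).2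
    (Eventually.of_forall fun t ht => hC t (Set.Ioc_subset_Icc_self ht))

theorem norm_toLp_sq {T : ℝ} {f : ℝ → ℂ} (hf : MemLp f 2 (volume.restrict (Set.Ioc 0 T))) :
    ‖hf.toLp f‖ ^ 2 = ∫ t in Set.Ioc 0 T, ‖f t‖ ^ 2 := by
  have h1 : inner ℂ (hf.toLp f) (hf.toLp f) = ((∫ t in Set.Ioc 0 T, ‖f t‖ ^ 2 : ℝ) : ℂ) := by
    rw [L2.inner_def, ← integral_complex_ofReal]
    refine integral_congr_ae ?_
    filter_upwards [hf.coeFn_toLp] with t ht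
    rw [ht, inner_self_eq_norm_sq_to_K]
    simp
  rw [inner_self_eq_norm_sq_to_K] at h1
  refine Complex.ofReal_injective (Eq.trans ?_ h1)
  rw [Complex.ofReal_pow]
  rfl

/-- The exponential `t ↦ exp (i σ t)` as an element of `L²(0,T)`. -/
def expo (T : ℝ) (σ : ℂ) : L2 T :=
  (memLp_of_continuous (f := fun t : ℝ => Complex.exp (Complex.I * σ * t)) (by fun_prop) T).toLp _

variable {J : Type*}

theorem sum_smul_expo (T : ℝ) (G : Finset J) (σ a : J → ℂ) :
    ∑ j ∈ G, a j • expo T (σ j) =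
      (memLp_of_continuous (continuous_expSum G σ a) T).toLp (expSum G σ a) := by
  classical
  induction G using Finset.induction_on with
  | empty =>
    rw [Finset.sum_empty, eq_comm, Lp.eq_zero_iff_ae_eq_zero]
    filter_upwards [(memLp_of_continuous (continuous_expSum ∅ σ a) T).coeFn_toLp] with t ht
    rw [ht]
    rfl
  | insert i G hi ih =>
    rw [Finset.sum_insert hi, ih, expo, ← MemLp.toLp_const_smul, ← MemLp.toLp_add]
    refine (MemLp.toLp_eq_toLp_iff _ _).2 (Eventually.of_forall fun t => ?_)
    simp [expSum, Finset.sum_insert hi]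

theorem norm_sum_smul_expo_sq (T : ℝ) (G : Finset J) (σ a : J → ℂ) :
    ‖∑ j ∈ G, a j • expo T (σ j)‖ ^ 2 = ∫ t in Set.Ioc 0 T, ‖expSum G σ a t‖ ^ 2 := by
  rw [sum_smul_expo, norm_toLp_sq]

theorem expSum_translate (G : Finset J) (σ a : J → ℂ) (h t : ℝ) :
    expSum G σ (fun j => a j * Complex.exp (Complex.I * σ j * h)) t = expSum G σ a (t + h) := by
  refine Finset.sum_congr rfl fun j _ => ?_
  rw [mul_assoc, ← Complex.exp_add]
  congr 2
  push_cast
  ring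

/-- The factors e^{iσ_j h} translate the sum by h, so the left side is the norm of the untranslated
sum over (h, T' + h), a subinterval of (0,T). -/
theorem norm_sum_expo_translate_le (G : Finset J) (σ a : J → ℂ) {T' h T : ℝ} (h0 : 0 ≤ h)
    (hT : T' + h ≤ T) :
    ‖∑ j ∈ G, (a j * Complex.exp (Complex.I * σ j * h)) • expo T' (σ j)‖ ≤
      ‖∑ j ∈ G, a j • expo T (σ j)‖ := by
  refine (sq_le_sq₀ (norm_nonneg _) (norm_nonneg _)).1 ?_
  rw [norm_sum_smul_expo_sq T' G σ fun j => a j * Complex.exp (Complex.I * σ j * h),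
    norm_sum_smul_expo_sq]
  simp only [expSum_translate]
  have hc := continuous_expSum G σ a
  have hI : ∀ A B : ℝ, IntegrableOn (fun t => ‖expSum G σ a t‖ ^ 2) (Set.Ioc A B) := fun A B =>
    (Continuous.integrableOn_Icc (by fun_prop)).mono_set Set.Ioc_subset_Icc_self
  rcases le_or_gt T' 0 with h1 | h1
  · rw [Set.Ioc_eq_empty (by linarith)]
    simp only [Measure.restrict_empty, integral_zero_measure]
    exact setIntegral_nonneg measurableSet_Ioc fun t _ => by positivity
  · rw [← intervalIntegral.integral_of_le h1.le,
      intervalIntegral.integral_comp_add_right (fun t => ‖expSum G σ a t‖ ^ 2),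
      intervalIntegral.integral_of_le (by linarith)]
    refine setIntegral_mono_set (hI 0 T) (Eventually.of_forall fun t => by positivity) ?_
    exact (Set.Ioc_subset_Ioc (by linarith) hT).eventuallyLE

theorem expo_ne_zero {T : ℝ} (hT : 0 < T) (σ : ℂ) : expo T σ ≠ 0 := by
  intro h
  have h1 : ‖expo T σ‖ ^ 2 = ∫ t in Set.Ioc 0 T, ‖Complex.exp (Complex.I * σ * t)‖ ^ 2 :=
    norm_toLp_sq _
  rw [h, norm_zero, ← intervalIntegral.integral_of_le hT.le] at h1
  have h2 : 0 < ∫ t in (0 : ℝ)..T, ‖Complex.exp (Complex.I * σ * t)‖ ^ 2 := by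
    refine intervalIntegral.intervalIntegral_pos_of_pos ?_ (fun t => ?_) hT
    · exact Continuous.intervalIntegrable (by fun_prop) _ _
    · have := norm_pos_iff.2 (Complex.exp_ne_zero (Complex.I * σ * t))
      positivity
  simp at h1
  linarith

theorem norm_expo_sq_le {T A : ℝ} (hT : 0 ≤ T) {σ : ℂ} (h : |σ.im| ≤ A) :
    ‖expo T σ‖ ^ 2 ≤ T * Real.exp (A * T) ^ 2 := by
  have h1 : ‖expo T σ‖ ^ 2 = ∫ t in Set.Ioc 0 T, ‖Complex.exp (Complex.I * σ * t)‖ ^ 2 :=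
    norm_toLp_sq _
  rw [h1, ← intervalIntegral.integral_of_le hT]
  calc _ ≤ ∫ t in (0 : ℝ)..T, Real.exp (A * T) ^ 2 := by
        refine intervalIntegral.integral_mono_on hT ?_ ?_ fun t ht => ?_
        · exact Continuous.intervalIntegrable (by fun_prop) _ _
        · exact Continuous.intervalIntegrable (by fun_prop) _ _
        · gcongr
          exact norm_exp_I_mul_le h (by rw [abs_of_nonneg ht.1]; exact ht.2)
    _ = _ := by simp

/-- The pairs of multiples of exponentials. -/
def expoPair (w₁ w₂ σ : J → ℂ) (T : ℝ) (j : J) : L2Pair T :=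
  WithLp.toLp 2 (w₁ j • expo T (σ j), w₂ j • expo T (σ j))

theorem sum_smul_expoPair (w₁ w₂ σ : J → ℂ) (T : ℝ) (G : Finset J) (x : J → ℂ) :
    ∑ j ∈ G, x j • expoPair w₁ w₂ σ T j =
      WithLp.toLp 2 (∑ j ∈ G, (x j * w₁ j) • expo T (σ j), ∑ j ∈ G, (x j * w₂ j) • expo T (σ j)) := by
  classical
  induction G using Finset.induction_on with
  | empty => simp; rfl
  | insert i G hi ih =>
    rw [Finset.sum_insert hi, ih, Finset.sum_insert hi, Finset.sum_insert hi, expoPair,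
      ← WithLp.toLp_smul, ← WithLp.toLp_add]
    simp [mul_smul]

theorem norm_sum_smul_expoPair_sq (w₁ w₂ σ : J → ℂ) (T : ℝ) (G : Finset J) (x : J → ℂ) :
    ‖∑ j ∈ G, x j • expoPair w₁ w₂ σ T j‖ ^ 2 =
      ‖∑ j ∈ G, (x j * w₁ j) • expo T (σ j)‖ ^ 2 + ‖∑ j ∈ G, (x j * w₂ j) • expo T (σ j)‖ ^ 2 := by
  rw [sum_smul_expoPair, WithLp.prod_norm_sq_eq_of_L2]
  rfl

theorem translationBound_expoPair (w₁ w₂ σ : J → ℂ) :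
    TranslationBound (expoPair w₁ w₂ σ) σ := by
  intro T' h T h0 hT G x
  refine (sq_le_sq₀ (norm_nonneg _) (norm_nonneg _)).1 ?_
  rw [norm_sum_smul_expoPair_sq, norm_sum_smul_expoPair_sq]
  simp only [mul_right_comm _ (Complex.exp _) _]
  gcongr 1
  · exact pow_le_pow_left₀ (norm_nonneg _)
      (norm_sum_expo_translate_le G σ (fun j => x j * w₁ j) h0 hT) 2
  · exact pow_le_pow_left₀ (norm_nonneg _)
      (norm_sum_expo_translate_le G σ (fun j => x j * w₂ j) h0 hT) 2

theorem besselBound_expoPair {w₁ w₂ σ : J → ℂ} {T : ℝ} {θ₁ θ₂ : J → ℝ}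
    (h₁ : BesselBound (fun j => w₁ j • expo T (σ j)) θ₁)
    (h₂ : BesselBound (fun j => w₂ j • expo T (σ j)) θ₂) :
    BesselBound (expoPair w₁ w₂ σ T) (fun j => θ₁ j + θ₂ j) := by
  intro G x
  rw [norm_sum_smul_expoPair_sq]
  simp only [add_mul, Finset.sum_add_distrib]
  have a := h₁ G x
  have b := h₂ G x
  simp only [smul_smul] at a b
  exact add_le_add a b

end Exponentials

/-! ### Rules for assembling Bessel and lower bounds. -/

section BesselRules

theorem norm_sum_sq_le {ι V : Type*} [NormedAddCommGroup V] (s : Finset ι) (y : ι → V) :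
    ‖∑ i ∈ s, y i‖ ^ 2 ≤ s.card * ∑ i ∈ s, ‖y i‖ ^ 2 :=
  (pow_le_pow_left₀ (norm_nonneg _) (norm_sum_le _ _) 2).trans sq_sum_le_card_mul_sum_sq

variable {J V : Type*} [NormedAddCommGroup V] [InnerProductSpace ℂ V]

/-- Cauchy–Schwarz after inserting p_j / p_j. A suitable p leaves weights ‖v_j‖/p_j that still tend
to zero. -/
theorem besselBound_of_summable {v : J → V} {p : J → ℝ} (hp : ∀ j, 0 < p j)
    (hs : Summable fun j => p j ^ 2) :
    BesselBound v (fun j => (∑' j, p j ^ 2) * (‖v j‖ / p j) ^ 2) := by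
  intro G x
  have h1 : ‖∑ j ∈ G, x j • v j‖ ≤ ∑ j ∈ G, p j * (‖v j‖ / p j * ‖x j‖) := by
    refine (norm_sum_le _ _).trans (Finset.sum_le_sum fun j _ => le_of_eq ?_)
    have := (hp j).ne'
    rw [norm_smul]
    field_simp
  have h2 : ∑ j ∈ G, p j ^ 2 ≤ ∑' j, p j ^ 2 := hs.sum_le_tsum G fun _ _ => by positivity
  calc _ ≤ (∑ j ∈ G, p j * (‖v j‖ / p j * ‖x j‖)) ^ 2 := by gcongr
    _ ≤ (∑ j ∈ G, p j ^ 2) * ∑ j ∈ G, (‖v j‖ / p j * ‖x j‖) ^ 2 :=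
        Finset.sum_mul_sq_le_sq_mul_sq _ _ _
    _ ≤ (∑' j, p j ^ 2) * ∑ j ∈ G, (‖v j‖ / p j * ‖x j‖) ^ 2 :=
        mul_le_mul_of_nonneg_right h2 (Finset.sum_nonneg fun _ _ => by positivity)
    _ = _ := by simp only [Finset.mul_sum, mul_pow, mul_assoc]

/-- Only finitely many vectors lie outside the tail, and Cauchy–Schwarz charges them to the
constant. -/
theorem exists_besselBound_of_tail {v : ℕ → V} {K : ℝ} {N : ℕ}
    (h : ∀ (G : Finset ℕ), (∀ n ∈ G, N ≤ n) → ∀ x : ℕ → ℂ,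
      ‖∑ n ∈ G, x n • v n‖ ^ 2 ≤ K * ∑ n ∈ G, ‖x n‖ ^ 2) :
    ∃ K' : ℝ, 0 ≤ K' ∧ BesselBound v fun _ => K' := by
  classical
  set A := ∑ n ∈ Finset.range N, ‖v n‖ ^ 2 with hA
  have hA0 : 0 ≤ A := Finset.sum_nonneg fun _ _ => by positivity
  refine ⟨2 * A + 2 * |K|, by positivity, fun G x => ?_⟩
  set G₁ := G.filter fun n => N ≤ n with hG₁
  set G₂ := G.filter fun n => ¬ N ≤ n with hG₂
  have h1 := h G₁ (fun n hn => (Finset.mem_filter.1 hn).2) x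
  have h2 : ‖∑ n ∈ G₂, x n • v n‖ ^ 2 ≤ A * ∑ n ∈ G₂, ‖x n‖ ^ 2 := by
    calc _ ≤ (∑ n ∈ G₂, ‖v n‖ * ‖x n‖) ^ 2 := by
          gcongr
          refine (norm_sum_le _ _).trans (Finset.sum_le_sum fun n _ => ?_)
          rw [norm_smul, mul_comm]
      _ ≤ (∑ n ∈ G₂, ‖v n‖ ^ 2) * ∑ n ∈ G₂, ‖x n‖ ^ 2 := Finset.sum_mul_sq_le_sq_mul_sq _ _ _
      _ ≤ _ := by
          gcongr
          refine Finset.sum_le_sum_of_subset_of_nonneg (fun n hn => ?_) fun _ _ _ => by positivity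
          have := (Finset.mem_filter.1 hn).2
          rw [Finset.mem_range]; omega
  have hsub : ∀ s ⊆ G, ∑ n ∈ s, ‖x n‖ ^ 2 ≤ ∑ n ∈ G, ‖x n‖ ^ 2 := fun s hs =>
    Finset.sum_le_sum_of_subset_of_nonneg hs fun _ _ _ => by positivity
  have h3 := hsub G₁ (Finset.filter_subset _ _)
  have h4 := hsub G₂ (Finset.filter_subset _ _)
  rw [← Finset.sum_filter_add_sum_filter_not G (fun n => N ≤ n) (fun n => x n • v n),
    ← Finset.mul_sum]
  have h5 := norm_add_le (∑ n ∈ G₁, x n • v n) (∑ n ∈ G₂, x n • v n)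
  have h6 : K * ∑ n ∈ G₁, ‖x n‖ ^ 2 ≤ |K| * ∑ n ∈ G, ‖x n‖ ^ 2 :=
    (mul_le_mul_of_nonneg_right (le_abs_self K)
      (Finset.sum_nonneg fun _ _ => by positivity)).trans
      (mul_le_mul_of_nonneg_left h3 (abs_nonneg K))
  have h7 := mul_le_mul_of_nonneg_left h4 hA0
  have h8 : ‖∑ n ∈ G₁, x n • v n + ∑ n ∈ G₂, x n • v n‖ ^ 2 ≤
      2 * ‖∑ n ∈ G₁, x n • v n‖ ^ 2 + 2 * ‖∑ n ∈ G₂, x n • v n‖ ^ 2 := by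
    nlinarith [sq_nonneg (‖∑ n ∈ G₁, x n • v n‖ - ‖∑ n ∈ G₂, x n • v n‖),
      norm_nonneg (∑ n ∈ G₁, x n • v n + ∑ n ∈ G₂, x n • v n)]
  linarith

theorem besselBound_of_fibers {ι κ : Type*} [Fintype κ] {v : ι × κ → V} {θ : ι × κ → ℝ}
    (h : ∀ k, BesselBound (fun n => v (n, k)) fun n => θ (n, k)) :
    BesselBound v fun p => Fintype.card κ * θ p := by
  classical
  intro G x
  set A := G.image Prod.fst with hA
  set y : ι × κ → ℂ := fun p => if p ∈ G then x p else 0 with hy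
  have hsub : G ⊆ A ×ˢ Finset.univ := fun p hp =>
    Finset.mem_product.2 ⟨Finset.mem_image_of_mem _ hp, Finset.mem_univ _⟩
  have e1 : ∑ p ∈ G, x p • v p = ∑ k, ∑ n ∈ A, y (n, k) • v (n, k) := by
    rw [← Finset.sum_product_right (s := A) (t := Finset.univ) (f := fun p => y p • v p),
      ← Finset.sum_subset hsub]
    · exact Finset.sum_congr rfl fun p hp => by simp [hy, hp]
    · intro p _ hp
      simp [hy, hp]
  have e2 : ∑ p ∈ G, Fintype.card κ * θ p * ‖x p‖ ^ 2 =
      Fintype.card κ * ∑ k, ∑ n ∈ A, θ (n, k) * ‖y (n, k)‖ ^ 2 := by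
    rw [← Finset.sum_product_right (s := A) (t := Finset.univ) (f := fun p => θ p * ‖y p‖ ^ 2),
      ← Finset.sum_subset hsub, Finset.mul_sum]
    · exact Finset.sum_congr rfl fun p hp => by simp [hy, hp, mul_assoc]
    · intro p _ hp
      simp [hy, hp]
  rw [e1, e2]
  refine (norm_sum_sq_le _ _).trans ?_
  rw [Finset.card_univ]
  gcongr with k
  exact h k A fun n => y (n, k)

/-- The part supported in S is the whole sum minus the rest; the rest is estimated by the Bessel
inequality with its own weights, and the square of the difference costs the factor 2. -/
theorem sum_filter_le_of_tail {v : J → V} {θ : J → ℝ} (h : BesselBound v θ) {S : Set J}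
    [DecidablePred (· ∈ S)] {κ : ℝ}
    (hS : ∀ G : Finset J, (∀ j ∈ G, j ∈ S) → ∀ x : J → ℂ,
      κ * ∑ j ∈ G, ‖x j‖ ^ 2 ≤ ‖∑ j ∈ G, x j • v j‖ ^ 2) (G : Finset J) (x : J → ℂ) :
    κ * ∑ j ∈ G, (if j ∈ S then 1 else 0) * ‖x j‖ ^ 2 ≤ 2 * (‖∑ j ∈ G, x j • v j‖ ^ 2 +
      ∑ j ∈ G, (if j ∈ S then 0 else θ j) * ‖x j‖ ^ 2) := by
  have h1 := hS (G.filter (· ∈ S)) (fun j hj => (Finset.mem_filter.1 hj).2) x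
  have h2 := h (G.filter (¬ · ∈ S)) x
  have e1 : ∑ j ∈ G, (if j ∈ S then (1 : ℝ) else 0) * ‖x j‖ ^ 2 =
      ∑ j ∈ G.filter (· ∈ S), ‖x j‖ ^ 2 := by
    rw [Finset.sum_filter]; exact Finset.sum_congr rfl fun j _ => by split_ifs <;> simp
  have e2 : ∑ j ∈ G, (if j ∈ S then 0 else θ j) * ‖x j‖ ^ 2 =
      ∑ j ∈ G.filter (¬ · ∈ S), θ j * ‖x j‖ ^ 2 := by
    rw [Finset.sum_filter]; exact Finset.sum_congr rfl fun j _ => by split_ifs <;> simp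
  rw [e1, e2]
  have e3 := Finset.sum_filter_add_sum_filter_not G (· ∈ S) (fun j => x j • v j)
  rw [← eq_sub_iff_add_eq] at e3
  have h5 := norm_sub_le (∑ j ∈ G, x j • v j) (∑ j ∈ G.filter (¬ · ∈ S), x j • v j)
  rw [← e3] at h5
  nlinarith [sq_nonneg (‖∑ j ∈ G, x j • v j‖ - ‖∑ j ∈ G.filter (¬ · ∈ S), x j • v j‖),
    norm_nonneg (∑ j ∈ G.filter (· ∈ S), x j • v j)]

end BesselRules

/-! ### Bessel bounds for the oscillating and the damped families. -/

section ExponentialTails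

theorem exists_besselBound_mirror {s : ℕ → ℂ} {γ β T : ℝ} (hγ : 0 < γ)
    (hs : liminf (fun n => (s (n + 1)).re - (s n).re) atTop = γ)
    (hβ : Tendsto (fun n => (s n).im) atTop (𝓝 β)) (hT : 0 < T) (b : Bool) :
    ∃ K : ℝ, 0 ≤ K ∧ BesselBound (fun n => expo T (mirror s (n, b))) fun _ => K := by
  obtain ⟨K, N, h⟩ := exists_tail_upper_bound (J := ℕ) hγ hs hβ hT
  refine exists_besselBound_of_tail (K := K) (N := N) fun G hG x => ?_
  rw [norm_sum_smul_expo_sq T G (fun n => mirror s (n, b)), ← intervalIntegral.integral_of_le hT.le]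
  exact h G (fun n => (n, b)) (fun n _ m _ h => (Prod.mk.inj h).1) hG x

theorem exists_besselBound_damped {r : ℕ → ℝ} {χ ν T : ℝ} (hr : Tendsto r atTop (𝓝 χ))
    (hν : 1 / 2 < ν) (hT : 0 ≤ T) :
    ∃ θ : ℕ → ℝ, (∀ n, 0 ≤ θ n) ∧ Tendsto θ atTop (𝓝 0) ∧
      BesselBound (fun n : ℕ => ((((n : ℝ) + 1) ^ (-ν) : ℝ) : ℂ) • expo T (-(Complex.I * r n))) θ := by
  -- The weight is split: (n+1)^(-ν') is square summable because ν' > 1/2, and the remaining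
  -- (n+1)^(-(ν-ν')) makes the Bessel weights tend to zero.
  obtain ⟨ν', h1, h2⟩ := exists_between hν
  obtain ⟨A, hA⟩ := hr.abs.bddAbove_range
  have hE : ∀ n, ‖expo T (-(Complex.I * r n))‖ ≤ Real.sqrt (T * Real.exp (A * T) ^ 2) := fun n =>
    Real.le_sqrt_of_sq_le (norm_expo_sq_le hT (by simpa using hA ⟨n, rfl⟩))
  set E := Real.sqrt (T * Real.exp (A * T) ^ 2) with hEdef
  have hpos : ∀ n : ℕ, (0 : ℝ) < (n : ℝ) + 1 := fun n => by positivity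
  have hs : Summable fun n : ℕ => (((n : ℝ) + 1) ^ (-ν')) ^ 2 := by
    have h3 : Summable fun n : ℕ => (n : ℝ) ^ (-(2 * ν')) := Real.summable_nat_rpow.2 (by linarith)
    have h4 := (summable_nat_add_iff 1).2 h3
    refine h4.congr fun n => ?_
    rw [← Real.rpow_natCast, ← Real.rpow_mul (hpos n).le]
    push_cast
    congr 1
    ring
  have hB := besselBound_of_summable
    (v := fun n : ℕ => ((((n : ℝ) + 1) ^ (-ν) : ℝ) : ℂ) • expo T (-(Complex.I * r n)))
    (fun n => Real.rpow_pos_of_pos (hpos n) (-ν')) hs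
  set B := ∑' n : ℕ, (((n : ℝ) + 1) ^ (-ν')) ^ 2 with hBdef
  have hB0 : 0 ≤ B := tsum_nonneg fun _ => by positivity
  refine ⟨fun n => B * (((n : ℝ) + 1) ^ (-(ν - ν')) * E) ^ 2, fun n => by positivity, ?_,
    hB.mono fun n => ?_⟩
  · have h3 : Tendsto (fun n : ℕ => ((n : ℝ) + 1) ^ (-(ν - ν'))) atTop (𝓝 0) :=
      (tendsto_rpow_neg_atTop (sub_pos.2 h2)).comp
        (tendsto_atTop_add_const_right _ _ tendsto_natCast_atTop_atTop)
    simpa using (((h3.mul_const E).pow 2).const_mul B)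
  · gcongr
    rw [norm_smul, Complex.norm_real, Real.norm_of_nonneg (Real.rpow_nonneg (hpos n).le _),
      div_le_iff₀ (Real.rpow_pos_of_pos (hpos n) _)]
    calc _ ≤ ((n : ℝ) + 1) ^ (-ν) * E := by gcongr; exact hE n
      _ = _ := by
        rw [mul_right_comm, ← Real.rpow_add (hpos n)]
        congr 2
        ring

end ExponentialTails

/-! ### Bookkeeping for finitely many families indexed by ℕ. -/

section Families

theorem exists_bound_of_eventually_le {κ : Type*} [Fintype κ] {f : ℕ × κ → ℝ}
    (h : ∀ k, ∃ C, ∀ᶠ n in atTop, f (n, k) ≤ C) : ∃ C, 0 ≤ C ∧ ∀ p, f p ≤ C := by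
  have h1 : ∀ k, ∃ C, ∀ n, f (n, k) ≤ C := fun k => by
    obtain ⟨C, hC⟩ := h k
    have : IsBoundedUnder (· ≤ ·) atTop fun n => f (n, k) := ⟨C, by simpa using hC⟩
    obtain ⟨B, hB⟩ := this.bddAbove_range
    exact ⟨B, fun n => hB ⟨n, rfl⟩⟩
  choose C hC using h1
  refine ⟨∑ k, |C k|, Finset.sum_nonneg fun _ _ => abs_nonneg _, fun p => ?_⟩
  calc f p ≤ C p.2 := hC p.2 p.1
    _ ≤ |C p.2| := le_abs_self _
    _ ≤ _ := Finset.single_le_sum (f := fun k => |C k|) (fun _ _ => abs_nonneg _)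
      (Finset.mem_univ p.2)

theorem finite_of_eventually_not {κ : Type*} [Finite κ] {P : ℕ × κ → Prop}
    (h : ∀ k, ∀ᶠ n in atTop, ¬ P (n, k)) : {p | P p}.Finite := by
  have : {p | P p} ⊆ ⋃ k, (fun n => (n, k)) '' {n | P (n, k)} := by
    rintro ⟨n, k⟩ hp
    exact Set.mem_iUnion.2 ⟨k, n, hp, rfl⟩
  refine (Set.finite_iUnion fun k => Set.Finite.image _ ?_).subset this
  obtain ⟨N, hN⟩ := eventually_atTop.1 (h k)
  refine (Set.finite_Iio N).subset fun n hn => ?_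
  by_contra hcon
  exact hN n (not_lt.1 hcon) hn

theorem fin6_eq_of_lt_two : ∀ k l : Fin 6, k < 2 → l < 2 → decide (k = 1) = decide (l = 1) →
    k = l := by decide

theorem fin6_eq_of_two_le : ∀ k l : Fin 6, 2 ≤ k ∧ k < 4 → 2 ≤ l ∧ l < 4 →
    decide (k = 3) = decide (l = 3) → k = l := by decide

theorem fin6_lt_two : ∀ k : Fin 6, k < 2 → k = 0 ∨ k = 1 := by decide

theorem fin6_two_le : ∀ k : Fin 6, 2 ≤ k ∧ k < 4 → k = 2 ∨ k = 3 := by decide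

end Families

/-! ### The concrete system: Bessel bounds and coercivity. -/

/-- The exponents and the constants of the two series. -/
structure ExpSystem where
  (ω ζ c d : ℕ → ℂ) (r : ℕ → ℝ) (η ν : ℝ)

namespace ExpSystem

/-- The asymptotic hypotheses on the exponents. -/
structure Regular (S : ExpSystem) (γ α χ M b : ℝ) : Prop where
  γ_pos : 0 < γ
  ω_gap : liminf (fun n => (S.ω (n + 1)).re - (S.ω n).re) atTop = γ
  ζ_gap : liminf (fun n => (S.ζ (n + 1)).re - (S.ζ n).re) atTop = γ
  ω_im : Tendsto (fun n => (S.ω n).im) atTop (𝓝 α)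
  ζ_im : Tendsto (fun n => (S.ζ n).im) atTop (𝓝 0)
  r_lim : Tendsto S.r atTop (𝓝 χ)
  c_le : ∀ n, ‖S.c n‖ * ‖S.ω n‖ ≤ M
  d_ne : ∀ n, S.d n ≠ 0
  ζ_le : ∀ n, ‖S.ζ n‖ ≤ b * ‖S.d n‖
  ν_gt : 1 / 2 < S.ν

variable (S : ExpSystem)

/-- The frequencies: `e^{i freq t}` are the exponentials of the two series. -/
def freq (p : ℕ × Fin 6) : ℂ :=
  ![S.ω p.1, -starRingEnd ℂ (S.ω p.1), S.ζ p.1, -starRingEnd ℂ (S.ζ p.1),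
    -(Complex.I * S.r p.1), Complex.I * S.η] p.2

/-- The factors of the coefficients in the first series. -/
def fst (p : ℕ × Fin 6) : ℂ :=
  ![1, 1, (S.d p.1)⁻¹, (starRingEnd ℂ (S.d p.1))⁻¹, ((((p.1 : ℝ) + 1) ^ (-S.ν) : ℝ) : ℂ), 0] p.2

/-- The factors of the coefficients in the second series. -/
def snd (p : ℕ × Fin 6) : ℂ :=
  ![S.c p.1, starRingEnd ℂ (S.c p.1), 1, 1, 0, if p.1 = 0 then 1 else 0] p.2

/-- The pairs of functions whose combinations are the pairs of series. -/
def vec (T : ℝ) (p : ℕ × Fin 6) : L2Pair T := expoPair S.fst S.snd S.freq T p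

/-- Weights in the Bessel inequality of the first series. -/
def weightFst (K : ℝ) (θ : ℕ → ℝ) (p : ℕ × Fin 6) : ℝ :=
  ![K, K, K * ‖(S.d p.1)⁻¹‖ ^ 2, K * ‖(starRingEnd ℂ (S.d p.1))⁻¹‖ ^ 2, θ p.1, 0] p.2

/-- Weights in the Bessel inequality of the second series. -/
def weightSnd (K : ℝ) (p : ℕ × Fin 6) : ℝ :=
  ![K * ‖S.c p.1‖ ^ 2, K * ‖starRingEnd ℂ (S.c p.1)‖ ^ 2, K, K, 0, if p.1 = 0 then K else 0] p.2

variable {S} {γ α χ M b : ℝ}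

theorem besselBound_zero {J V : Type*} [NormedAddCommGroup V] [InnerProductSpace ℂ V] {w : J → ℂ}
    (hw : ∀ j, w j = 0) (e : J → V) : BesselBound (fun j => w j • e j) fun _ => 0 := fun G x => by
  simp [hw]

theorem besselBound_single {V : Type*} [NormedAddCommGroup V] [InnerProductSpace ℂ V] (e : V)
    {K : ℝ} (hK : ‖e‖ ^ 2 ≤ K) :
    BesselBound (fun n : ℕ => (if n = 0 then (1 : ℂ) else 0) • e) fun n => if n = 0 then K else 0 := by
  intro G x
  simp only [ite_smul, one_smul, zero_smul, smul_ite, smul_zero, ite_mul, zero_mul,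
    Finset.sum_ite_eq']
  split_ifs
  · rw [norm_smul, mul_pow, mul_comm]
    gcongr
  · simp

theorem Regular.exists_besselBound (h : S.Regular γ α χ M b) {T : ℝ} (hT : 0 < T) :
    ∃ K : ℝ, ∃ θ : ℕ → ℝ, 0 ≤ K ∧ (∀ n, 0 ≤ θ n) ∧ Tendsto θ atTop (𝓝 0) ∧
      BesselBound (fun p => S.fst p • expo T (S.freq p)) (fun p => 6 * S.weightFst K θ p) ∧
      BesselBound (fun p => S.snd p • expo T (S.freq p)) (fun p => 6 * S.weightSnd K p) := by
  obtain ⟨K₀, h₀, B₀⟩ := exists_besselBound_mirror h.γ_pos h.ω_gap h.ω_im hT false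
  obtain ⟨K₁, h₁, B₁⟩ := exists_besselBound_mirror h.γ_pos h.ω_gap h.ω_im hT true
  obtain ⟨K₂, h₂, B₂⟩ := exists_besselBound_mirror h.γ_pos h.ζ_gap h.ζ_im hT false
  obtain ⟨K₃, h₃, B₃⟩ := exists_besselBound_mirror h.γ_pos h.ζ_gap h.ζ_im hT true
  obtain ⟨θ, hθ0, hθ, B₄⟩ := exists_besselBound_damped h.r_lim h.ν_gt hT.le
  set K₅ := ‖expo T (Complex.I * S.η)‖ ^ 2 with hK₅
  have h₅ : 0 ≤ K₅ := by positivity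
  set K := K₀ + K₁ + K₂ + K₃ + K₅ with hK
  have C₀ := B₀.mono (θ' := fun _ => K) fun _ => by linarith
  have C₁ := B₁.mono (θ' := fun _ => K) fun _ => by linarith
  have C₂ := B₂.mono (θ' := fun _ => K) fun _ => by linarith
  have C₃ := B₃.mono (θ' := fun _ => K) fun _ => by linarith
  have one : ∀ {v : ℕ → L2 T}, BesselBound v (fun _ => K) →
      BesselBound (fun n => (1 : ℂ) • v n) fun _ => K := fun hv => by simpa using hv
  refine ⟨K, θ, by positivity, hθ0, hθ, ?_, ?_⟩
  · have := besselBound_of_fibers (v := fun p => S.fst p • expo T (S.freq p))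
      (θ := S.weightFst K θ) fun k => by
        fin_cases k
        · exact one C₀
        · exact one C₁
        · exact C₂.smul fun n => (S.d n)⁻¹
        · exact C₃.smul fun n => (starRingEnd ℂ (S.d n))⁻¹
        · exact B₄
        · exact besselBound_zero (w := fun _ => 0) (fun _ => rfl) (fun _ => expo T (Complex.I * S.η))
    simpa using this
  · have := besselBound_of_fibers (v := fun p => S.snd p • expo T (S.freq p))
      (θ := S.weightSnd K) fun k => by
        fin_cases k
        · exact C₀.smul fun n => S.c n
        · exact C₁.smul fun n => starRingEnd ℂ (S.c n)
        · exact one C₂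
        · exact one C₃
        · exact besselBound_zero (w := fun _ => 0) (fun _ => rfl)
            (fun n => expo T (-(Complex.I * S.r n)))
        · exact besselBound_single (expo T (Complex.I * S.η)) (K := K) (by linarith)
    simpa using this

theorem Regular.tendsto_c (h : S.Regular γ α χ M b) :
    Tendsto (fun n => ‖S.c n‖) atTop (𝓝 0) := by
  have h1 := tendsto_norm_atTop_of_liminf_gap h.γ_pos h.ω_gap
  refine squeeze_zero' (Eventually.of_forall fun _ => norm_nonneg _) ?_
    (h1.const_div_atTop M)
  filter_upwards [h1.eventually_gt_atTop 0] with n hn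
  rw [le_div_iff₀ hn]
  exact h.c_le n

theorem Regular.tendsto_inv_d (h : S.Regular γ α χ M b) :
    Tendsto (fun n => ‖(S.d n)⁻¹‖) atTop (𝓝 0) := by
  have h1 := tendsto_norm_atTop_of_liminf_gap h.γ_pos h.ζ_gap
  refine squeeze_zero' (Eventually.of_forall fun _ => norm_nonneg _) ?_
    (h1.const_div_atTop b)
  filter_upwards [h1.eventually_gt_atTop 0] with n hn
  have hd := norm_pos_iff.2 (h.d_ne n)
  rw [norm_inv, le_div_iff₀ hn, inv_mul_le_iff₀ hd, mul_comm]
  exact h.ζ_le n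

theorem Regular.exists_im_bound (h : S.Regular γ α χ M b) : ∃ τ, ∀ p, |(S.freq p).im| ≤ τ := by
  obtain ⟨τ, -, hτ⟩ := exists_bound_of_eventually_le (f := fun p => |(S.freq p).im|) fun k => by
    have hω := h.ω_im.abs.eventually (eventually_le_nhds (lt_add_one _))
    have hζ := h.ζ_im.abs.eventually (eventually_le_nhds (lt_add_one _))
    have hr := h.r_lim.abs.eventually (eventually_le_nhds (lt_add_one _))
    fin_cases k
    · exact ⟨_, hω⟩
    · exact ⟨_, hω.mono fun n hn => by simpa [freq] using hn⟩
    · exact ⟨_, hζ⟩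
    · exact ⟨_, hζ.mono fun n hn => by simpa [freq] using hn⟩
    · exact ⟨_, hr.mono fun n hn => by simpa [freq] using hn⟩
    · exact ⟨|S.η|, Eventually.of_forall fun n => by simp [freq]⟩
  exact ⟨τ, hτ⟩

/-- The combinations of the vectors control the coefficients of high index, up to a compact term. -/
theorem Regular.exists_coercive (h : S.Regular γ α χ M b) {T : ℝ} (hT : 2 * Real.pi / γ < T) :
    ∃ Λ : ℝ, ∃ θ : ℕ × Fin 6 → ℝ, ∃ N : ℕ, 0 ≤ Λ ∧ (∀ p, 0 ≤ θ p) ∧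
      (∀ k, Tendsto (fun n => θ (n, k)) atTop (𝓝 0)) ∧
      (∀ k, ∃ C, ∀ᶠ n in atTop, θ (n, k) * ‖S.freq (n, k)‖ ^ 2 ≤ C) ∧
      ∀ (G : Finset (ℕ × Fin 6)) (x : ℕ × Fin 6 → ℂ),
        ∑ p ∈ G, (if p.2 < 4 ∧ N ≤ p.1 then 1 else 0) * ‖x p‖ ^ 2 ≤
          Λ * (‖∑ p ∈ G, x p • S.vec T p‖ ^ 2 + ∑ p ∈ G, θ p * ‖x p‖ ^ 2) := by
  classical
  have hT0 : 0 < T := lt_trans (by have := h.γ_pos; positivity) hT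
  obtain ⟨K, θ, hK, hθ0, hθ, B₁, B₂⟩ := h.exists_besselBound hT0
  obtain ⟨κ₁, hκ₁, N₁, hN₁⟩ :=
    exists_tail_lower_bound (J := ℕ × Fin 6) h.γ_pos h.ω_gap h.ω_im hT
  obtain ⟨κ₂, hκ₂, N₂, hN₂⟩ :=
    exists_tail_lower_bound (J := ℕ × Fin 6) h.γ_pos h.ζ_gap h.ζ_im hT
  set N := max N₁ N₂ with hN
  set S₁ : Set (ℕ × Fin 6) := {p | p.2 < 2 ∧ N ≤ p.1} with hS₁
  set S₂ : Set (ℕ × Fin 6) := {p | (2 ≤ p.2 ∧ p.2 < 4) ∧ N ≤ p.1} with hS₂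
  have w₁0 : ∀ p, 0 ≤ S.weightFst K θ p := by
    rintro ⟨n, k⟩
    fin_cases k <;> simp [weightFst, hK, hθ0] <;> positivity
  have w₂0 : ∀ p, 0 ≤ S.weightSnd K p := by
    rintro ⟨n, k⟩
    fin_cases k <;> simp [weightSnd, hK] <;> positivity
  -- The weights left after removing the principal families: the tails of the ω exponentials in the
  -- first component and of the ζ exponentials in the second. What remains at high index is of order
  -- |c_n|², |d_n|⁻² or the damped weight.
  set θ' : ℕ × Fin 6 → ℝ := fun p => (if p ∈ S₁ then 0 else 6 * S.weightFst K θ p) +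
    (if p ∈ S₂ then 0 else 6 * S.weightSnd K p) with hθ'
  have hθ'0 : ∀ p, 0 ≤ θ' p := fun p => by
    have := w₁0 p
    have := w₂0 p
    simp only [hθ']
    split_ifs <;> positivity
  have eω : ∀ n ≥ N, θ' (n, 0) = 6 * (K * ‖S.c n‖ ^ 2) := fun n hn => by
    simp [hθ', hS₁, hS₂, weightSnd, show N ≤ n from hn]
  have eω' : ∀ n ≥ N, θ' (n, 1) = 6 * (K * ‖S.c n‖ ^ 2) := fun n hn => by
    simp [hθ', hS₁, hS₂, weightSnd, show N ≤ n from hn]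
  have eζ : ∀ n ≥ N, θ' (n, 2) = 6 * (K * ‖(S.d n)⁻¹‖ ^ 2) := fun n hn => by
    simp [hθ', hS₁, hS₂, weightFst, show N ≤ n from hn]
  have eζ' : ∀ n ≥ N, θ' (n, 3) = 6 * (K * ‖(S.d n)⁻¹‖ ^ 2) := fun n hn => by
    simp [hθ', hS₁, hS₂, weightFst, show N ≤ n from hn]
  have er : ∀ n, θ' (n, 4) = 6 * θ n := fun n => by
    simp [hθ', hS₁, hS₂, weightFst, weightSnd]
  have eη : ∀ n ≥ 1, θ' (n, 5) = 0 := fun n hn => by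
    simp [hθ', hS₁, hS₂, weightFst, weightSnd, show n ≠ 0 by omega]
  have hc0 : Tendsto (fun n => 6 * (K * ‖S.c n‖ ^ 2)) atTop (𝓝 0) := by
    simpa using ((h.tendsto_c.pow 2).const_mul K).const_mul 6
  have hd0 : Tendsto (fun n => 6 * (K * ‖(S.d n)⁻¹‖ ^ 2)) atTop (𝓝 0) := by
    simpa using ((h.tendsto_inv_d.pow 2).const_mul K).const_mul 6
  -- The bounds on |c_n||ω_n| and |ζ_n|/|d_n| keep the weights times squared exponents bounded, as
  -- `IsNull.mul_exponent` requires.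
  have hcb : ∀ n, 6 * (K * ‖S.c n‖ ^ 2) * ‖S.ω n‖ ^ 2 ≤ 6 * (K * M ^ 2) := fun n => by
    rw [mul_assoc, mul_assoc, ← mul_pow]
    gcongr
    exact h.c_le n
  have hdb : ∀ n, 6 * (K * ‖(S.d n)⁻¹‖ ^ 2) * ‖S.ζ n‖ ^ 2 ≤ 6 * (K * b ^ 2) := fun n => by
    rw [mul_assoc, mul_assoc, ← mul_pow]
    gcongr
    rw [norm_inv, inv_mul_le_iff₀ (norm_pos_iff.2 (h.d_ne n)), mul_comm]
    exact h.ζ_le n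
  have hNe : ∀ᶠ n in atTop, N ≤ n := eventually_ge_atTop N
  refine ⟨2 / κ₁ + 2 / κ₂, θ', N, by positivity, hθ'0, fun k => ?_, fun k => ?_, fun G x => ?_⟩
  · fin_cases k
    · exact hc0.congr' (hNe.mono fun n hn => (eω n hn).symm)
    · exact hc0.congr' (hNe.mono fun n hn => (eω' n hn).symm)
    · exact hd0.congr' (hNe.mono fun n hn => (eζ n hn).symm)
    · exact hd0.congr' (hNe.mono fun n hn => (eζ' n hn).symm)
    · have : Tendsto (fun n => 6 * θ n) atTop (𝓝 0) := by simpa using hθ.const_mul 6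
      exact this.congr fun n => (er n).symm
    · exact tendsto_const_nhds.congr' ((eventually_ge_atTop 1).mono fun n hn => (eη n hn).symm)
  · fin_cases k
    · refine ⟨_, hNe.mono fun n hn => le_trans (le_of_eq ?_) (hcb n)⟩
      exact congrArg (· * ‖S.ω n‖ ^ 2) (eω n hn)
    · refine ⟨_, hNe.mono fun n hn => le_trans (le_of_eq ?_) (hcb n)⟩
      have := eω' n hn
      simp [this, freq]
    · refine ⟨_, hNe.mono fun n hn => le_trans (le_of_eq ?_) (hdb n)⟩
      exact congrArg (· * ‖S.ζ n‖ ^ 2) (eζ n hn)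
    · refine ⟨_, hNe.mono fun n hn => le_trans (le_of_eq ?_) (hdb n)⟩
      have := eζ' n hn
      simp [this, freq]
    · have h1 : Tendsto (fun n => θ' (n, 4) * ‖S.freq (n, 4)‖ ^ 2) atTop (𝓝 (6 * 0 * |χ| ^ 2)) := by
        simp only [er]
        refine (hθ.const_mul 6).mul ?_
        simpa [freq] using (h.r_lim.abs.pow 2)
      exact ⟨_, h1.eventually (eventually_le_nhds (lt_add_one _))⟩
    · refine ⟨0, (eventually_ge_atTop 1).mono fun n hn => ?_⟩
      have := eη n hn
      simp [this]
  · have t₁ := sum_filter_le_of_tail B₁ (S := S₁) (κ := κ₁) (fun G' hG' y => by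
      -- Slots 0 and 1 are ω and its mirror image, encoded by the Boolean; on them the
      -- first-component factor is 1, so Ingham's lower bound applies without loss.
      have h1 := hN₁ G' (fun p => (p.1, decide (p.2 = 1))) (by
        rintro ⟨n, k⟩ hp ⟨m, l⟩ hq heq
        have a := (hG' _ hp).1
        have b := (hG' _ hq).1
        simp only [Prod.mk.injEq] at heq a b ⊢
        exact ⟨heq.1, fin6_eq_of_lt_two k l a b heq.2⟩) (fun p hp => (le_max_left _ _).trans (hG' p hp).2) y
      rw [intervalIntegral.integral_of_le hT0.le, ← norm_sum_smul_expo_sq] at h1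
      refine h1.trans (le_of_eq ?_)
      congr 2
      refine Finset.sum_congr rfl fun p hp => ?_
      obtain ⟨n, k⟩ := p
      have a := (hG' _ hp).1
      have : k = 0 ∨ k = 1 := fin6_lt_two k a
      rcases this with rfl | rfl <;> simp [fst, freq, mirror]) G x
    have t₂ := sum_filter_le_of_tail B₂ (S := S₂) (κ := κ₂) (fun G' hG' y => by
      have h1 := hN₂ G' (fun p => (p.1, decide (p.2 = 3))) (by
        rintro ⟨n, k⟩ hp ⟨m, l⟩ hq heq
        have a := (hG' _ hp).1
        have b := (hG' _ hq).1
        simp only [Prod.mk.injEq] at heq a b ⊢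
        exact ⟨heq.1, fin6_eq_of_two_le k l a b heq.2⟩) (fun p hp => (le_max_right _ _).trans (hG' p hp).2) y
      rw [intervalIntegral.integral_of_le hT0.le, ← norm_sum_smul_expo_sq] at h1
      refine h1.trans (le_of_eq ?_)
      congr 2
      refine Finset.sum_congr rfl fun p hp => ?_
      obtain ⟨n, k⟩ := p
      have a := (hG' _ hp).1
      have : k = 2 ∨ k = 3 := fin6_two_le k a
      rcases this with rfl | rfl <;> simp [snd, freq, mirror]) G x
    have hv := norm_sum_smul_expoPair_sq S.fst S.snd S.freq T G x
    simp only [mul_smul] at hv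
    change ‖∑ p ∈ G, x p • S.vec T p‖ ^ 2 = _ at hv
    rw [hv]
    have e1 : ∑ p ∈ G, (if p.2 < 4 ∧ N ≤ p.1 then (1 : ℝ) else 0) * ‖x p‖ ^ 2 =
        ∑ p ∈ G, (if p ∈ S₁ then (1 : ℝ) else 0) * ‖x p‖ ^ 2 +
        ∑ p ∈ G, (if p ∈ S₂ then (1 : ℝ) else 0) * ‖x p‖ ^ 2 := by
      rw [← Finset.sum_add_distrib]
      refine Finset.sum_congr rfl fun p _ => ?_
      rw [← add_mul]
      congr 1
      obtain ⟨n, k⟩ := p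
      by_cases hn : N ≤ n <;> fin_cases k <;> simp [hS₁, hS₂, hn]
    have e2 : ∑ p ∈ G, θ' p * ‖x p‖ ^ 2 =
        ∑ p ∈ G, (if p ∈ S₁ then 0 else 6 * S.weightFst K θ p) * ‖x p‖ ^ 2 +
        ∑ p ∈ G, (if p ∈ S₂ then 0 else 6 * S.weightSnd K p) * ‖x p‖ ^ 2 := by
      rw [← Finset.sum_add_distrib]
      exact Finset.sum_congr rfl fun p _ => by rw [← add_mul]
    rw [e1, e2]
    have p₁ : 0 ≤ ∑ p ∈ G, (if p ∈ S₁ then 0 else 6 * S.weightFst K θ p) * ‖x p‖ ^ 2 :=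
      Finset.sum_nonneg fun p _ => mul_nonneg
        (by split_ifs; exacts [le_rfl, mul_nonneg (by norm_num) (w₁0 p)]) (by positivity)
    have p₂ : 0 ≤ ∑ p ∈ G, (if p ∈ S₂ then 0 else 6 * S.weightSnd K p) * ‖x p‖ ^ 2 :=
      Finset.sum_nonneg fun p _ => mul_nonneg
        (by split_ifs; exacts [le_rfl, mul_nonneg (by norm_num) (w₂0 p)]) (by positivity)
    rw [← le_div_iff₀' hκ₁] at t₁
    rw [← le_div_iff₀' hκ₂] at t₂
    refine (add_le_add t₁ t₂).trans ?_
    rw [mul_div_right_comm, mul_div_right_comm, add_mul]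
    have q₁ := sq_nonneg ‖∑ p ∈ G, x p • S.fst p • expo T (S.freq p)‖
    have q₂ := sq_nonneg ‖∑ p ∈ G, x p • S.snd p • expo T (S.freq p)‖
    gcongr 2 / κ₁ * ?_ + 2 / κ₂ * ?_
    · linarith
    · linarith

end ExpSystem

/-! ### Uniqueness and observability for the concrete system. -/

namespace ExpSystem

variable {S : ExpSystem} {γ α χ M b : ℝ}

theorem Regular.exists_besselBound_vec (h : S.Regular γ α χ M b) {T : ℝ} (hT : 0 < T) :
    ∃ K : ℝ, 0 ≤ K ∧ BesselBound (S.vec T) fun _ => K := by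
  obtain ⟨K, θ, hK, hθ0, hθ, B₁, B₂⟩ := h.exists_besselBound hT
  have hB := besselBound_expoPair B₁ B₂
  obtain ⟨C, hC0, hC⟩ := exists_bound_of_eventually_le
    (f := fun p => 6 * S.weightFst K θ p + 6 * S.weightSnd K p) fun k => by
      have hc : Tendsto (fun n => 6 * K + 6 * (K * ‖S.c n‖ ^ 2)) atTop
          (𝓝 (6 * K + 6 * (K * 0 ^ 2))) :=
        (((h.tendsto_c.pow 2).const_mul K).const_mul 6).const_add _
      have hd : Tendsto (fun n => 6 * (K * ‖(S.d n)⁻¹‖ ^ 2) + 6 * K) atTop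
          (𝓝 (6 * (K * 0 ^ 2) + 6 * K)) :=
        (((h.tendsto_inv_d.pow 2).const_mul K).const_mul 6).add_const _
      have hθ' := hθ.const_mul 6
      have hle := fun {u : ℕ → ℝ} {l : ℝ} (hu : Tendsto u atTop (𝓝 l)) =>
        hu.eventually (eventually_le_nhds (lt_add_one l))
      fin_cases k
      · exact ⟨_, hle hc⟩
      · exact ⟨_, (hle hc).mono fun n hn => le_trans (le_of_eq (by simp [weightFst, weightSnd])) hn⟩
      · exact ⟨_, hle hd⟩
      · exact ⟨_, (hle hd).mono fun n hn => le_trans (le_of_eq (by simp [weightFst, weightSnd])) hn⟩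
      · exact ⟨_, (hle hθ').mono fun n hn => le_trans (le_of_eq (by simp [weightFst, weightSnd])) hn⟩
      · refine ⟨6 * K, Eventually.of_forall fun n => ?_⟩
        by_cases hn : n = 0 <;> simp [weightFst, weightSnd, hn, hK]
  exact ⟨C, hC0, hB.mono hC⟩

/-- Distinctness of the exponents `ζ n` from the other exponents of the second series. -/
structure Separated (S : ExpSystem) : Prop where
  ζ_inj : Function.Injective S.ζ
  ω_ne : ∀ n m, S.ω n ≠ S.ζ m
  ω_ne_refl : ∀ n m, S.ω n ≠ -starRingEnd ℂ (S.ζ m)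
  ζ_ne_refl : ∀ n m, S.ζ n ≠ -starRingEnd ℂ (S.ζ m)

/-- Slot 4 is excluded because the damped exponentials are absent from the second component, the
only place where this is used. The exponent iη is fixed by z ↦ -conj z, so ζ_n = iη would contradict
`ζ_ne_refl`. -/
theorem Separated.freq_ne (hs : S.Separated) {n : ℕ} {p : ℕ × Fin 6} (hp : p ≠ (n, 2))
    (hp4 : p.2 ≠ 4) : S.freq p ≠ S.freq (n, 2) := by
  obtain ⟨m, k⟩ := p
  fin_cases k
  · exact hs.ω_ne m n
  · intro h
    refine hs.ω_ne_refl m n ?_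
    have h' : -starRingEnd ℂ (S.ω m) = S.ζ n := h
    rw [← h']
    simp
  · intro h
    have h' : S.ζ m = S.ζ n := h
    exact hp (by rw [hs.ζ_inj h']; rfl)
  · exact fun h => hs.ζ_ne_refl n m (Eq.symm h)
  · exact absurd rfl hp4
  · intro h
    have h' : Complex.I * S.η = S.ζ n := h
    refine hs.ζ_ne_refl n n ?_
    rw [← h']
    simp

theorem Regular.coeff_eq_zero (h : S.Regular γ α χ M b) (hs : S.Separated) {T : ℝ}
    (hT : 2 * Real.pi / γ < T) {x : ℕ × Fin 6 → ℂ} (hx : Summable fun p => ‖x p‖ ^ 2)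
    (h0 : HasSum (fun p => x p • S.vec T p) 0) (n : ℕ) : x (n, 2) = 0 := by
  classical
  have hγ := h.γ_pos
  -- Coercivity still holds on (0,T₀), and T - T₀ leaves room for translations.
  obtain ⟨T₀, hT₀, hT₀T⟩ := exists_between hT
  have hT₀0 : 0 < T₀ := lt_trans (by positivity) hT₀
  obtain ⟨Λ, θ, N, hΛ, hθ0, hθ, hθb, hco⟩ := h.exists_coercive hT₀
  obtain ⟨K, -, hK⟩ := h.exists_besselBound_vec (hT₀0.trans hT₀T)
  obtain ⟨τ, hτ⟩ := h.exists_im_bound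
  have htr : TranslationBound S.vec S.freq := translationBound_expoPair _ _ _
  -- The indices not covered by coercivity are added to the weight. Their exponents are bounded:
  -- finitely many ω and ζ, the convergent r_n, and η.
  set ρ : ℕ × Fin 6 → ℝ := fun p => if p.2 < 4 ∧ N ≤ p.1 then 0 else 1 with hρ
  have hρ0 : ∀ p, 0 ≤ ρ p := fun p => by simp only [hρ]; split_ifs <;> norm_num
  obtain ⟨Θ, hΘ0, hΘ⟩ := exists_bound_of_eventually_le
    (f := fun p => (θ p + ρ p) * ‖S.freq p‖ ^ 2) fun k => by
      obtain ⟨C, hC⟩ := hθb k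
      have h2 : ∃ C', ∀ᶠ m in atTop, ρ (m, k) * ‖S.freq (m, k)‖ ^ 2 ≤ C' := by
        have hz : k < 4 → ∃ C', ∀ᶠ m in atTop, ρ (m, k) * ‖S.freq (m, k)‖ ^ 2 ≤ C' := fun hk =>
          ⟨0, (eventually_ge_atTop N).mono fun m hm => by simp [hρ, hk, hm]⟩
        fin_cases k
        · exact hz (by decide)
        · exact hz (by decide)
        · exact hz (by decide)
        · exact hz (by decide)
        · have h1 : Tendsto (fun m => ρ (m, 4) * ‖S.freq (m, 4)‖ ^ 2) atTop (𝓝 (|χ| ^ 2)) := by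
            simpa [freq, hρ] using (h.r_lim.abs.pow 2)
          exact ⟨_, h1.eventually (eventually_le_nhds (lt_add_one _))⟩
        · exact ⟨|S.η| ^ 2, Eventually.of_forall fun m => by simp [freq, hρ]⟩
      obtain ⟨C', hC'⟩ := h2
      refine ⟨C + C', (hC.and hC').mono fun m hm => ?_⟩
      rw [add_mul]
      exact add_le_add hm.1 hm.2
  have hcoer : ∀ (G : Finset (ℕ × Fin 6)) (x : ℕ × Fin 6 → ℂ), ∑ p ∈ G, ‖x p‖ ^ 2 ≤
      (Λ + 1) * (‖∑ p ∈ G, x p • S.vec T₀ p‖ ^ 2 + ∑ p ∈ G, (θ p + ρ p) * ‖x p‖ ^ 2) := by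
    intro G x
    have e : ∑ p ∈ G, ‖x p‖ ^ 2 =
        ∑ p ∈ G, (if p.2 < 4 ∧ N ≤ p.1 then 1 else 0) * ‖x p‖ ^ 2 + ∑ p ∈ G, ρ p * ‖x p‖ ^ 2 := by
      rw [← Finset.sum_add_distrib]
      refine Finset.sum_congr rfl fun p _ => ?_
      simp only [hρ]
      split_ifs <;> simp
    have h1 := hco G x
    have h2 : 0 ≤ ∑ p ∈ G, ρ p * ‖x p‖ ^ 2 :=
      Finset.sum_nonneg fun p _ => mul_nonneg (hρ0 p) (by positivity)
    have h3 : 0 ≤ ∑ p ∈ G, θ p * ‖x p‖ ^ 2 :=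
      Finset.sum_nonneg fun p _ => mul_nonneg (hθ0 p) (by positivity)
    simp only [add_mul _ _ (‖x _‖ ^ 2), Finset.sum_add_distrib]
    rw [e]
    nlinarith [sq_nonneg ‖∑ p ∈ G, x p • S.vec T₀ p‖, mul_nonneg hΛ h2]
  have hnull : IsNull S.vec T x := ⟨hx, fun T' hT' =>
    squeeze_zero_norm (fun G => htr.restrict hT'.le G x)
      (tendsto_zero_iff_norm_tendsto_zero.1 h0)⟩
  obtain ⟨hk, A, hA⟩ := hnull.exists_bound htr hT₀T hK hτ (by positivity) hΘ0
    (fun p => add_nonneg (hθ0 p) (hρ0 p)) hΘ hcoer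
  -- Passing to the second component discards the damped exponentials, whose exponents r_n
  -- accumulate at χ and would leave infinitely many terms.
  have hsnd : ∀ k : ℕ, HasSum (fun p => S.freq p ^ k • (x p * S.snd p) • expo T₀ (S.freq p)) 0 := by
    intro k
    have h1 := ((hk k).2 T₀ hT₀T).mapL (WithLp.sndL 2 ℂ (L2 T₀) (L2 T₀))
    rw [map_zero] at h1
    have h2 : (fun p => WithLp.sndL 2 ℂ (L2 T₀) (L2 T₀) ((S.freq p ^ k * x p) • S.vec T₀ p)) =
        fun p => S.freq p ^ k • (x p * S.snd p) • expo T₀ (S.freq p) := by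
      funext p
      rw [map_smul, mul_smul, mul_smul]
      rfl
    rwa [h2] at h1
  -- |ω_n| and |ζ_n| tend to infinity while x vanishes at exponents larger than A in modulus.
  have hfin : {p | x p ≠ 0 ∧ S.snd p ≠ 0}.Finite := by
    refine finite_of_eventually_not fun k => ?_
    have hω := (tendsto_norm_atTop_of_liminf_gap hγ h.ω_gap).eventually_gt_atTop A
    have hζ := (tendsto_norm_atTop_of_liminf_gap hγ h.ζ_gap).eventually_gt_atTop A
    fin_cases k
    · exact hω.mono fun m hm hcon => hcon.1 (hA _ hm)
    · exact hω.mono fun m hm hcon => hcon.1 (hA _ (by simpa [freq] using hm))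
    · exact hζ.mono fun m hm hcon => hcon.1 (hA _ hm)
    · exact hζ.mono fun m hm hcon => hcon.1 (hA _ (by simpa [freq] using hm))
    · exact Eventually.of_forall fun m hcon => hcon.2 rfl
    · exact (eventually_ge_atTop 1).mono fun m hm hcon => hcon.2
        (by simp [snd, show m ≠ 0 by omega])
  by_contra hne
  have hmem : (n, 2) ∈ hfin.toFinset := by
    rw [Set.Finite.mem_toFinset]
    exact ⟨hne, by simp [snd]⟩
  have hz := eq_zero_of_moments hfin.toFinset S.freq
    (fun p => (x p * S.snd p) • expo T₀ (S.freq p)) (fun k => by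
      refine (hasSum_sum_of_ne_finset_zero fun p hp => ?_).unique (hsnd k)
      have : x p * S.snd p = 0 := by
        by_contra hcon
        exact hp (hfin.mem_toFinset.2 (mul_ne_zero_iff.1 hcon))
      rw [this, zero_smul, smul_zero]) hmem (fun p hp hpn => hs.freq_ne hpn fun h4 => by
      have := (hfin.mem_toFinset.1 hp).2
      obtain ⟨m, k⟩ := p
      obtain rfl : k = 4 := h4
      exact this rfl)
  rcases smul_eq_zero.1 hz with h1 | h1
  · exact hne (by simpa [snd] using h1)
  · exact expo_ne_zero hT₀0 _ h1

/-- Coefficients dominated by those of the exponentials of frequency `ζ n`. -/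
def dominated (L : ℝ) : Set (ℕ × Fin 6 → ℂ) :=
  {x | (∀ n k, k ≠ 5 → ‖x (n, k)‖ ≤ L * ‖x (n, 2)‖) ∧ ∀ n, n ≠ 0 → x (n, 5) = 0}

/-- Square summable dominated coefficients, with a bound on the remaining coefficient. -/
def admissible (L : ℝ) : Set (ℕ × Fin 6 → ℂ) :=
  {x | x ∈ dominated L ∧ (Summable fun p => ‖x p‖ ^ 2) ∧
    ‖x (0, 5)‖ ^ 2 ≤ L * ∑' n, ‖x (n, 2)‖ ^ 2}

theorem isClosed_dominated (L : ℝ) : IsClosed (dominated L) := by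
  have : dominated L = (⋂ n, ⋂ k, ⋂ (_ : k ≠ 5), {x | ‖x (n, k)‖ ≤ L * ‖x (n, 2)‖}) ∩
      ⋂ n, ⋂ (_ : n ≠ 0), {x | x (n, 5) = 0} := by
    ext x
    simp [dominated]
  rw [this]
  refine IsClosed.inter
    (isClosed_iInter fun n => isClosed_iInter fun k => isClosed_iInter fun _ => ?_)
    (isClosed_iInter fun n => isClosed_iInter fun _ => ?_)
  · exact isClosed_le (by fun_prop) (by fun_prop)
  · exact isClosed_eq (by fun_prop) continuous_const

theorem smul_mem_admissible {L : ℝ} {x : ℕ × Fin 6 → ℂ} (hx : x ∈ admissible L) {s : ℝ}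
    (hs : 0 < s) : (fun p => (s : ℂ) * x p) ∈ admissible L := by
  have hn : ∀ p, ‖(s : ℂ) * x p‖ = s * ‖x p‖ := fun p => by
    rw [norm_mul, Complex.norm_real, Real.norm_of_nonneg hs.le]
  refine ⟨⟨fun n k hk => ?_, fun n hn0 => ?_⟩, ?_, ?_⟩
  · rw [hn, hn, mul_left_comm]
    exact mul_le_mul_of_nonneg_left (hx.1.1 n k hk) hs.le
  · change (s : ℂ) * x (n, 5) = 0
    rw [hx.1.2 n hn0, mul_zero]
  · simp only [hn, mul_pow]
    exact hx.2.1.mul_left _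
  · simp only [hn, mul_pow]
    rw [tsum_mul_left, mul_left_comm]
    exact mul_le_mul_of_nonneg_left hx.2.2 (by positivity)

theorem summable_fiber {x : ℕ × Fin 6 → ℂ} (hx : Summable fun p => ‖x p‖ ^ 2) (k : Fin 6) :
    Summable fun n => ‖x (n, k)‖ ^ 2 :=
  hx.comp_injective (i := fun n : ℕ => (n, k)) fun _ _ h => (Prod.mk.inj h).1

/-- Five slots are each dominated by slot 2 with constant L², and the single coefficient in slot 5
contributes L. -/
theorem tsum_norm_sq_le_of_mem_admissible {L : ℝ} {x : ℕ × Fin 6 → ℂ} (hx : x ∈ admissible L) :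
    ∑' p, ‖x p‖ ^ 2 ≤ (5 * L ^ 2 + L) * ∑' n, ‖x (n, 2)‖ ^ 2 := by
  have hB := summable_fiber hx.2.1 2
  have h5 : HasSum (fun n => ‖x (n, 5)‖ ^ 2) (‖x (0, 5)‖ ^ 2) :=
    hasSum_single 0 fun n hn => by rw [hx.1.2 n hn]; simp
  rw [hx.2.1.tsum_prod]
  simp only [tsum_fintype]
  have hsum : Summable fun n => 5 * L ^ 2 * ‖x (n, 2)‖ ^ 2 + ‖x (n, 5)‖ ^ 2 :=
    (hB.mul_left _).add h5.summable
  have hle : ∀ n, ∑ k, ‖x (n, k)‖ ^ 2 ≤ 5 * L ^ 2 * ‖x (n, 2)‖ ^ 2 + ‖x (n, 5)‖ ^ 2 := by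
    intro n
    have hk : ∀ k, k ≠ 5 → ‖x (n, k)‖ ^ 2 ≤ L ^ 2 * ‖x (n, 2)‖ ^ 2 := fun k hk => by
      rw [← mul_pow]
      exact pow_le_pow_left₀ (norm_nonneg _) (hx.1.1 n k hk) 2
    have h0 := hk 0 (by decide)
    have h1 := hk 1 (by decide)
    have h2 := hk 2 (by decide)
    have h3 := hk 3 (by decide)
    have h4 := hk 4 (by decide)
    rw [Fin.sum_univ_six]
    linarith
  refine (Summable.tsum_le_tsum hle (Summable.of_nonneg_of_le
    (fun n => Finset.sum_nonneg fun _ _ => by positivity) hle hsum) hsum).trans ?_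
  rw [Summable.tsum_add (hB.mul_left _) h5.summable, tsum_mul_left, h5.tsum_eq, add_mul]
  gcongr
  exact hx.2.2

theorem Regular.exists_observability (h : S.Regular γ α χ M b) (hs : S.Separated) {T : ℝ}
    (hT : 2 * Real.pi / γ < T) {L : ℝ} (hL : 0 ≤ L) :
    ∃ c > 0, ∀ x ∈ admissible L,
      ∑' p, ‖x p‖ ^ 2 ≤ c * ‖∑' p, x p • S.vec T p‖ ^ 2 := by
  have hT0 : 0 < T := lt_trans (by have := h.γ_pos; positivity) hT
  obtain ⟨K, -, hK⟩ := h.exists_besselBound_vec hT0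
  obtain ⟨Λ, θ, N, hΛ, hθ0, hθ, -, hco⟩ := h.exists_coercive hT
  -- The finitely many indices below N escape Ingham's lower bound; adding them to the weight
  -- changes it only at finitely many places.
  set ρ : ℕ × Fin 6 → ℝ := fun p => if p.1 < N then 1 else 0 with hρ
  have hρ0 : ∀ p, 0 ≤ ρ p := fun p => by simp only [hρ]; split_ifs <;> norm_num
  have hlim : ∀ k, Tendsto (fun n => θ (n, k) + ρ (n, k)) atTop (𝓝 0) := fun k => by
    refine (hθ k).congr' ((eventually_ge_atTop N).mono fun n hn => ?_)
    simp [hρ, not_lt.2 hn]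
  obtain ⟨Kθ, -, hKθ⟩ := exists_bound_of_eventually_le (f := fun p => θ p + ρ p) fun k =>
    ⟨_, (hlim k).eventually (eventually_le_nhds (zero_lt_one' ℝ))⟩
  -- The bound on the coordinate (0,5) involves an infinite sum and may be lost in a coordinatewise
  -- limit. The closed set is therefore `dominated`, and the kernel argument does without that
  -- bound.
  refine exists_observability_of_compact (Λ := (5 * L ^ 2 + L) * (Λ + 1)) hK
    (θ := fun p => θ p + ρ p) (fun p => add_nonneg (hθ0 p) (hρ0 p))
    (fun ε hε => finite_of_eventually_not fun k => ?_) hKθ (𝓐 := dominated L)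
    (fun x hx => hx.1) (isClosed_dominated L) (fun x hx s hs => smul_mem_admissible hx hs)
    (fun x hx => hx.2.1) (fun x hx => ?_) (fun x hx hx2 hx0 => ?_)
  · filter_upwards [(hlim k).eventually (eventually_le_nhds hε)] with n hn
    exact not_lt.2 hn
  · have hl := hx.2.1
    have hsθ : Summable fun p => θ p * ‖x p‖ ^ 2 :=
      Summable.of_nonneg_of_le (fun p => mul_nonneg (hθ0 p) (by positivity))
        (fun p => mul_le_mul_of_nonneg_right
          ((le_add_of_nonneg_right (hρ0 p)).trans (hKθ p)) (by positivity)) (hl.mul_left Kθ)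
    have hsρ : Summable fun p => ρ p * ‖x p‖ ^ 2 :=
      Summable.of_nonneg_of_le (fun p => mul_nonneg (hρ0 p) (by positivity))
        (fun p => mul_le_mul_of_nonneg_right
          ((le_add_of_nonneg_left (hθ0 p)).trans (hKθ p)) (by positivity)) (hl.mul_left Kθ)
    set ι : ℕ × Fin 6 → ℝ := fun p => if p.2 < 4 ∧ N ≤ p.1 then 1 else 0 with hι
    have hι0 : ∀ p, 0 ≤ ι p := fun p => by simp only [hι]; split_ifs <;> norm_num
    have hι1 : ∀ p, ι p ≤ 1 := fun p => by simp only [hι]; split_ifs <;> norm_num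
    have hsι : Summable fun p => ι p * ‖x p‖ ^ 2 :=
      Summable.of_nonneg_of_le (fun p => mul_nonneg (hι0 p) (by positivity))
        (fun p => mul_le_of_le_one_left (by positivity) (hι1 p)) hl
    have h1 : ∑' p, ι p * ‖x p‖ ^ 2 ≤
        Λ * (‖∑' p, x p • S.vec T p‖ ^ 2 + ∑' p, θ p * ‖x p‖ ^ 2) :=
      le_of_tendsto_of_tendsto' hsι.hasSum
        ((((Tendsto.norm (hK.summable hl).hasSum).pow 2).add hsθ.hasSum).const_mul Λ)
        fun G => hco G x
    have h2 : ∑' n, ‖x (n, 2)‖ ^ 2 ≤ ∑' p, (ι p * ‖x p‖ ^ 2 + ρ p * ‖x p‖ ^ 2) := by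
      refine le_trans ?_ (tsum_comp_le_tsum_of_inj (hsι.add hsρ)
        (fun p => add_nonneg (mul_nonneg (hι0 p) (by positivity))
          (mul_nonneg (hρ0 p) (by positivity))) (i := fun n : ℕ => (n, (2 : Fin 6)))
        fun _ _ h => (Prod.mk.inj h).1)
      refine Summable.tsum_le_tsum (fun n => ?_) (summable_fiber hl 2)
        ((hsι.add hsρ).comp_injective fun _ _ h => (Prod.mk.inj h).1)
      have : (2 : Fin 6) < 4 := by decide
      rcases lt_or_ge n N with hn | hn
      · simp [hι, hρ, hn, not_le.2 hn]
      · simp [hι, hρ, hn, not_lt.2 hn, this]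
    rw [hsι.tsum_add hsρ] at h2
    refine (tsum_norm_sq_le_of_mem_admissible hx).trans ?_
    rw [mul_assoc]
    refine mul_le_mul_of_nonneg_left ?_ (by positivity)
    simp only [add_mul _ _ (‖x _‖ ^ 2)]
    rw [hsθ.tsum_add hsρ]
    have h3 : 0 ≤ ∑' p, ρ p * ‖x p‖ ^ 2 := tsum_nonneg fun p => mul_nonneg (hρ0 p) (by positivity)
    have h4 : 0 ≤ ∑' p, θ p * ‖x p‖ ^ 2 := tsum_nonneg fun p => mul_nonneg (hθ0 p) (by positivity)
    nlinarith [sq_nonneg ‖∑' p, x p • S.vec T p‖, mul_nonneg hΛ h3]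
  -- Uniqueness kills slot 2, domination then kills everything except (0,5), and there a single
  -- nonzero vector remains.
  · have hsum := (hK.summable hx2).hasSum
    rw [hx0] at hsum
    have hB := h.coeff_eq_zero hs hT hx2 hsum
    have hk : ∀ n k, k ≠ 5 → x (n, k) = 0 := fun n k hk => by
      have := hx.1 n k hk
      rw [hB n, norm_zero, mul_zero] at this
      exact norm_le_zero_iff.1 this
    have hoth : ∀ p, p ≠ (0, 5) → x p = 0 := by
      rintro ⟨n, k⟩ hp
      by_cases h5 : k = 5
      · subst h5
        exact hx.2 n fun hn => hp (by rw [hn])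
      · exact hk n k h5
    have h5 : x (0, 5) • S.vec T (0, 5) = 0 :=
      (hasSum_single (0, 5) fun p hp => by rw [hoth p hp, zero_smul]).unique hsum
    have hv : S.vec T (0, 5) ≠ 0 := by
      intro hv
      have := congrArg (WithLp.sndL 2 ℂ (L2 T) (L2 T)) hv
      rw [map_zero] at this
      have h6 : (1 : ℂ) • expo T (S.freq (0, 5)) = 0 := this
      rw [one_smul] at h6
      exact expo_ne_zero hT0 _ h6
    funext p
    by_cases hp : p = (0, 5)
    · rw [hp]
      exact (smul_eq_zero.1 h5).resolve_right hv
    · exact hoth p hp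

end ExpSystem

/-! ### Identification of the two series with the vector sum. -/

namespace ExpSystem

variable {S : ExpSystem} {γ α χ M b : ℝ}

/-- The coefficients of the pair of series with respect to the vectors `S.vec T`. -/
def coeff (S : ExpSystem) (C D : ℕ → ℂ) (R : ℕ → ℝ) (𝓔 : ℝ) (p : ℕ × Fin 6) : ℂ :=
  ![C p.1, starRingEnd ℂ (C p.1), S.d p.1 * D p.1, starRingEnd ℂ (S.d p.1 * D p.1),
    ((((p.1 : ℝ) + 1) ^ S.ν * R p.1 : ℝ) : ℂ), if p.1 = 0 then (𝓔 : ℂ) else 0] p.2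

theorem exp_conj_freq (z : ℂ) (t : ℝ) :
    Complex.exp (Complex.I * -starRingEnd ℂ z * t) =
      Complex.exp (-Complex.I * starRingEnd ℂ z * t) := by
  congr 1; ring

theorem expSum_fst (hd : ∀ n, S.d n ≠ 0) (C D : ℕ → ℂ) (R : ℕ → ℝ) (𝓔 : ℝ) (N : ℕ) (t : ℝ) :
    expSum (Finset.range N ×ˢ Finset.univ) S.freq (fun p => S.coeff C D R 𝓔 p * S.fst p) t =
      ∑ n ∈ Finset.range N, term₁ S.ω S.ζ S.r C D R n t := by
  rw [expSum, Finset.sum_product]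
  refine Finset.sum_congr rfl fun n _ => ?_
  have hdc : starRingEnd ℂ (S.d n) ≠ 0 := (map_ne_zero _).2 (hd n)
  have e1 : S.d n * D n * (S.d n)⁻¹ = D n := by field_simp [hd n]
  have e2 : starRingEnd ℂ (S.d n * D n) * (starRingEnd ℂ (S.d n))⁻¹ = starRingEnd ℂ (D n) := by
    rw [map_mul]; field_simp
  have hp : (0 : ℝ) < (n : ℝ) + 1 := by positivity
  have e3 : ((((n : ℝ) + 1) ^ S.ν * R n : ℝ) : ℂ) * ((((n : ℝ) + 1) ^ (-S.ν) : ℝ) : ℂ) = R n := by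
    rw [← Complex.ofReal_mul, mul_right_comm, ← Real.rpow_add hp]
    simp
  have e4 : Complex.exp (Complex.I * -(Complex.I * S.r n) * t) = (Real.exp (S.r n * t) : ℝ) := by
    rw [Complex.ofReal_exp]
    congr 1
    push_cast
    linear_combination (-(S.r n * t) : ℂ) * Complex.I_sq
  rw [Fin.sum_univ_six]
  change C n * 1 * Complex.exp (Complex.I * S.ω n * t) +
    starRingEnd ℂ (C n) * 1 * Complex.exp (Complex.I * -starRingEnd ℂ (S.ω n) * t) +
    S.d n * D n * (S.d n)⁻¹ * Complex.exp (Complex.I * S.ζ n * t) +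
    starRingEnd ℂ (S.d n * D n) * (starRingEnd ℂ (S.d n))⁻¹ *
      Complex.exp (Complex.I * -starRingEnd ℂ (S.ζ n) * t) +
    ((((n : ℝ) + 1) ^ S.ν * R n : ℝ) : ℂ) * ((((n : ℝ) + 1) ^ (-S.ν) : ℝ) : ℂ) *
      Complex.exp (Complex.I * -(Complex.I * S.r n) * t) +
    (if n = 0 then (𝓔 : ℂ) else 0) * 0 * Complex.exp (Complex.I * (Complex.I * S.η) * t) = _
  rw [e1, e2, e3, e4, exp_conj_freq, exp_conj_freq, term₁, wavePair, wavePair]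
  push_cast
  ring

/-- The extra exponential is stored at index n = 0, so it is present in every partial sum as soon as
N ≥ 1. -/
theorem expSum_snd (C D : ℕ → ℂ) (R : ℕ → ℝ) (𝓔 : ℝ) {N : ℕ} (hN : 1 ≤ N) (t : ℝ) :
    expSum (Finset.range N ×ˢ Finset.univ) S.freq (fun p => S.coeff C D R 𝓔 p * S.snd p) t =
      ∑ n ∈ Finset.range N, term₂ S.ω S.ζ S.c S.d C D n t + ((𝓔 * Real.exp (-S.η * t) : ℝ) : ℂ) := by
  have hE : ((𝓔 * Real.exp (-S.η * t) : ℝ) : ℂ) =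
      ∑ n ∈ Finset.range N, if n = 0 then ((𝓔 * Real.exp (-S.η * t) : ℝ) : ℂ) else 0 := by
    rw [Finset.sum_ite_eq', if_pos (Finset.mem_range.2 hN)]
  rw [hE, ← Finset.sum_add_distrib, expSum, Finset.sum_product]
  refine Finset.sum_congr rfl fun n _ => ?_
  have e4 : Complex.exp (Complex.I * (Complex.I * S.η) * t) = (Real.exp (-S.η * t) : ℝ) := by
    rw [Complex.ofReal_exp]
    congr 1
    push_cast
    linear_combination (S.η * t : ℂ) * Complex.I_sq
  rw [Fin.sum_univ_six]
  change C n * S.c n * Complex.exp (Complex.I * S.ω n * t) +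
    starRingEnd ℂ (C n) * starRingEnd ℂ (S.c n) *
      Complex.exp (Complex.I * -starRingEnd ℂ (S.ω n) * t) +
    S.d n * D n * 1 * Complex.exp (Complex.I * S.ζ n * t) +
    starRingEnd ℂ (S.d n * D n) * 1 * Complex.exp (Complex.I * -starRingEnd ℂ (S.ζ n) * t) +
    ((((n : ℝ) + 1) ^ S.ν * R n : ℝ) : ℂ) * 0 *
      Complex.exp (Complex.I * -(Complex.I * S.r n) * t) +
    (if n = 0 then (𝓔 : ℂ) else 0) * (if n = 0 then (1 : ℂ) else 0) *
      Complex.exp (Complex.I * (Complex.I * S.η) * t) = _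
  rw [e4, exp_conj_freq, exp_conj_freq, term₂, wavePair, wavePair, map_mul (starRingEnd ℂ) (S.c n)]
  split_ifs <;> push_cast <;> ring

theorem tendsto_toLp_iff {T : ℝ} {F : ℕ → ℝ → ℂ} (hF : ∀ N, Continuous (F N)) {u : ℝ → ℂ}
    (hu : MemLp u 2 (volume.restrict (Set.Ioc 0 T))) :
    Tendsto (fun N => (memLp_of_continuous (hF N) T).toLp (F N)) atTop (𝓝 (hu.toLp u)) ↔
      Tendsto (fun N => eLpNorm (fun t => u t - F N t) 2 (volume.restrict (Set.Ioc 0 T)))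
        atTop (𝓝 0) := by
  rw [Lp.tendsto_Lp_iff_tendsto_eLpNorm'' F (fun N => memLp_of_continuous (hF N) T) u hu]
  refine tendsto_congr fun N => ?_
  rw [eLpNorm_sub_comm]
  rfl

theorem tendsto_range_product : Tendsto
    (fun N : ℕ => Finset.range N ×ˢ (Finset.univ : Finset (Fin 6))) atTop atTop := by
  refine tendsto_atTop_finset_of_monotone (fun m n hmn => ?_) fun p => ⟨p.1 + 1, ?_⟩
  · exact Finset.product_subset_product_left (Finset.range_mono hmn)
  · simp

theorem tendsto_fst_snd {T : ℝ} {x : ℕ × Fin 6 → ℂ} {y : L2Pair T}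
    (hy : HasSum (fun p => x p • S.vec T p) y) :
    Tendsto (fun N : ℕ => (memLp_of_continuous (continuous_expSum
      (Finset.range N ×ˢ Finset.univ) S.freq (fun p => x p * S.fst p)) T).toLp _) atTop (𝓝 y.fst) ∧
    Tendsto (fun N : ℕ => (memLp_of_continuous (continuous_expSum
      (Finset.range N ×ˢ Finset.univ) S.freq (fun p => x p * S.snd p)) T).toLp _)
        atTop (𝓝 y.snd) := by
  have h := Tendsto.comp hy tendsto_range_product
  have h1 := ((WithLp.fstL 2 ℂ (L2 T) (L2 T)).continuous.tendsto y).comp h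
  have h2 := ((WithLp.sndL 2 ℂ (L2 T) (L2 T)).continuous.tendsto y).comp h
  have e := fun N : ℕ => sum_smul_expoPair S.fst S.snd S.freq T
    (Finset.range N ×ˢ (Finset.univ : Finset (Fin 6))) x
  constructor
  · refine h1.congr fun N => ?_
    rw [← sum_smul_expo]
    exact congrArg (WithLp.fstL 2 ℂ (L2 T) (L2 T)) (e N)
  · refine h2.congr fun N => ?_
    rw [← sum_smul_expo]
    exact congrArg (WithLp.sndL 2 ℂ (L2 T) (L2 T)) (e N)

/-- The unconditional sum y is evaluated along the rectangles `range N` × `univ`, whose sums are the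
partial sums of the two series. Uniqueness of limits in L² then identifies the classes of u₁ and u₂
with the components of y. -/
theorem isSolutionPair_iff (hd : ∀ n, S.d n ≠ 0) {T : ℝ} {C D : ℕ → ℂ} {R : ℕ → ℝ} {𝓔 : ℝ}
    {y : L2Pair T} (hy : HasSum (fun p => S.coeff C D R 𝓔 p • S.vec T p) y) (u₁ u₂ : ℝ → ℂ) :
    IsSolutionPair T S.η S.ω S.ζ S.r S.c S.d C D R 𝓔 u₁ u₂ ↔
      ∃ (h₁ : MemLp u₁ 2 (volume.restrict (Set.Ioc 0 T)))
        (h₂ : MemLp u₂ 2 (volume.restrict (Set.Ioc 0 T))),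
        h₁.toLp u₁ = y.fst ∧ h₂.toLp u₂ = y.snd := by
  obtain ⟨t₁, t₂⟩ := tendsto_fst_snd hy
  have hE : MemLp (fun t : ℝ => ((𝓔 * Real.exp (-S.η * t) : ℝ) : ℂ)) 2
      (volume.restrict (Set.Ioc 0 T)) := memLp_of_continuous (by fun_prop) T
  have i₁ : ∀ h₁ : MemLp u₁ 2 (volume.restrict (Set.Ioc 0 T)),
      Tendsto (fun N : ℕ => eLpNorm (fun t => u₁ t - ∑ n ∈ Finset.range N,
        term₁ S.ω S.ζ S.r C D R n t) 2 (volume.restrict (Set.Ioc 0 T))) atTop (𝓝 0) ↔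
        h₁.toLp u₁ = y.fst := fun h₁ => by
    have := tendsto_toLp_iff (fun N => continuous_expSum (Finset.range N ×ˢ Finset.univ) S.freq
      (fun p => S.coeff C D R 𝓔 p * S.fst p)) h₁
    simp only [expSum_fst hd] at this
    rw [← this]
    exact ⟨fun h => tendsto_nhds_unique h t₁, fun h => h ▸ t₁⟩
  have i₂ : ∀ h₂ : MemLp u₂ 2 (volume.restrict (Set.Ioc 0 T)),
      Tendsto (fun N : ℕ => eLpNorm (fun t => u₂ t - ((𝓔 * Real.exp (-S.η * t) : ℝ) : ℂ) -
        ∑ n ∈ Finset.range N, term₂ S.ω S.ζ S.c S.d C D n t) 2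
          (volume.restrict (Set.Ioc 0 T))) atTop (𝓝 0) ↔ h₂.toLp u₂ = y.snd := fun h₂ => by
    have := tendsto_toLp_iff (fun N => continuous_expSum (Finset.range N ×ˢ Finset.univ) S.freq
      (fun p => S.coeff C D R 𝓔 p * S.snd p)) h₂
    have hcongr : (fun N : ℕ => eLpNorm (fun t => u₂ t - expSum (Finset.range N ×ˢ Finset.univ)
          S.freq (fun p => S.coeff C D R 𝓔 p * S.snd p) t) 2 (volume.restrict (Set.Ioc 0 T)))
        =ᶠ[atTop] fun N : ℕ => eLpNorm (fun t => u₂ t - ((𝓔 * Real.exp (-S.η * t) : ℝ) : ℂ) -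
        ∑ n ∈ Finset.range N, term₂ S.ω S.ζ S.c S.d C D n t) 2
          (volume.restrict (Set.Ioc 0 T)) := by
      filter_upwards [eventually_ge_atTop 1] with N hN
      congr 1
      funext t
      rw [expSum_snd C D R 𝓔 hN t]
      ring
    rw [tendsto_congr' hcongr] at this
    rw [← this]
    exact ⟨fun h => tendsto_nhds_unique h t₂, fun h => h ▸ t₂⟩
  constructor
  · rintro ⟨⟨h₁, l₁⟩, h₂', l₂⟩
    have h₂ : MemLp u₂ 2 (volume.restrict (Set.Ioc 0 T)) := by
      have := h₂'.add hE
      refine this.ae_eq (Eventually.of_forall fun t => ?_)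
      simp
    exact ⟨h₁, h₂, (i₁ h₁).1 l₁, (i₂ h₂).1 l₂⟩
  · rintro ⟨h₁, h₂, e₁, e₂⟩
    exact ⟨⟨h₁, (i₁ h₁).2 e₁⟩, h₂.sub hE, (i₂ h₂).2 e₂⟩

theorem integral_eq_norm_sq {T : ℝ} (hT : 0 ≤ T) {y : L2Pair T} {u₁ u₂ : ℝ → ℂ}
    (h₁ : MemLp u₁ 2 (volume.restrict (Set.Ioc 0 T)))
    (h₂ : MemLp u₂ 2 (volume.restrict (Set.Ioc 0 T)))
    (e₁ : h₁.toLp u₁ = y.fst) (e₂ : h₂.toLp u₂ = y.snd) :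
    ∫ t in (0 : ℝ)..T, (‖u₁ t‖ ^ 2 + ‖u₂ t‖ ^ 2) = ‖y‖ ^ 2 := by
  rw [WithLp.prod_norm_sq_eq_of_L2, ← e₁, ← e₂, norm_toLp_sq, norm_toLp_sq,
    intervalIntegral.integral_of_le hT]
  exact integral_add (h₁.integrable_norm_pow two_ne_zero) (h₂.integrable_norm_pow two_ne_zero)

theorem coeff_mem_admissible (S : ExpSystem) (hν : 0 ≤ S.ν) (N₀ : ℕ) {μ : ℝ} (hμ : 0 ≤ μ)
    (hM : 0 ≤ M) {C D : ℕ → ℂ} {R : ℕ → ℝ} {𝓔 : ℝ}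
    (h : AdmissibleCoeffs S.d N₀ μ S.ν M C D R 𝓔) :
    S.coeff C D R 𝓔 ∈ admissible (1 + M + μ * ((N₀ : ℝ) + 1) ^ S.ν * (1 + M) + M * (1 + M) ^ 2) := by
  set x := S.coeff C D R 𝓔 with hx
  set Q := ((N₀ : ℝ) + 1) ^ S.ν with hQ
  -- One summand per constraint: 1 for dD and its conjugate, M for C, the third for (n+1)^ν R (Q
  -- covers the indices n ≤ N₀, and √energy ≤ (1 + M)|d_nD_n|), the last for 𝓔.
  set L := 1 + M + μ * Q * (1 + M) + M * (1 + M) ^ 2 with hL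
  have hQ1 : 1 ≤ Q := Real.one_le_rpow (by linarith [Nat.cast_nonneg (α := ℝ) N₀]) hν
  have q1 : 0 ≤ μ * Q * (1 + M) := by positivity
  have q2 : 0 ≤ M * (1 + M) ^ 2 := by positivity
  have x0 : ∀ n, ‖x (n, 0)‖ = ‖C n‖ := fun n => rfl
  have x1 : ∀ n, ‖x (n, 1)‖ = ‖C n‖ := fun n => RCLike.norm_conj _
  have x2 : ∀ n, ‖x (n, 2)‖ = ‖S.d n * D n‖ := fun n => rfl
  have x3 : ∀ n, ‖x (n, 3)‖ = ‖S.d n * D n‖ := fun n => RCLike.norm_conj _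
  have x4 : ∀ n, ‖x (n, 4)‖ = ((n : ℝ) + 1) ^ S.ν * |R n| := fun n => by
    have : x (n, 4) = ((((n : ℝ) + 1) ^ S.ν * R n : ℝ) : ℂ) := rfl
    rw [this, Complex.norm_real, Real.norm_eq_abs, abs_mul, abs_of_nonneg (by positivity)]
  have x50 : x (0, 5) = 𝓔 := rfl
  have x5 : ∀ n, n ≠ 0 → x (n, 5) = 0 := fun n hn => by simp [hx, coeff, hn]
  have hen : ∀ n, energy S.d C D n ≤ (1 + M) ^ 2 * ‖S.d n * D n‖ ^ 2 := fun n => by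
    have := pow_le_pow_left₀ (norm_nonneg _) (h.bound_C n) 2
    rw [energy]
    nlinarith [mul_nonneg hM (sq_nonneg ‖S.d n * D n‖)]
  have hsq : ∀ n, Real.sqrt (energy S.d C D n) ≤ (1 + M) * ‖S.d n * D n‖ := fun n => by
    refine Real.sqrt_le_iff.2 ⟨by positivity, ?_⟩
    rw [mul_pow]
    exact hen n
  have hBs : Summable fun n => ‖S.d n * D n‖ ^ 2 :=
    Summable.of_nonneg_of_le (fun _ => by positivity)
      (fun n => by rw [energy]; exact le_add_of_nonneg_left (by positivity)) h.summable_energy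
  have hR : ∀ n : ℕ, ((n : ℝ) + 1) ^ S.ν * |R n| ≤ μ * Q * ((1 + M) * ‖S.d n * D n‖) := by
    intro n
    have hp : (0 : ℝ) < ((n : ℝ) + 1) ^ S.ν := by positivity
    rcases le_total N₀ n with hn | hn
    · calc _ ≤ ((n : ℝ) + 1) ^ S.ν * (μ / ((n : ℝ) + 1) ^ S.ν * Real.sqrt (energy S.d C D n)) := by
            gcongr
            exact h.bound_R_ge n hn
        _ = μ * 1 * Real.sqrt (energy S.d C D n) := by field_simp
        _ ≤ _ := by gcongr; exact hsq n
    · have hnN : (n : ℝ) ≤ N₀ := by exact_mod_cast hn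
      calc _ ≤ Q * (μ * Real.sqrt (energy S.d C D n)) := by
            gcongr
            · exact Real.rpow_le_rpow (by positivity) (by linarith) hν
            · exact h.bound_R_le n hn
        _ = μ * Q * Real.sqrt (energy S.d C D n) := by ring
        _ ≤ _ := by gcongr; exact hsq n
  have hdom : ∀ n k, k ≠ 5 → ‖x (n, k)‖ ≤ L * ‖x (n, 2)‖ := by
    intro n k hk
    rw [x2]
    have hB := norm_nonneg (S.d n * D n)
    have hbase : ∀ a, a ≤ L → a * ‖S.d n * D n‖ ≤ L * ‖S.d n * D n‖ := fun a ha =>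
      mul_le_mul_of_nonneg_right ha hB
    fin_cases k
    · exact (x0 n).le.trans ((h.bound_C n).trans (hbase M (by linarith)))
    · exact (x1 n).le.trans ((h.bound_C n).trans (hbase M (by linarith)))
    · exact (x2 n).le.trans ((one_mul _).ge.trans (hbase 1 (by linarith)))
    · exact (x3 n).le.trans ((one_mul _).ge.trans (hbase 1 (by linarith)))
    · refine (x4 n).le.trans ((hR n).trans ?_)
      rw [← mul_assoc]
      exact hbase _ (by linarith)
    · exact absurd rfl hk
  have hE : ‖x (0, 5)‖ ^ 2 ≤ M * (1 + M) ^ 2 * ∑' n, ‖S.d n * D n‖ ^ 2 := by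
    rw [x50, Complex.norm_real, Real.norm_eq_abs, mul_assoc, ← tsum_mul_left]
    refine h.bound_E.trans (mul_le_mul_of_nonneg_left ?_ hM)
    exact h.summable_energy.tsum_le_tsum hen (hBs.mul_left _)
  have hfib : ∀ k, Summable fun n => ‖x (n, k)‖ ^ 2 := fun k => by
    by_cases hk : k = 5
    · subst hk
      refine (hasSum_single 0 fun n hn => ?_).summable
      rw [x5 n hn]; simp
    · refine Summable.of_nonneg_of_le (fun _ => by positivity) (fun n => ?_) (hBs.mul_left (L ^ 2))
      have := pow_le_pow_left₀ (norm_nonneg _) (hdom n k hk) 2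
      rwa [mul_pow, x2] at this
  refine ⟨⟨hdom, x5⟩, ?_, ?_⟩
  · refine (summable_prod_of_nonneg fun _ => by positivity).2
      ⟨fun n => (hasSum_fintype _).summable, ?_⟩
    simp only [tsum_fintype]
    exact summable_sum fun k _ => hfib k
  · simp only [x2]
    refine hE.trans (mul_le_mul_of_nonneg_right (by linarith) (tsum_nonneg fun _ => by positivity))

end ExpSystem

end WaveMemory

end

/-! ### The two-sided estimate. -/

theorem mainTheorem3
    (ω ζ : ℕ → ℂ) (r : ℕ → ℝ) (c d : ℕ → ℂ) (η : ℝ)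
    (hω_inj : Function.Injective ω) (hζ_inj : Function.Injective ζ)
    (hr_inj : Function.Injective r)
    (hωζ : ∀ n m, ω n ≠ ζ m)
    (hωζ_conj : ∀ n m, ω n ≠ starRingEnd ℂ (ζ m))
    (hωζ_refl : ∀ n m, ω n ≠ -starRingEnd ℂ (ζ m))
    (hζ_refl : ∀ n m, ζ n ≠ -starRingEnd ℂ (ζ m))
    (hrω : ∀ n m, (r n : ℂ) ≠ Complex.I * ω m)
    (hrζ : ∀ n m, (r n : ℂ) ≠ Complex.I * ζ m)
    (hrη : ∀ n, r n ≠ -η)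
    (hζ_ne : ∀ n, ζ n ≠ 0)
    (γ α χ : ℝ) (N₀ : ℕ) (μ ν M : ℝ)
    (hγ : 0 < γ) (hα : 0 < α) (hχ : χ < 0) (hμ : 0 < μ) (hν : 1 / 2 < ν) (hM : 0 < M)
    (hω_gap : liminf (fun n => (ω (n + 1)).re - (ω n).re) atTop = γ)
    (hζ_gap : liminf (fun n => (ζ (n + 1)).re - (ζ n).re) atTop = γ)
    (hω_im : Tendsto (fun n => (ω n).im) atTop (𝓝 α))
    (hr_lim : Tendsto r atTop (𝓝 χ))
    (hζ_im : Tendsto (fun n => (ζ n).im) atTop (𝓝 0))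
    (hd : ∃ a b : ℝ, 0 < a ∧ 0 < b ∧ ∀ n, a * ‖d n‖ ≤ ‖ζ n‖ ∧ ‖ζ n‖ ≤ b * ‖d n‖)
    (hc : ∀ n, ‖c n‖ * ‖ω n‖ ≤ M)
    (T : ℝ) (hT : 2 * Real.pi / γ < T) :
    ∃ c₁ c₂ : ℝ, 0 < c₁ ∧ 0 < c₂ ∧
      ∀ (C D : ℕ → ℂ) (R : ℕ → ℝ) (𝓔 : ℝ),
        WaveMemory.AdmissibleCoeffs d N₀ μ ν M C D R 𝓔 →
          (∃ u₁ u₂ : ℝ → ℂ, WaveMemory.IsSolutionPair T η ω ζ r c d C D R 𝓔 u₁ u₂) ∧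
          ∀ u₁ u₂ : ℝ → ℂ, WaveMemory.IsSolutionPair T η ω ζ r c d C D R 𝓔 u₁ u₂ →
            c₁ * (∫ t in (0 : ℝ)..T, (‖u₁ t‖ ^ 2 + ‖u₂ t‖ ^ 2)) ≤
                ∑' n, WaveMemory.energy d C D n ∧
              ∑' n, WaveMemory.energy d C D n ≤
                c₂ * (∫ t in (0 : ℝ)..T, (‖u₁ t‖ ^ 2 + ‖u₂ t‖ ^ 2)) := by
  obtain ⟨a, b, -, -, hab⟩ := hd
  have hd0 : ∀ n, d n ≠ 0 := fun n h0 => by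
    have := (hab n).2
    rw [h0, norm_zero, mul_zero] at this
    exact hζ_ne n (norm_le_zero_iff.1 this)
  set S : WaveMemory.ExpSystem := ⟨ω, ζ, c, d, r, η, ν⟩ with hS
  have hreg : S.Regular γ α χ M b :=
    ⟨hγ, hω_gap, hζ_gap, hω_im, hζ_im, hr_lim, hc, hd0, fun n => (hab n).2, hν⟩
  have hsep : S.Separated := ⟨hζ_inj, hωζ, hωζ_refl, hζ_refl⟩
  have hT0 : 0 < T := lt_trans (by positivity) hT
  set L := 1 + M + μ * ((N₀ : ℝ) + 1) ^ ν * (1 + M) + M * (1 + M) ^ 2 with hL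
  have hL0 : 0 < L := by positivity
  obtain ⟨K, hK0, hK⟩ := hreg.exists_besselBound_vec hT0
  obtain ⟨c₀, hc₀, hobs⟩ := hreg.exists_observability hsep hT hL0.le
  have hA : 0 < (K + 1) * (5 * L ^ 2 + L) := by positivity
  -- The constant c₁ combines the Bessel constant (K + 1 to ensure positivity) with the comparison
  -- of all slots to slot 2. In c₂ the factor (1 + M)² bounds the energy by |d_nD_n|² and c₀ is the
  -- observability constant.
  refine ⟨((K + 1) * (5 * L ^ 2 + L))⁻¹, (1 + M) ^ 2 * c₀, inv_pos.2 hA, by positivity,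
    fun C D R 𝓔 h => ?_⟩
  set x := S.coeff C D R 𝓔 with hx
  have hadm : x ∈ WaveMemory.ExpSystem.admissible L :=
    WaveMemory.ExpSystem.coeff_mem_admissible S (by change 0 ≤ ν; linarith) N₀ hμ.le hM.le h
  have hy := (hK.summable hadm.2.1).hasSum
  set y := ∑' p, x p • S.vec T p with hydef
  have hiff := WaveMemory.ExpSystem.isSolutionPair_iff (S := S) hd0 hy
  refine ⟨⟨y.fst, y.snd, (hiff _ _).2 ⟨Lp.memLp _, Lp.memLp _, Lp.toLp_coeFn _ _,
    Lp.toLp_coeFn _ _⟩⟩, fun u₁ u₂ hu => ?_⟩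
  obtain ⟨h₁, h₂, e₁, e₂⟩ := (hiff u₁ u₂).1 hu
  rw [WaveMemory.ExpSystem.integral_eq_norm_sq hT0.le h₁ h₂ e₁ e₂]
  have hB : Summable fun n => ‖d n * D n‖ ^ 2 := WaveMemory.ExpSystem.summable_fiber hadm.2.1 2
  have hBtot : ∑' n, ‖d n * D n‖ ^ 2 ≤ ∑' p, ‖x p‖ ^ 2 :=
    tsum_comp_le_tsum_of_inj hadm.2.1 (fun p => by positivity)
      (i := fun n : ℕ => (n, (2 : Fin 6))) fun _ _ h => (Prod.mk.inj h).1
  constructor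
  · rw [inv_mul_le_iff₀ hA]
    have s1 := hK.norm_sq_le hy (hadm.2.1.mul_left K)
    rw [tsum_mul_left] at s1
    have s2 : ∑' p, ‖x p‖ ^ 2 ≤ (5 * L ^ 2 + L) * ∑' n, ‖d n * D n‖ ^ 2 :=
      WaveMemory.ExpSystem.tsum_norm_sq_le_of_mem_admissible hadm
    have s3 : ∑' n, ‖d n * D n‖ ^ 2 ≤ ∑' n, WaveMemory.energy d C D n :=
      hB.tsum_le_tsum (fun n => le_add_of_nonneg_left (by positivity)) h.summable_energy
    calc ‖y‖ ^ 2 ≤ K * ∑' p, ‖x p‖ ^ 2 := s1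
      _ ≤ (K + 1) * ((5 * L ^ 2 + L) * ∑' n, WaveMemory.energy d C D n) := by
          gcongr
          · linarith
          · exact s2.trans (by gcongr)
      _ = _ := by ring
  · have hen : ∀ n, WaveMemory.energy d C D n ≤ (1 + M) ^ 2 * ‖d n * D n‖ ^ 2 := fun n => by
      have := pow_le_pow_left₀ (norm_nonneg _) (h.bound_C n) 2
      rw [WaveMemory.energy]
      nlinarith [mul_nonneg hM.le (sq_nonneg ‖d n * D n‖)]
    calc ∑' n, WaveMemory.energy d C D n ≤ ∑' n, (1 + M) ^ 2 * ‖d n * D n‖ ^ 2 :=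
          h.summable_energy.tsum_le_tsum hen (hB.mul_left _)
      _ = (1 + M) ^ 2 * ∑' n, ‖d n * D n‖ ^ 2 := tsum_mul_left
      _ ≤ (1 + M) ^ 2 * (c₀ * ‖y‖ ^ 2) := by
          gcongr
          exact hBtot.trans (hobs x hadm)
      _ = _ := by ring
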